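/- **Setting.** Let $V$ be the complex vector space with basis $e_{-1},\dots,e_{-5},e_1,\dots,e_5$ and quadratic form $Q(\sum_i (u_{-i}e_{-i}+u_ie_i))=\sum_{i=1}^5u_{-i}u_i$. Let $U_\infty=\langle e_1,\dots,e_5\rangle$ and $S^+=\Lambda^{\mathrm{even}}U_\infty$, with basis $e_I=e_{i_1}\wedge\dots\wedge e_{i_k}$ ($I=\{i_1<\dots<i_k\}\subset\{1,\dots,5\}$, $k$ even) and coordinates $x_I$ ($x_0:=x_\emptyset$), so $\mathbb P(S^+)=\mathbb P^{15}$. Let $v\in V$ act on $\Lambda U_\infty$ by $\varphi_v$, where $e_i$ acts by left wedge multiplication and $e_{-i}$ by contraction of $e_i$. The class of a nonzero $s\in S^+$ is the half spinor of a Lagrangian (5-dimensional totally isotropic) $U\subset V$ if $\varphi_u(s)=0$ for all $u\in U$; $\operatorname{OG}(5,10)\subset\mathbb P^{15}$ is the set of the half spinors in $S^+$ of Lagrangians. For $t=[t_0:t_1]$ let $C_t\subset\mathbb P^6$ be the union of the following components $C_t^v$ (given by their ideals): $0$: $\langle y_5,y_4,y_3,y_2,y_1\rangle$; $1$: $\langle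 y_6,y_5,y_4,y_3,y_2\rangle$; $2$: $\langle y_6,y_5,y_4,y_3,y_0-y_1\rangle$; $34$: $\langle t_0y_2y_3-t_1y_2y_4+(t_1-t_0)y_3y_4,\ y_6,\ y_5,\ y_1-y_2+y_4,\ y_0-y_2+y_3\rangle$; $5$: $\langle y_6,y_3-y_4,y_2-y_4+y_5,y_1,y_0\rangle$; $6$: $\langle y_4-y_5,y_3-y_5+y_6,y_2,y_1,y_0\rangle$; $7$: $\langle y_5-y_6,y_3,y_2,y_1,y_0\rangle$; $8$: $\langle y_4,y_3,y_2,y_1,y_0\rangle$; $9$: $\langle y_5,y_4,y_2,y_1,y_0+y_3+y_6\rangle$; $10$: $\langle y_6,y_5,y_3,y_2,y_0\rangle$; $11$: $\langle y_6,y_4,y_3,y_1,y_0\rangle$. The ideal of $C_t$ is generated by the quadrics $$\begin{aligned} g_0&=-t_0y_1y_3+t_1y_0y_4,\\ g_1&=-(t_0-t_1)y_0y_3-t_1y_2y_3-(t_0-t_1)y_3^2+t_1y_2y_4+(t_0-t_1)y_3y_4-(t_0-t_1)y_3y_6,\\ g_2&=(t_0-t_1)y_1y_3+t_1y_2y_3-t_1y_2y_4,\\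 g_3&=t_0y_2y_3-t_1y_2y_4-(t_0-t_1)y_3y_4+(t_0-t_1)y_3y_5,\\ g_4&=-t_1y_0y_2+t_1y_1y_2-t_1y_2y_3+t_1y_2y_4,\\ g_5&=y_2y_6,\quad g_6=y_1y_5,\quad g_7=y_0y_5+y_3y_5-y_4y_5+y_4y_6,\quad g_8=y_1y_6,\quad g_9=y_3y_5-y_4y_5+y_4y_6, \end{aligned}$$ which satisfy $\sum_{i=0}^4g_ig_{i+5}=0$; identify $g_{i-1}$ with $e_{-i}$ and $g_{i+4}$ with $e_i$. For $t\notin\{0,1,\infty\}$ and a smooth point $p$ of $C_t$ (where the Jacobian matrix has rank 5), let $\rho(p)\in\mathbb P^{15}$ be the half spinor of the row space of the Jacobian matrix $[\partial g_j/\partial y_i(p)]$. Let $X_t^v$ be the Zariski closure of the image under $\rho$ of the smooth points of $C_t$ lying on $C_t^v$, and $X_t=\bigcup_vX_t^v$. Use the coordinates $[t_0:t_1]=[1:s]$, so that $t\to1$ means $s\to1$ and $t\to\infty$ means $s\to0$, and let $X_1,X_\infty$ and $X_1^v,X_\infty^v$ be (the supports of) the flat limits in $\mathbb P^{15}$ of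 $X_t$ and $X_t^v$ as $t\to1$, $t\to\infty$. Let $P_t\subset\mathbb P^{15}$ be the linear subspace $$x_{2345}=x_{1245}=x_{1234}=x_{14}=0,\quad t_0x_{25}-t_1x_{35}-t_0x_{45}=0,\quad x_{23}=x_{25},\quad x_{15}+x_{25}-x_{35}-x_{45}=0,\quad x_{12}=x_{13},\quad x_0+t_1x_{25}-t_1x_{35}-t_1x_{45}=0,$$ and $Y_t=P_t\cap\operatorname{OG}(5,10)$; here $Y_1$ and $Y_\infty$ are taken at $(t_0,t_1)=(1,1)$ and $(1,0)$. **Proposition.** (1) The irreducible components of $X_1$ are twelve lines: $X_1^v$ for $v\ne34$ (called line $v$), and two lines, called line $3$ and line $4$, with $X_1^{34}$ their union, where line $3$ meets lines $9$ and $10$ and line $4$ meets lines $2$ and $5$. If $v$–$w$ is one of the pairs named below, lines $v$ and $w$ meet in exactly one point, the node $v$–$w$. The set $Y_1$ has exactly five irreducible components, each of dimension $2$: * the linear span of lines $0$ and $9$; * the scroll swept out by the lines joining each point $p$ of line $1$ to its image on line $3$ under the unique isomorphism of line $1$ with line $3$ that maps the (distinct) nodes $0$–$1$, $1$–$2$,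 $1$–$10$ to the (distinct) nodes $3$–$9$, $3$–$4$, $3$–$10$ respectively; this scroll contains line $10$; * the linear span of lines $2$ and $4$; * the linear span of lines $5$ and $11$; * the scroll swept out by the lines joining each point $p$ of line $6$ to its image on line $8$ under the unique isomorphism of line $6$ with line $8$ that maps the (distinct) nodes $5$–$6$, $6$–$7$, $6$–$9$ to the (distinct) nodes $8$–$11$, $7$–$8$, $0$–$8$ respectively; this scroll contains line $7$. (2) The irreducible components of $X_\infty$ are the eleven sets $X_\infty^v$; those with $v\neq34$ are lines, and $X_\infty^{34}$ is an irreducible quadric curve (a conic) in a plane. The set $Y_\infty$ has exactly eight irreducible components: the six lines $X_\infty^v$ for $v=0,1,2,7,10,11$; the irreducible conic $X_\infty^{34}$; and the linear span of the lines $X_\infty^5,X_\infty^6,X_\infty^8,X_\infty^9$, which is a plane $\mathbb P^2$. -/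

import Mathlib

open scoped LinearAlgebra.Projectivization

noncomputable section

namespace SpinorModel

/-! ### Zariski topology on a projective space over `ℂ` -/

/-- The polynomial `F` vanishes at the point `p` of projective space, that is, on the whole line
of vectors which `p` represents. -/
def VanishesAt {σ : Type} (F : MvPolynomial σ ℂ) (p : ℙ ℂ (σ → ℂ)) : Prop :=
  ∀ v ∈ p.submodule, MvPolynomial.eval v F = 0

/-- The Zariski topology: the non-vanishing loci of homogeneous polynomials are a basis. -/
instance zariskiTopology {σ : Type} : TopologicalSpace (ℙ ℂ (σ → ℂ)) :=
  TopologicalSpace.generateFrom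
    {U | ∃ (n : ℕ) (F : MvPolynomial σ ℂ), F.IsHomogeneous n ∧ U = {p | ¬ VanishesAt F p}}

/-- The irreducible components of a subset `Y` of a topological space: the maximal irreducible
subsets of `Y`. -/
def componentsOf {T : Type} [TopologicalSpace T] (Y : Set T) : Set (Set T) :=
  {Z | Maximal (fun Z' => Z' ⊆ Y ∧ IsIrreducible Z') Z}

/-! ### The quadratic space, the half-spin space and the orthogonal Grassmannian -/

/-- The ten-dimensional space `V`: the basis vector at `Sum.inl i` is `e_{-(i+1)}` and the basis
vector at `Sum.inr i` is `e_{i+1}`, for `i = 0, …, 4`. -/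
abbrev QuadSpace : Type := Fin 5 ⊕ Fin 5 → ℂ

/-- `Q = ∑ u_{-i} u_i`. -/
def quadForm (u : QuadSpace) : ℂ := ∑ i : Fin 5, u (Sum.inl i) * u (Sum.inr i)

/-- Lagrangian subspaces: totally isotropic of dimension five. -/
def IsLagrangian (U : Submodule ℂ QuadSpace) : Prop :=
  Module.finrank ℂ U = 5 ∧ ∀ u ∈ U, quadForm u = 0

/-- The exterior algebra of `U_∞ = ⟨e_1, …, e_5⟩` in its standard basis: `s I` is the coefficient
of `e_I`, where the element `i : Fin 5` of `I` stands for the basis vector `e_{i+1}`. -/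
abbrev Ext : Type := Finset (Fin 5) → ℂ

/-- The sign of moving `e_{i+1}` past the factors of `e_J` with smaller index. -/
def koszulSign (i : Fin 5) (J : Finset (Fin 5)) : ℂ := (-1) ^ (J.filter (fun j => j < i)).card

/-- Left multiplication by `e_{i+1}`. -/
def wedge (i : Fin 5) (s : Ext) : Ext :=
  fun J => if i ∈ J then koszulSign i J * s (J.erase i) else 0

/-- Contraction of `e_{i+1}`. -/
def contract (i : Fin 5) (s : Ext) : Ext :=
  fun J => if i ∈ J then 0 else koszulSign i J * s (insert i J)

/-- The Clifford action `φ_u` of a vector `u`: `e_{-i}` contracts `e_i`, and `e_i` wedges. -/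
def clifford (u : QuadSpace) (s : Ext) : Ext :=
  ∑ i : Fin 5, (u (Sum.inl i) • contract i s + u (Sum.inr i) • wedge i s)

/-- The sixteen indices of the coordinates of `S⁺`: subsets with an even number of elements. -/
abbrev EvenIdx : Type := {I : Finset (Fin 5) // Even I.card}

/-- The half-spin space `S⁺`, the even part of the exterior algebra. -/
abbrev HalfSpin : Type := EvenIdx → ℂ

/-- The inclusion of `S⁺` in the exterior algebra. It also gives the coordinates: `x_I` of `s` is
`toExt s I` (with indices shifted by one). -/
def toExt (s : HalfSpin) : Ext := fun I => if h : Even I.card then s ⟨I, h⟩ else 0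

/-- The projective space `ℙ(S⁺) = ℙ¹⁵`. -/
abbrev PS : Type := ℙ ℂ HalfSpin

/-- `x` is the class of a half spinor in `S⁺` of the subspace `U`: all `φ_u`, `u ∈ U`, kill it. -/
def IsHalfSpinorOf (U : Submodule ℂ QuadSpace) (x : PS) : Prop :=
  ∀ s ∈ x.submodule, ∀ u ∈ U, clifford u (toExt s) = 0

/-- The orthogonal Grassmannian `OG(5,10)` in `ℙ(S⁺)`: the half spinors of Lagrangians. -/
def orthGrassmannian : Set PS :=
  {x | ∃ U : Submodule ℂ QuadSpace, IsLagrangian U ∧ IsHalfSpinorOf U x}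

/-! ### The family of reducible nodal curves -/

/-- The vertices of the graph `G`; the irreducible components of the curves are labelled by
them. -/
inductive Vertex : Type
  | v0 | v1 | v2 | v34 | v5 | v6 | v7 | v8 | v9 | v10 | v11

open MvPolynomial in
/-- The ten quadrics `g_0, …, g_9` in `y_0, …, y_6` that generate the ideal of `C_t`,
`t = [t₀ : t₁]`; the identity `∑ g_i g_{i+5} = 0` holds, and `g_i`, `g_{i+5}` are regarded as the
basis vectors `e_{-(i+1)}`, `e_{i+1}` of the quadratic space. -/
def quadrics (t₀ t₁ : ℂ) : Fin 5 ⊕ Fin 5 → MvPolynomial (Fin 7) ℂ :=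
  Sum.elim
    ![-C t₀ * X 1 * X 3 + C t₁ * X 0 * X 4,
      -C (t₀ - t₁) * X 0 * X 3 - C t₁ * X 2 * X 3 - C (t₀ - t₁) * X 3 ^ 2 + C t₁ * X 2 * X 4
        + C (t₀ - t₁) * X 3 * X 4 - C (t₀ - t₁) * X 3 * X 6,
      C (t₀ - t₁) * X 1 * X 3 + C t₁ * X 2 * X 3 - C t₁ * X 2 * X 4,
      C t₀ * X 2 * X 3 - C t₁ * X 2 * X 4 - C (t₀ - t₁) * X 3 * X 4 + C (t₀ - t₁) * X 3 * X 5,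
      -C t₁ * X 0 * X 2 + C t₁ * X 1 * X 2 - C t₁ * X 2 * X 3 + C t₁ * X 2 * X 4]
    ![X 2 * X 6,
      X 1 * X 5,
      X 0 * X 5 + X 3 * X 5 - X 4 * X 5 + X 4 * X 6,
      X 1 * X 6,
      X 3 * X 5 - X 4 * X 5 + X 4 * X 6]

open MvPolynomial in
/-- Generators of the ideals of the components of the canonical curve `C_t` in `ℙ⁶`. -/
def componentGens (t₀ t₁ : ℂ) : Vertex → List (MvPolynomial (Fin 7) ℂ)
  | .v0 => [X 5, X 4, X 3, X 2, X 1]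
  | .v1 => [X 6, X 5, X 4, X 3, X 2]
  | .v2 => [X 6, X 5, X 4, X 3, X 0 - X 1]
  | .v34 => [C t₀ * X 2 * X 3 - C t₁ * X 2 * X 4 + C (-t₀ + t₁) * X 3 * X 4,
      X 6, X 5, X 1 - X 2 + X 4, X 0 - X 2 + X 3]
  | .v5 => [X 6, X 3 - X 4, X 2 - X 4 + X 5, X 1, X 0]
  | .v6 => [X 4 - X 5, X 3 - X 5 + X 6, X 2, X 1, X 0]
  | .v7 => [X 5 - X 6, X 3, X 2, X 1, X 0]
  | .v8 => [X 4, X 3, X 2, X 1, X 0]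
  | .v9 => [X 5, X 4, X 2, X 1, X 0 + X 3 + X 6]
  | .v10 => [X 6, X 5, X 3, X 2, X 0]
  | .v11 => [X 6, X 4, X 3, X 1, X 0]

/-- The component `C_t^v` of the canonical curve `C_t ⊂ ℙ⁶`. -/
def canonicalComponent (t₀ t₁ : ℂ) (v : Vertex) : Set (ℙ ℂ (Fin 7 → ℂ)) :=
  {p | ∀ f ∈ componentGens t₀ t₁ v, VanishesAt f p}

/-- The row space `W_p^⊥` of the Jacobian matrix `[∂ g_j / ∂ y_i (p)]` at the vector `y`
representing `p`, as a subspace of the quadratic space. -/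
def jacobianRowSpace (t₀ t₁ : ℂ) (y : Fin 7 → ℂ) : Submodule ℂ QuadSpace :=
  Submodule.span ℂ (Set.range fun (i : Fin 7) (j : Fin 5 ⊕ Fin 5) =>
    MvPolynomial.eval y (MvPolynomial.pderiv i (quadrics t₀ t₁ j)))

/-- The graph of `ρ`: the point `p` of `C_t` is smooth (by the Jacobian criterion the Jacobian
matrix has rank `5 = 6 - 1` there), and `x` is the half spinor of the row space `W_p^⊥`. -/
def IsRho (t₀ t₁ : ℂ) (p : ℙ ℂ (Fin 7 → ℂ)) (x : PS) : Prop :=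
  Module.finrank ℂ (jacobianRowSpace t₀ t₁ p.rep) = 5 ∧
    IsHalfSpinorOf (jacobianRowSpace t₀ t₁ p.rep) x

/-- `X_t^v`, the spinor embedding of `C_t^v`: the Zariski closure of the image under `ρ` of the
smooth points of `C_t` on `C_t^v`. -/
def spinorComponent (t₀ t₁ : ℂ) (v : Vertex) : Set PS :=
  closure {x | ∃ p ∈ canonicalComponent t₀ t₁ v, IsRho t₀ t₁ p x}

/-- `X_t`, the union of the `X_t^v`. -/
def spinorCurve (t₀ t₁ : ℂ) : Set PS := ⋃ v, spinorComponent t₀ t₁ v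

/-- The (support of the) flat limit at `s = a` of a family `Z s` of subsets of `ℙ¹⁵`, given for
`s ≠ 0, 1`: the fibre over `a` of the Zariski closure of the total space
`{(s, z) | s ≠ 0, 1, z ∈ Z s}` in `𝔸¹ × ℙ¹⁵`. The closed subsets of `𝔸¹ × ℙ¹⁵` are cut out by
polynomials with coefficients in `ℂ[s]` which are homogeneous in the coordinates of `ℙ¹⁵`. -/
def flatLimit (Z : ℂ → Set PS) (a : ℂ) : Set PS :=
  {x | ∀ (n : ℕ) (F : MvPolynomial EvenIdx (Polynomial ℂ)), F.IsHomogeneous n →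
    (∀ s : ℂ, s ≠ 0 → s ≠ 1 → ∀ z ∈ Z s,
      VanishesAt (MvPolynomial.map (Polynomial.evalRingHom s) F) z) →
    VanishesAt (MvPolynomial.map (Polynomial.evalRingHom a) F) x}

/-- The limit of the component `X_t^v` for `t = [1 : s]` and `s → a`; so `a = 1` is the limit
`t → 1` and `a = 0` is the limit `t → ∞`. -/
def limitComponent (a : ℂ) (v : Vertex) : Set PS := flatLimit (fun s => spinorComponent 1 s v) a

/-- The flat limit of the curve `X_t` for `t = [1 : s]` and `s → a`. Thus `limitCurve 1` is `X_1`
and `limitCurve 0` is `X_∞`. -/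
def limitCurve (a : ℂ) : Set PS := flatLimit (fun s => spinorCurve 1 s) a

/-- The vectors of the seven-dimensional space `P_t ⊂ S⁺`; the coordinate `x_{i j …}` of `s` is
`toExt s {i - 1, j - 1, …}`. -/
def linearEqs (t₀ t₁ : ℂ) (s : HalfSpin) : Prop :=
  let x := toExt s
  x {1, 2, 3, 4} = 0 ∧
  x {0, 1, 3, 4} = 0 ∧
  x {0, 1, 2, 3} = 0 ∧
  t₀ * x {1, 4} - t₁ * x {2, 4} - t₀ * x {3, 4} = 0 ∧
  x {1, 2} - x {1, 4} = 0 ∧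
  x {0, 4} + x {1, 4} - x {2, 4} - x {3, 4} = 0 ∧
  x {0, 3} = 0 ∧
  x {0, 1} - x {0, 2} = 0 ∧
  x ∅ + t₁ * x {1, 4} - t₁ * x {2, 4} - t₁ * x {3, 4} = 0

/-- The projective linear space `P_t ⊂ ℙ(S⁺)`. -/
def linearSpace (t₀ t₁ : ℂ) : Set PS := {x | ∀ s ∈ x.submodule, linearEqs t₀ t₁ s}

/-- `Y_t = P_t ∩ OG(5,10)`. -/
def linearSection (t₀ t₁ : ℂ) : Set PS := linearSpace t₀ t₁ ∩ orthGrassmannian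

/-! ### Lines, spans, conics and scrolls -/

/-- The projective linear span of a set of points. -/
def projSpan (A : Set PS) : Set PS := (Projectivization.Subspace.span A : Set PS)

/-- `L` is a projective line. -/
def IsLine (L : Set PS) : Prop :=
  ∃ W : Submodule ℂ HalfSpin, Module.finrank ℂ W = 2 ∧ L = (W.projectivization : Set PS)

/-- `A` is a projective plane. -/
def IsPlane (A : Set PS) : Prop :=
  ∃ W : Submodule ℂ HalfSpin, Module.finrank ℂ W = 3 ∧ A = (W.projectivization : Set PS)

/-- `A` is an irreducible quadric in a plane: it is irreducible, its span is a plane, and it is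
cut out in this plane by one quadratic form. -/
def IsIrreducibleConic (A : Set PS) : Prop :=
  IsIrreducible A ∧ IsPlane (projSpan A) ∧
    ∃ q : QuadraticForm ℂ HalfSpin, A = {x | x ∈ projSpan A ∧ ∀ s ∈ x.submodule, q s = 0}

/-- `f` is an isomorphism of projective lines, that is, it is induced by an isomorphism of the
underlying two-dimensional vector spaces. -/
def IsLineIso {L L' : Set PS} (f : L → L') : Prop :=
  ∃ (W W' : Submodule ℂ HalfSpin) (φ : W ≃ₗ[ℂ] W'),
    Module.finrank ℂ W = 2 ∧ L = (W.projectivization : Set PS) ∧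
    L' = (W'.projectivization : Set PS) ∧
    ∀ (a : L) (w : W), (w : HalfSpin) ∈ (a : PS).submodule →
      ((φ w : W') : HalfSpin) ∈ (f a : PS).submodule

/-- `Z` is the scroll swept out by the lines that join a point of the line `L` to its image under
the isomorphism `L → L'` which maps the three distinct points `p i` of `L` to the three distinct
points `p' i` of `L'`. -/
def IsScroll (Z L L' : Set PS) (p p' : Fin 3 → PS) : Prop :=
  Function.Injective p ∧ Function.Injective p' ∧ (∀ i, p i ∈ L) ∧ (∀ i, p' i ∈ L') ∧
  ∃ f : L → L',
    (∀ h : L → L', (IsLineIso h ∧ ∀ (i : Fin 3) (a : L), (a : PS) = p i → (h a : PS) = p' i) ↔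
      h = f) ∧
    Z = ⋃ a : L, projSpan {(a : PS), (f a : PS)}

end SpinorModel

end

noncomputable section
namespace SpinorModel

/-! ### The Zariski topology -/

section Zariski

open MvPolynomial Filter Topology

variable {σ : Type}

theorem eval_smul_of_isHomogeneous {F : MvPolynomial σ ℂ} {n : ℕ} (hF : F.IsHomogeneous n)
    (c : ℂ) (v : σ → ℂ) : eval (c • v) F = c ^ n * eval v F := by
  rw [eval_eq, eval_eq, Finset.mul_sum]
  refine Finset.sum_congr rfl fun d hd => ?_
  have hdeg : d.degree = n := by
    by_contra h
    exact (MvPolynomial.mem_support_iff.mp hd) (hF.coeff_eq_zero h)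
  simp only [Pi.smul_apply, smul_eq_mul, mul_pow, Finset.prod_mul_distrib,
    Finset.prod_pow_eq_pow_sum]
  rw [← hdeg, Finsupp.degree_apply]
  ring

theorem vanishesAt_mk_iff {F : MvPolynomial σ ℂ} {n : ℕ} (hF : F.IsHomogeneous n)
    {v : σ → ℂ} (hv : v ≠ 0) :
    VanishesAt F (Projectivization.mk ℂ v hv) ↔ eval v F = 0 := by
  constructor
  · intro h
    exact h v (by rw [Projectivization.submodule_mk]; exact Submodule.mem_span_singleton_self v)
  · intro h w hw
    rw [Projectivization.submodule_mk] at hw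
    obtain ⟨c, rfl⟩ := Submodule.mem_span_singleton.mp hw
    rw [eval_smul_of_isHomogeneous hF, h, mul_zero]

theorem vanishesAt_mul_iff {F G : MvPolynomial σ ℂ} {n m : ℕ} (hF : F.IsHomogeneous n)
    (hG : G.IsHomogeneous m) (x : ℙ ℂ (σ → ℂ)) :
    VanishesAt (F * G) x ↔ VanishesAt F x ∨ VanishesAt G x := by
  induction x using Projectivization.ind with
  | h v hv =>
    rw [vanishesAt_mk_iff hF, vanishesAt_mk_iff hG, vanishesAt_mk_iff (hF.mul hG), map_mul,
      mul_eq_zero]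

theorem isClosed_setOf_vanishesAt {F : MvPolynomial σ ℂ} {n : ℕ} (hF : F.IsHomogeneous n) :
    IsClosed {p : ℙ ℂ (σ → ℂ) | VanishesAt F p} :=
  ⟨TopologicalSpace.isOpen_generateFrom_of_mem ⟨n, F, hF, rfl⟩⟩

/-- Products of forms are forms, so the non-vanishing loci are stable under finite intersections and
form a basis. Consequently a closed set is separated from an outside point by a single form. -/
theorem exists_form_of_isOpen {U : Set (ℙ ℂ (σ → ℂ))} (hU : IsOpen U) {x : ℙ ℂ (σ → ℂ)}
    (hx : x ∈ U) : ∃ (n : ℕ) (F : MvPolynomial σ ℂ), F.IsHomogeneous n ∧ ¬ VanishesAt F x ∧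
      ∀ y, ¬ VanishesAt F y → y ∈ U := by
  induction hU generalizing x with
  | basic s hs =>
    obtain ⟨n, F, hF, rfl⟩ := hs
    exact ⟨n, F, hF, hx, fun y hy => hy⟩
  | univ =>
    refine ⟨0, 1, isHomogeneous_one _ _, fun h => ?_, fun y _ => trivial⟩
    simpa using h 0 (Submodule.zero_mem _)
  | inter s t _ _ hs ht =>
    obtain ⟨n, F, hF, hFx, hFs⟩ := hs hx.1
    obtain ⟨m, G, hG, hGx, hGt⟩ := ht hx.2
    refine ⟨n + m, F * G, hF.mul hG, ?_, fun y hy => ?_⟩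
    · rw [vanishesAt_mul_iff hF hG]; tauto
    · rw [vanishesAt_mul_iff hF hG] at hy
      exact ⟨hFs y (by tauto), hGt y (by tauto)⟩
  | sUnion S _ hS =>
    obtain ⟨s, hs, hxs⟩ := hx
    obtain ⟨n, F, hF, hFx, hFs⟩ := hS s hs hxs
    exact ⟨n, F, hF, hFx, fun y hy => ⟨s, hs, hFs y hy⟩⟩

theorem exists_form_of_isClosed {K : Set (ℙ ℂ (σ → ℂ))} (hK : IsClosed K) {x : ℙ ℂ (σ → ℂ)}
    (hx : x ∉ K) : ∃ (n : ℕ) (F : MvPolynomial σ ℂ), F.IsHomogeneous n ∧ ¬ VanishesAt F x ∧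
      ∀ y ∈ K, VanishesAt F y := by
  obtain ⟨n, F, hF, hFx, h⟩ := exists_form_of_isOpen hK.isOpen_compl hx
  exact ⟨n, F, hF, hFx, fun y hy => by_contra fun hn => h y hn hy⟩

/-- The cone of vectors over a set of points of a projective space, including `0`. -/
def coneOver (K : Set (ℙ ℂ (σ → ℂ))) : Set (σ → ℂ) :=
  {z | ∀ h : z ≠ 0, Projectivization.mk ℂ z h ∈ K}

theorem coneOver_mono {K K' : Set (ℙ ℂ (σ → ℂ))} (h : K ⊆ K') : coneOver K ⊆ coneOver K' :=
  fun _ hz h0 => h (hz h0)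

theorem smul_mem_coneOver {K : Set (ℙ ℂ (σ → ℂ))} {z : σ → ℂ} (hz : z ∈ coneOver K) (c : ℂ) :
    c • z ∈ coneOver K := by
  intro h
  have hz0 : z ≠ 0 := right_ne_zero_of_smul h
  have : Projectivization.mk ℂ (c • z) h = Projectivization.mk ℂ z hz0 :=
    (Projectivization.mk_eq_mk_iff' ℂ _ _ h hz0).mpr ⟨c, rfl⟩
  rw [this]
  exact hz hz0

/-- Zariski closed sets are closed in the classical topology. -/
theorem isClosed_coneOver {K : Set (ℙ ℂ (σ → ℂ))} (hK : IsClosed K) :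
    IsClosed (coneOver K) := by
  rw [← isOpen_compl_iff, isOpen_iff_mem_nhds]
  intro z hz
  simp only [coneOver, Set.mem_compl_iff, Set.mem_ofPred_eq, not_forall] at hz
  obtain ⟨h0, hz⟩ := hz
  obtain ⟨n, F, hF, hFz, hFK⟩ := exists_form_of_isClosed hK hz
  rw [vanishesAt_mk_iff hF] at hFz
  have h1 : ∀ᶠ y in 𝓝 z, eval y F ≠ 0 :=
    (MvPolynomial.continuous_eval F).continuousAt.eventually_ne hFz
  filter_upwards [h1, eventually_ne_nhds h0] with y hy1 hy2 hy3
  exact hy1 ((vanishesAt_mk_iff hF hy2).mp (hFK _ (hy3 hy2)))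

/-- This is how special points are reached: a Zariski closed cone is classically closed, so
membership at general nearby parameters passes to the limit. -/
theorem mem_coneOver_of_eventually {K : Set (ℙ ℂ (σ → ℂ))} (hK : IsClosed K) {z : ℂ → σ → ℂ}
    {a : ℂ} (hz : ContinuousAt z a) (h : ∀ᶠ ε in 𝓝[≠] a, z ε ∈ coneOver K) :
    z a ∈ coneOver K :=
  (isClosed_coneOver hK).mem_of_tendsto (hz.tendsto.mono_left nhdsWithin_le_nhds) h

/-- A set of points with a polynomial parametrisation is irreducible. -/
theorem isIrreducible_of_parametrization {τ : Type} {S : Set (ℙ ℂ (σ → ℂ))} (hS : S.Nonempty)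
    (φ : σ → MvPolynomial τ ℂ) (h₁ : ∀ v, (fun i => eval v (φ i)) ∈ coneOver S)
    (h₂ : ∀ x ∈ S, ∃ v h, Projectivization.mk ℂ (fun i => eval v (φ i)) h = x) :
    IsIrreducible S := by
  refine ⟨hS, ?_⟩
  rintro U U' hU hU' ⟨x, hxS, hxU⟩ ⟨y, hyS, hyU⟩
  obtain ⟨n, F, hF, hFx, hFU⟩ := exists_form_of_isOpen hU hxU
  obtain ⟨m, G, hG, hGy, hGU⟩ := exists_form_of_isOpen hU' hyU
  have key : ∀ (v : τ → ℂ) (H : MvPolynomial σ ℂ),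
      eval v (bind₁ φ H) = eval (fun i => eval v (φ i)) H := by
    intro v H
    rw [← MvPolynomial.coe_aeval_eq_eval, ← MvPolynomial.coe_aeval_eq_eval]
    exact MvPolynomial.aeval_bind₁ _ _ _
  obtain ⟨v, hv, rfl⟩ := h₂ x hxS
  obtain ⟨w, hw, rfl⟩ := h₂ y hyS
  rw [vanishesAt_mk_iff hF, ← key] at hFx
  rw [vanishesAt_mk_iff hG, ← key] at hGy
  obtain ⟨i, hi⟩ := Function.ne_iff.mp hv
  have h1 : bind₁ φ F ≠ 0 := fun h => hFx (by rw [h, map_zero])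
  have h2 : bind₁ φ G ≠ 0 := fun h => hGy (by rw [h, map_zero])
  have h3 : φ i ≠ 0 := fun h => hi (by simp [h])
  -- A product of nonzero polynomials over ℂ is nonzero at some parameter. The third factor keeps
  -- the parametrised vector away from 0, so that it defines a point.
  obtain ⟨u, hu⟩ : ∃ u, eval u (bind₁ φ F * bind₁ φ G * φ i) ≠ 0 := by
    by_contra! hc
    exact mul_ne_zero (mul_ne_zero h1 h2) h3 (MvPolynomial.funext (fun x => by simpa using hc x))
  simp only [map_mul, mul_ne_zero_iff, key] at hu
  have hu0 : (fun i => eval u (φ i)) ≠ 0 := fun h => hu.2 (congrFun h i)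
  refine ⟨Projectivization.mk ℂ _ hu0, h₁ u hu0, hFU _ ?_, hGU _ ?_⟩
  · rw [vanishesAt_mk_iff hF]; exact hu.1.1
  · rw [vanishesAt_mk_iff hG]; exact hu.1.2

end Zariski

/-- The components of a finite union of irreducible closed sets without inclusions. -/
theorem componentsOf_iUnion {T ι : Type} [TopologicalSpace T] [Finite ι] (Z : ι → Set T)
    (hc : ∀ i, IsClosed (Z i)) (hi : ∀ i, IsIrreducible (Z i))
    (h : ∀ i j, Z i ⊆ Z j → i = j) :
    componentsOf (⋃ i, Z i) = Set.range Z := by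
  -- An irreducible set covered by finitely many closed sets lies in one of them.
  have key : ∀ A : Set T, IsIrreducible A → A ⊆ ⋃ i, Z i → ∃ i, A ⊆ Z i := by
    intro A hA hAZ
    obtain ⟨z, hz, hAz⟩ := isIrreducible_iff_sUnion_isClosed.mp hA
      (Set.finite_range Z).toFinset (by simpa using hc) (by simpa using hAZ)
    obtain ⟨i, rfl⟩ : z ∈ Set.range Z := by simpa using hz
    exact ⟨i, hAz⟩
  ext A
  constructor
  · intro (hA : Maximal (fun B => B ⊆ ⋃ i, Z i ∧ IsIrreducible B) A)
    obtain ⟨i, hAi⟩ := key A hA.prop.2 hA.prop.1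
    exact ⟨i, (hA.eq_of_subset ⟨Set.subset_iUnion Z i, hi i⟩ hAi).symm⟩
  · rintro ⟨i, rfl⟩
    refine ⟨⟨Set.subset_iUnion Z i, hi i⟩, fun B hB hiB => ?_⟩
    obtain ⟨j, hj⟩ := key B hB.2 hB.1
    rwa [h i j (hiB.trans hj)]

theorem ncard_range_of_not_subset {T ι : Type} (Z : ι → Set T)
    (h : ∀ i j, Z i ⊆ Z j → i = j) : (Set.range Z).ncard = Nat.card ι := by
  have hinj : Function.Injective Z := fun i j hij => h i j hij.subset
  rw [← Set.image_univ, Set.ncard_image_of_injective _ hinj, Set.ncard_univ]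

/-! ### Flat limits -/

section FlatLimit

open MvPolynomial Filter Topology

/-- Continuity must be joint, because along a section both the parameter and the point move. -/
theorem continuous_eval_map (F : MvPolynomial EvenIdx (Polynomial ℂ)) :
    Continuous fun p : ℂ × HalfSpin => eval p.2 (map (Polynomial.evalRingHom p.1) F) := by
  simp only [eval_map, eval₂_eq, Polynomial.coe_evalRingHom]
  refine continuous_finsetSum _ fun d _ => ?_
  refine ((Polynomial.continuous _).comp continuous_fst).mul ?_
  exact continuous_finsetProd _ fun i _ =>
    ((continuous_apply i).comp continuous_snd).pow _

theorem isClosed_flatLimit (Z : ℂ → Set PS) (a : ℂ) : IsClosed (flatLimit Z a) := by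
  have : flatLimit Z a = ⋂ (n : ℕ) (F : MvPolynomial EvenIdx (Polynomial ℂ))
      (_ : F.IsHomogeneous n) (_ : ∀ s : ℂ, s ≠ 0 → s ≠ 1 → ∀ z ∈ Z s,
      VanishesAt (map (Polynomial.evalRingHom s) F) z),
      {x | VanishesAt (map (Polynomial.evalRingHom a) F) x} := by
    ext x; simp [flatLimit]
  rw [this]
  exact isClosed_iInter fun n => isClosed_iInter fun F => isClosed_iInter fun hF =>
    isClosed_iInter fun _ => isClosed_setOf_vanishesAt (hF.map _)

theorem flatLimit_mono {Z Z' : ℂ → Set PS} (h : ∀ s, s ≠ 0 → s ≠ 1 → Z s ⊆ Z' s) (a : ℂ) :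
    flatLimit Z a ⊆ flatLimit Z' a :=
  fun _ hx n F hF hZ => hx n F hF fun s h0 h1 z hz => hZ s h0 h1 z (h s h0 h1 hz)

/-- The limit of a continuous section lies in the flat limit. -/
theorem mem_flatLimit_of_section {Z : ℂ → Set PS} {a : ℂ} {z : ℂ → HalfSpin}
    (hz : ContinuousAt z a) (h : ∀ s, s ≠ 0 → s ≠ 1 → z s ∈ coneOver (Z s)) :
    z a ∈ coneOver (flatLimit Z a) := by
  intro hza n F hF hZ
  rw [vanishesAt_mk_iff (hF.map _)]
  have hc : ContinuousAt (fun s => eval (z s) (map (Polynomial.evalRingHom s) F)) a :=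
    (continuous_eval_map F).continuousAt.comp (f := fun s => (s, z s)) (continuousAt_id.prodMk hz)
  have h0 : ∀ᶠ s in 𝓝[≠] a, eval (z s) (map (Polynomial.evalRingHom s) F) = 0 := by
    have hne : ∀ b : ℂ, ∀ᶠ s in 𝓝[≠] a, s ≠ b := by
      intro b
      rcases eq_or_ne a b with rfl | hab
      · exact self_mem_nhdsWithin
      · exact (eventually_ne_nhds hab).filter_mono nhdsWithin_le_nhds
    filter_upwards [hne 0, hne 1, (hz.eventually_ne hza).filter_mono nhdsWithin_le_nhds]
      with s hs0 hs1 hzs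
    rw [← vanishesAt_mk_iff (hF.map _) hzs]
    exact hZ s hs0 hs1 _ (h s hs0 hs1 hzs)
  exact tendsto_nhds_unique (hc.tendsto.mono_left nhdsWithin_le_nhds)
    (tendsto_const_nhds.congr' (h0.mono fun s hs => hs.symm))

/-- A point outside every limit violates one equation of each family. The product of these finitely
many equations vanishes on the whole union for s ≠ 0, 1 but not at the point. -/
theorem flatLimit_iUnion {ι : Type} [Finite ι] (Z : ι → ℂ → Set PS) (a : ℂ) :
    flatLimit (fun s => ⋃ i, Z i s) a = ⋃ i, flatLimit (Z i) a := by
  apply Set.Subset.antisymm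
  · intro x hx
    by_contra hn
    simp only [Set.mem_iUnion, not_exists] at hn
    have : ∀ i, ∃ (n : ℕ) (F : MvPolynomial EvenIdx (Polynomial ℂ)), F.IsHomogeneous n ∧
        (∀ s : ℂ, s ≠ 0 → s ≠ 1 → ∀ z ∈ Z i s,
          VanishesAt (map (Polynomial.evalRingHom s) F) z) ∧
        ¬ VanishesAt (map (Polynomial.evalRingHom a) F) x := by
      intro i
      have := hn i
      simp only [flatLimit, Set.mem_ofPred_eq, not_forall] at this
      obtain ⟨n, F, hF, h1, h2⟩ := this
      exact ⟨n, F, hF, h1, h2⟩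
    choose n F hF hZ hx' using this
    have := Fintype.ofFinite ι
    have hP : (∏ i, F i).IsHomogeneous (∑ i, n i) := IsHomogeneous.prod _ _ _ fun i _ => hF i
    have := hx _ _ hP fun s h0 h1 z hz => by
      obtain ⟨i, hi⟩ := Set.mem_iUnion.mp hz
      intro v hv
      rw [map_prod, map_prod]
      exact Finset.prod_eq_zero (Finset.mem_univ i) (hZ i s h0 h1 z hi v hv)
    induction x using Projectivization.ind with
    | h v hv =>
      rw [vanishesAt_mk_iff (hP.map _), map_prod, map_prod, Finset.prod_eq_zero_iff] at this
      obtain ⟨i, -, hi⟩ := this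
      exact hx' i ((vanishesAt_mk_iff ((hF i).map _) hv).mpr hi)
  · exact Set.iUnion_subset fun i =>
      flatLimit_mono (Z' := fun s => ⋃ i, Z i s)
        (fun s _ _ => Set.subset_iUnion (fun i => Z i s) i) a

end FlatLimit

/-! ### Dimension -/

section Dimension

open MvPolynomial

variable {σ : Type}

/-- The polynomials that vanish on the cone over `K`. -/
def coneIdeal (K : Set (ℙ ℂ (σ → ℂ))) : Ideal (MvPolynomial σ ℂ) where
  carrier := {p | ∀ z ∈ coneOver K, eval z p = 0}
  add_mem' hp hq z hz := by rw [map_add, hp z hz, hq z hz, add_zero]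
  zero_mem' z _ := map_zero _
  smul_mem' c p hp z hz := by rw [smul_eq_mul, map_mul, hp z hz, mul_zero]

theorem mem_coneIdeal {K : Set (ℙ ℂ (σ → ℂ))} {p : MvPolynomial σ ℂ} :
    p ∈ coneIdeal K ↔ ∀ z ∈ coneOver K, eval z p = 0 := Iff.rfl

theorem zero_mem_coneOver (K : Set (ℙ ℂ (σ → ℂ))) : (0 : σ → ℂ) ∈ coneOver K :=
  fun h => (h rfl).elim

theorem coneIdeal_anti {K K' : Set (ℙ ℂ (σ → ℂ))} (h : K ⊆ K') : coneIdeal K' ≤ coneIdeal K :=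
  fun _ hp z hz => hp z (coneOver_mono h hz)

theorem coneIdeal_ne_top (K : Set (ℙ ℂ (σ → ℂ))) : coneIdeal K ≠ ⊤ := by
  intro h
  have h1 : (1 : MvPolynomial σ ℂ) ∈ coneIdeal K := h ▸ Submodule.mem_top
  simpa using h1 0 (zero_mem_coneOver K)

/-- Along a ray of the cone, p(cz) is a polynomial in c whose coefficients are the values at z of
the homogeneous components. It vanishes for all c, so every coefficient is 0. -/
theorem homogeneousComponent_mem_coneIdeal {K : Set (ℙ ℂ (σ → ℂ))} {p : MvPolynomial σ ℂ}
    (hp : p ∈ coneIdeal K) (n : ℕ) : homogeneousComponent n p ∈ coneIdeal K := by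
  intro z hz
  have key : (∑ i ∈ Finset.range (p.totalDegree + 1),
      Polynomial.monomial i (eval z (homogeneousComponent i p))) = 0 := by
    refine Polynomial.funext fun c => ?_
    have h1 := hp (c • z) (smul_mem_coneOver hz c)
    rw [← sum_homogeneousComponent p, map_sum] at h1
    rw [Polynomial.eval_finsetSum, Polynomial.eval_zero, ← h1]
    refine Finset.sum_congr rfl fun i _ => ?_
    rw [eval_smul_of_isHomogeneous (homogeneousComponent_isHomogeneous i p),
      Polynomial.eval_monomial, mul_comm]
  by_cases hn : n < p.totalDegree + 1
  · have h2 := congrArg (fun q => Polynomial.coeff q n) key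
    simpa [Polynomial.finsetSum_coeff, Polynomial.coeff_monomial, hn] using h2
  · rw [homogeneousComponent_eq_zero n p (by omega), map_zero]

/-- The ideal is homogeneous, so primality need only be tested on forms, where it is the
irreducibility of K. The empty set is deliberately allowed: its cone is {0}, which yields the
irrelevant ideal. -/
theorem coneIdeal_isPrime {K : Set (ℙ ℂ (σ → ℂ))} (hK : IsPreirreducible K) :
    (coneIdeal K).IsPrime := by
  let := MvPolynomial.gradedAlgebra (σ := σ) (R := ℂ)
  have hhom : (coneIdeal K).IsHomogeneous (homogeneousSubmodule σ ℂ) := by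
    intro i p hp
    have : ((DirectSum.decompose (homogeneousSubmodule σ ℂ) p) i : MvPolynomial σ ℂ) =
        homogeneousComponent i p := decomposition.decompose'_apply p i
    rw [this]
    exact homogeneousComponent_mem_coneIdeal hp i
  refine hhom.isPrime_of_homogeneous_mem_or_mem (coneIdeal_ne_top K) ?_
  rintro f g ⟨n, hf⟩ ⟨m, hg⟩ hfg
  have hf : f.IsHomogeneous n := hf
  have hg : g.IsHomogeneous m := hg
  by_contra! hne
  have hpt : ∀ {p : MvPolynomial σ ℂ} {n : ℕ}, p.IsHomogeneous n → K.Nonempty →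
      p ∉ coneIdeal K → (K ∩ {x | ¬ VanishesAt p x}).Nonempty := by
    rintro p n hp ⟨x, hx⟩ hpK
    simp only [mem_coneIdeal, not_forall] at hpK
    obtain ⟨z, hz, hpz⟩ := hpK
    by_cases h0 : z = 0
    · subst h0
      exact ⟨x, hx, fun h => hpz (h 0 (Submodule.zero_mem _))⟩
    · exact ⟨_, hz h0, by
        rw [Set.mem_ofPred_eq, vanishesAt_mk_iff hp h0]; exact hpz⟩
  by_cases hne' : K.Nonempty
  · obtain ⟨x, hx, hxf, hxg⟩ := hK _ _ (isClosed_setOf_vanishesAt hf).isOpen_compl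
      (isClosed_setOf_vanishesAt hg).isOpen_compl (hpt hf hne' hne.1) (hpt hg hne' hne.2)
    rcases (vanishesAt_mul_iff hf hg x).mp
      (fun v hv => hfg v fun h0 => by
        have : Projectivization.mk ℂ v h0 = x := by
          apply Projectivization.submodule_injective
          rw [Projectivization.submodule_mk]
          refine Submodule.eq_of_le_of_finrank_eq
            ((Submodule.span_singleton_le_iff_mem _ _).mpr hv) ?_
          rw [finrank_span_singleton h0, Projectivization.finrank_submodule]
        rwa [this]) with h | h
    · exact hxf h
    · exact hxg h
  · rw [Set.not_nonempty_iff_eq_empty] at hne'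
    subst hne'
    have h0 : ∀ {p : MvPolynomial σ ℂ}, p ∉ coneIdeal (∅ : Set (ℙ ℂ (σ → ℂ))) →
        eval 0 p ≠ 0 := by
      intro p hp h
      refine hp fun z hz => ?_
      by_cases hz0 : z = 0
      · rwa [hz0]
      · exact (hz hz0).elim
    have := hfg 0 (zero_mem_coneOver _)
    rw [map_mul] at this
    exact mul_ne_zero (h0 hne.1) (h0 hne.2) this

theorem coneIdeal_lt {K K' : Set (ℙ ℂ (σ → ℂ))} (hK : IsClosed K) (h : K ⊂ K') :
    coneIdeal K' < coneIdeal K := by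
  refine lt_of_le_of_ne (coneIdeal_anti h.subset) fun he => ?_
  obtain ⟨x, hxK', hxK⟩ := Set.exists_of_ssubset h
  obtain ⟨n, F, hF, hFx, hFK⟩ := exists_form_of_isClosed hK hxK
  -- Empty K is separate: the separating form may then be a nonzero constant, which does not vanish
  -- at the apex of the cone. A coordinate that is nonzero at x serves instead.
  obtain hemp | ⟨y, hy⟩ := Set.eq_empty_or_nonempty K
  rotate_left
  · have hmem : F ∈ coneIdeal K := by
      intro z hz
      by_cases h0 : z = 0
      · rw [h0]; exact hFK y hy 0 (Submodule.zero_mem _)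
      · exact (vanishesAt_mk_iff hF h0).mp (hFK _ (hz h0))
    rw [← he] at hmem
    refine hFx ?_
    induction x using Projectivization.ind with
    | h v hv =>
      rw [vanishesAt_mk_iff hF hv]
      refine hmem v fun h0 => ?_
      exact hxK'
  · induction x using Projectivization.ind with
    | h v hv =>
      obtain ⟨i, hi⟩ := Function.ne_iff.mp hv
      have hmem : X i ∈ coneIdeal K := by
        intro z hz
        by_cases h0 : z = 0
        · simp [h0]
        · rw [hemp] at hz; exact (hz h0).elim
      rw [← he] at hmem
      exact hi (by simpa using hmem v fun _ => hxK')

/-- The image of a chain can be prolonged by m below and by z above, so it gains two steps. -/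
theorem krullDim_le_of_strictMono_of_lt {α β : Type*} [Preorder α] [Preorder β] {g : α → β}
    (hg : StrictMono g) {m z : β} (hm : ∀ c, m < g c) (hz : ∀ c, g c < z) {n : ℕ}
    (h : Order.krullDim β ≤ ((n + 2 : ℕ) : WithBot ℕ∞)) : Order.krullDim α ≤ n := by
  refine iSup_le fun p => ?_
  let q₀ : LTSeries β := p.map g hg
  let q₁ : LTSeries β := RelSeries.cons q₀ m (hm _)
  have hq₁ : q₁.last = q₀.last := RelSeries.last_cons q₀ m (hm _)
  have hlast : q₁.last < z := hq₁ ▸ hz _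
  let q : LTSeries β := RelSeries.snoc q₁ z hlast
  have hq : q.length = p.length + 2 := by
    have h1 : q.length = q₁.length + 0 + 1 := rfl
    have h2 : q₁.length = 0 + q₀.length + 1 := rfl
    have h3 : q₀.length = p.length := rfl
    omega
  have hdim := (Order.LTSeries.length_le_krullDim q).trans h
  rw [hq] at hdim
  have h3 : p.length + 2 ≤ n + 2 := by exact_mod_cast hdim
  have h4 : p.length ≤ n := by omega
  exact_mod_cast h4

/-- A closed subset of a projective space `ℙⁿ⁺¹` on which a non-zero polynomial vanishes has
dimension at most `n`. -/
theorem topologicalKrullDim_le {n : ℕ} {T : Set (ℙ ℂ (σ → ℂ))} (hT : IsClosed T)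
    (φ : σ → MvPolynomial (Fin (n + 2)) ℂ) (j : Fin (n + 2) → σ) (hφ : ∀ k, φ (j k) = X k)
    (hTφ : ∀ z ∈ coneOver T, ∀ i, z i = eval (fun k => z (j k)) (φ i))
    (f : MvPolynomial (Fin (n + 2)) ℂ) (hf : f ≠ 0)
    (hfT : ∀ z ∈ coneOver T, eval (fun k => z (j k)) f = 0) :
    topologicalKrullDim T ≤ n := by
  let R := MvPolynomial (Fin (n + 2)) ℂ
  -- Substitution of φ is surjective, and its kernel lies in the cone ideal of every subset of T.
  -- These ideals are therefore recovered from their images in R, so strict inclusions survive.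
  let θ : MvPolynomial σ ℂ →+* R := (bind₁ φ : MvPolynomial σ ℂ →ₐ[ℂ] R).toRingHom
  have hθ : ∀ p, θ p = bind₁ φ p := fun p => rfl
  have hθe : ∀ z ∈ coneOver T, ∀ p, eval (fun k => z (j k)) (θ p) = eval z p := by
    intro z hz p
    have : z = fun i => eval (fun k => z (j k)) (φ i) := funext (hTφ z hz)
    conv_rhs => rw [this]
    rw [hθ, ← MvPolynomial.coe_aeval_eq_eval, ← MvPolynomial.coe_aeval_eq_eval]
    exact MvPolynomial.aeval_bind₁ _ _ _
  have hθr : ∀ p, θ (rename j p) = p := by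
    intro p
    rw [hθ, bind₁_rename]
    have : φ ∘ j = X := funext hφ
    rw [this, bind₁_X_left, AlgHom.id_apply]
  have hsurj : Function.Surjective θ := fun p => ⟨_, hθr p⟩
  have hker : ∀ K ⊆ T, RingHom.ker θ ≤ coneIdeal K := by
    intro K hK p hp z hz
    rw [RingHom.mem_ker] at hp
    rw [← hθe z (coneOver_mono hK hz), hp, map_zero]
  have hcomap : ∀ K ⊆ T, (((coneIdeal K).map θ).comap θ) = coneIdeal K := by
    intro K hK
    rw [Ideal.comap_map_of_surjective θ hsurj]
    exact sup_eq_left.mpr (hker K hK)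
  have hlt : ∀ K K' : Set (ℙ ℂ (σ → ℂ)), K' ⊆ T → IsClosed K → K ⊂ K' →
      (coneIdeal K').map θ < (coneIdeal K).map θ := by
    intro K K' hK' hK h
    refine lt_of_le_of_ne (Ideal.map_mono (coneIdeal_anti h.subset)) fun he => ?_
    have := congrArg (Ideal.comap θ) he
    rw [hcomap K' hK', hcomap K (h.subset.trans hK')] at this
    exact (coneIdeal_lt hK h).ne this
  let P : ∀ K : Set (ℙ ℂ (σ → ℂ)), K ⊆ T → IsPreirreducible K → PrimeSpectrum R :=
    fun K hK hp => ⟨(coneIdeal K).map θ,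
      haveI := coneIdeal_isPrime hp
      Ideal.map_isPrime_of_surjective hsurj (hker K hK)⟩
  let im : TopologicalSpace.IrreducibleCloseds T → Set (ℙ ℂ (σ → ℂ)) :=
    fun c => Subtype.val '' (c : Set T)
  have himT : ∀ c, im c ⊆ T := by
    rintro c _ ⟨x, -, rfl⟩
    exact x.2
  have himi : ∀ c, IsIrreducible (im c) := fun c =>
    c.isIrreducible.image _ continuous_subtype_val.continuousOn
  have himc : ∀ c, IsClosed (im c) := fun c =>
    hT.isClosedEmbedding_subtypeVal.isClosedMap _ c.isClosed
  let g : TopologicalSpace.IrreducibleCloseds T → (PrimeSpectrum R)ᵒᵈ :=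
    fun c => OrderDual.toDual (P (im c) (himT c) (himi c).isPreirreducible)
  have hg : StrictMono g := by
    intro c c' hcc
    refine OrderDual.toDual_lt_toDual.mpr ?_
    have hss : im c ⊂ im c' :=
      (Subtype.val_injective.injOn.image_ssubset_image_iff (Set.subset_univ _)
        (Set.subset_univ _)).mpr hcc
    exact hlt _ _ (himT c') (himc c) hss
  -- Every chain of primes gains two members: the irrelevant ideal, which comes from the empty set,
  -- and the zero ideal, which is strictly smaller because of f. As R has dimension n + 2, chains in
  -- T have length at most n.
  let m : PrimeSpectrum R := P ∅ (Set.empty_subset _) isPreirreducible_empty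
  let z : PrimeSpectrum R := ⟨⊥, Ideal.isPrime_bot⟩
  have hm : ∀ c, OrderDual.toDual m < g c := by
    intro c
    refine OrderDual.toDual_lt_toDual.mpr ?_
    exact hlt _ _ (himT c) isClosed_empty
      (Set.empty_ssubset.mpr (himi c).nonempty)
  have hz : ∀ c, g c < OrderDual.toDual z := by
    intro c
    refine OrderDual.toDual_lt_toDual.mpr ?_
    have : f ∈ (coneIdeal (im c)).map θ := by
      rw [← hθr f]
      refine Ideal.mem_map_of_mem θ fun y hy => ?_
      rw [eval_rename]
      exact hfT y (coneOver_mono (himT c) hy)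
    refine lt_of_le_of_ne (bot_le : (⊥ : Ideal R) ≤ _) fun h => hf ?_
    have h' : (coneIdeal (im c)).map θ = ⊥ := (congrArg PrimeSpectrum.asIdeal h).symm
    rw [h'] at this
    exact this
  refine krullDim_le_of_strictMono_of_lt hg hm hz ?_
  rw [Order.krullDim_orderDual]
  have := MvPolynomial.ringKrullDim_of_isNoetherianRing (R := ℂ) (ι := Fin (n + 2))
  rw [ringKrullDim_eq_zero_of_field, Nat.card_eq_fintype_card, Fintype.card_fin,
    zero_add] at this
  exact this.le

theorem two_le_topologicalKrullDim {X : Type} [TopologicalSpace X] {A B C : Set X}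
    (hA : IsIrreducible A) (hB : IsIrreducible B) (hC : IsIrreducible C)
    (hAc : IsClosed A) (hBc : IsClosed B) (hCc : IsClosed C) (hAB : A ⊂ B) (hBC : B ⊂ C) :
    2 ≤ topologicalKrullDim C := by
  have hres : ∀ D : Set X, D ⊆ C → IsIrreducible D →
      IsIrreducible (Subtype.val ⁻¹' D : Set C) := by
    intro D hD hDi
    obtain ⟨x, hx⟩ := hDi.nonempty
    refine ⟨⟨⟨x, hD hx⟩, hx⟩, ?_⟩
    rintro _ _ ⟨U, hU, rfl⟩ ⟨V, hV, rfl⟩ ⟨y, hy, hyU⟩ ⟨z, hz, hzV⟩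
    obtain ⟨w, hw, hwUV⟩ := hDi.isPreirreducible U V hU hV ⟨y, hy, hyU⟩ ⟨z, hz, hzV⟩
    exact ⟨⟨w, hD hw⟩, hw, hwUV⟩
  have hlt : ∀ D D' : Set X, D' ⊆ C → D ⊂ D' →
      (Subtype.val ⁻¹' D : Set C) ⊂ Subtype.val ⁻¹' D' := by
    intro D D' hD' h
    obtain ⟨x, hx, hxD⟩ := Set.exists_of_ssubset h
    exact (Set.ssubset_iff_of_subset (Set.preimage_mono h.subset)).mpr
      ⟨⟨x, hD' hx⟩, hx, hxD⟩
  let a : TopologicalSpace.IrreducibleCloseds C :=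
    ⟨_, hres A (hAB.subset.trans hBC.subset) hA, hAc.preimage continuous_subtype_val⟩
  let b : TopologicalSpace.IrreducibleCloseds C :=
    ⟨_, hres B hBC.subset hB, hBc.preimage continuous_subtype_val⟩
  let c : TopologicalSpace.IrreducibleCloseds C :=
    ⟨_, hres C subset_rfl hC, hCc.preimage continuous_subtype_val⟩
  have hab : a < b := hlt A B hBC.subset hAB
  have hbc : b < c := hlt B C subset_rfl hBC
  let q : LTSeries (TopologicalSpace.IrreducibleCloseds C) :=
    ⟨2, ![a, b, c], fun i => by fin_cases i; exacts [hab, hbc]⟩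
  exact Order.LTSeries.length_le_krullDim q

end Dimension

/-! ### Half spinors -/

section Spinors

/-- Adding or removing an element of a subset of `{0, …, 4}`. -/
def toggle (j : Fin 5) (J : Finset (Fin 5)) : Finset (Fin 5) :=
  if j ∈ J then J.erase j else insert j J

theorem mem_toggle_self (j : Fin 5) (J : Finset (Fin 5)) : j ∈ toggle j J ↔ j ∉ J := by
  unfold toggle; split_ifs with h <;> simp [h]

theorem mem_toggle_of_ne {i j : Fin 5} (h : i ≠ j) (J : Finset (Fin 5)) :
    i ∈ toggle j J ↔ i ∈ J := by
  unfold toggle; split_ifs <;> simp [h]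

theorem toggle_toggle (j : Fin 5) (J : Finset (Fin 5)) : toggle j (toggle j J) = J := by
  ext i
  by_cases h : i = j
  · subst h; rw [mem_toggle_self, mem_toggle_self, not_not]
  · rw [mem_toggle_of_ne h, mem_toggle_of_ne h]

/-- The coordinate of `u` which pairs with the coordinate `J` in the Clifford action. -/
def part (J : Finset (Fin 5)) (u : QuadSpace) (j : Fin 5) : ℂ :=
  if j ∈ J then u (Sum.inr j) else u (Sum.inl j)

/-- In the coefficient J each index j contributes only one of its two coordinates of u, the one
selected by `part`. All arguments on annihilators rest on this. -/
theorem clifford_apply (u : QuadSpace) (s : Ext) (J : Finset (Fin 5)) :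
    clifford u s J = ∑ j, koszulSign j J * part J u j * s (toggle j J) := by
  simp only [clifford, Finset.sum_apply, Pi.add_apply, Pi.smul_apply, smul_eq_mul, contract, wedge]
  refine Finset.sum_congr rfl fun j _ => ?_
  by_cases h : j ∈ J <;> simp [part, toggle, h] <;> ring

theorem koszulSign_ne_zero (j : Fin 5) (J : Finset (Fin 5)) : koszulSign j J ≠ 0 :=
  pow_ne_zero _ (neg_ne_zero.mpr one_ne_zero)

theorem part_congr {J I : Finset (Fin 5)} {j : Fin 5} (h : j ∈ J ↔ j ∈ I) (u : QuadSpace) :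
    part J u j = part I u j := by
  simp only [part, h]

/-- In the coefficient `toggle i I` of φ_u z every summand but the i-th involves the I-part of u and
vanishes. What remains is, up to sign, z_I times the complementary coordinate of u at i. So
annihilators of z are determined by their I-parts. -/
theorem eq_zero_of_part_eq_zero {u : QuadSpace} {z : Ext} {I : Finset (Fin 5)} (hz : z I ≠ 0)
    (hu : clifford u z = 0) (h : ∀ j, part I u j = 0) : u = 0 := by
  have h' : ∀ i, part (toggle i I) u i = 0 := by
    intro i
    have h1 := congrFun hu (toggle i I)
    rw [clifford_apply, Finset.sum_eq_single i, toggle_toggle] at h1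
    · simpa [koszulSign_ne_zero, hz] using h1
    · intro j _ hji
      rw [part_congr (mem_toggle_of_ne hji I), h j, mul_zero, zero_mul]
    · simp
  ext (i | i)
  · by_cases hi : i ∈ I
    · simpa [part, mem_toggle_self, hi] using h' i
    · simpa [part, hi] using h i
  · by_cases hi : i ∈ I
    · simpa [part, hi] using h i
    · simpa [part, mem_toggle_self, hi] using h' i

/-- The projection of a space of vectors to their `I`-part. -/
def partMap (I : Finset (Fin 5)) : QuadSpace →ₗ[ℂ] (Fin 5 → ℂ) where
  toFun u := part I u
  map_add' u v := by ext j; simp only [part, Pi.add_apply]; split_ifs <;> rfl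
  map_smul' c u := by
    ext j
    simp only [part, Pi.smul_apply, smul_eq_mul, RingHom.id_apply]
    split_ifs <;> rfl

theorem partMap_domRestrict_injective {U : Submodule ℂ QuadSpace} {z : Ext} {I : Finset (Fin 5)}
    (hz : z I ≠ 0) (hU : ∀ u ∈ U, clifford u z = 0) :
    Function.Injective ((partMap I).domRestrict U) := by
  rw [injective_iff_map_eq_zero]
  rintro ⟨u, hu⟩ h
  exact Subtype.ext (eq_zero_of_part_eq_zero hz (hU u hu) (congrFun h))

theorem finrank_le_of_clifford_eq_zero {U : Submodule ℂ QuadSpace} {z : Ext} (hz : z ≠ 0)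
    (hU : ∀ u ∈ U, clifford u z = 0) : Module.finrank ℂ U ≤ 5 := by
  obtain ⟨I, hI⟩ := Function.ne_iff.mp hz
  simpa using LinearMap.finrank_le_finrank_of_injective (partMap_domRestrict_injective hI hU)

theorem clifford_sub_smul (u : QuadSpace) (x z : Ext) (c : ℂ) :
    clifford u (x - c • z) = clifford u x - c • clifford u z := by
  ext J
  simp only [Pi.sub_apply, Pi.smul_apply, smul_eq_mul, clifford_apply, Finset.mul_sum,
    ← Finset.sum_sub_distrib]
  exact Finset.sum_congr rfl fun j _ => by ring

/-- A five-dimensional space of vectors kills at most one spinor up to scalars. -/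
theorem eq_smul_of_clifford_eq_zero {U : Submodule ℂ QuadSpace} (hU5 : Module.finrank ℂ U = 5)
    {z x : Ext} {I : Finset (Fin 5)} (hz : z I ≠ 0) (hUz : ∀ u ∈ U, clifford u z = 0)
    (hUx : ∀ u ∈ U, clifford u x = 0) : x = (x I / z I) • z := by
  have hsurj : Function.Surjective ((partMap I).domRestrict U) :=
    (LinearMap.injective_iff_surjective_of_finrank_eq_finrank (by simpa using hU5)).mp
      (partMap_domRestrict_injective hz hUz)
  set y : Ext := x - (x I / z I) • z with hy
  have hUy : ∀ u ∈ U, clifford u y = 0 := by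
    intro u hu
    rw [hy, clifford_sub_smul, hUx u hu, hUz u hu, smul_zero, sub_zero]
  have hyI : y I = 0 := by simp [hy, hz]
  -- Induction on the number of indices where J and I differ. For such an index i, surjectivity
  -- provides u ∈ U whose I-part is the i-th unit vector, and the coefficient `toggle i J` of φ_u y
  -- is inspected.
  have key : ∀ (n : ℕ) (J : Finset (Fin 5)), (symmDiff J I).card = n → y J = 0 := by
    intro n
    induction n using Nat.strong_induction_on with
    | _ n ih =>
      intro J hJ
      obtain he | ⟨i, hi⟩ := (symmDiff J I).eq_empty_or_nonempty
      · rw [← Finset.bot_eq_empty, symmDiff_eq_bot] at he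
        rw [he, hyI]
      · obtain ⟨⟨u, hu⟩, hui⟩ := hsurj (Pi.single i 1)
        have hpart : ∀ j, part I u j = (Pi.single i 1 : Fin 5 → ℂ) j := congrFun hui
        have hiJ : i ∈ toggle i J ↔ i ∈ I := by
          rw [mem_toggle_self]
          rw [Finset.mem_symmDiff] at hi
          tauto
        have h1 := congrFun (hUy u hu) (toggle i J)
        rw [clifford_apply, Finset.sum_eq_single i, toggle_toggle, part_congr hiJ, hpart i] at h1
        · simpa [koszulSign_ne_zero] using h1
        · intro j _ hji
          -- If J and I agree at j, the relevant coordinate of u is the entry j ≠ i of a unit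
          -- vector, hence 0. Otherwise toggling both i and j brings J closer to I, and the
          -- induction hypothesis kills the coordinate of y.
          by_cases hj : j ∈ toggle i J ↔ j ∈ I
          · rw [part_congr hj, hpart j]
            simp [hji]
          · have hlt : (symmDiff (toggle j (toggle i J)) I).card < n := by
              rw [← hJ]
              refine Finset.card_lt_card ?_
              rw [Finset.ssubset_iff_of_subset]
              · refine ⟨i, hi, ?_⟩
                rw [Finset.mem_symmDiff, mem_toggle_of_ne hji.symm]
                tauto
              · intro k hk
                rw [Finset.mem_symmDiff] at hk ⊢
                by_cases hkj : k = j
                · subst hkj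
                  rw [mem_toggle_self] at hk
                  tauto
                · rw [mem_toggle_of_ne hkj] at hk
                  by_cases hki : k = i
                  · subst hki; tauto
                  · rw [mem_toggle_of_ne hki] at hk
                    exact hk
            rw [ih _ hlt _ rfl, mul_zero]
        · simp
  have hy0 : y = 0 := funext fun J => key _ J rfl
  exact sub_eq_zero.mp (hy ▸ hy0)

/-- The polar form of the quadratic form `Q`. -/
def polarForm : LinearMap.BilinForm ℂ QuadSpace :=
  LinearMap.mk₂ ℂ (fun u v => ∑ j, (u (Sum.inl j) * v (Sum.inr j) + u (Sum.inr j) * v (Sum.inl j)))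
    (fun u u' v => by simp only [Pi.add_apply, ← Finset.sum_add_distrib]
                      exact Finset.sum_congr rfl fun j _ => by ring)
    (fun c u v => by simp only [Pi.smul_apply, smul_eq_mul, Finset.mul_sum]
                     exact Finset.sum_congr rfl fun j _ => by ring)
    (fun u v v' => by simp only [Pi.add_apply, ← Finset.sum_add_distrib]
                      exact Finset.sum_congr rfl fun j _ => by ring)
    (fun c u v => by simp only [Pi.smul_apply, smul_eq_mul, Finset.mul_sum]
                     exact Finset.sum_congr rfl fun j _ => by ring)

theorem polarForm_apply (u v : QuadSpace) : polarForm u v =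
    ∑ j, (u (Sum.inl j) * v (Sum.inr j) + u (Sum.inr j) * v (Sum.inl j)) := rfl

theorem polarForm_self (u : QuadSpace) : polarForm u u = 2 * quadForm u := by
  rw [polarForm_apply, quadForm, Finset.mul_sum]
  exact Finset.sum_congr rfl fun j _ => by ring

theorem polarForm_comm (u v : QuadSpace) : polarForm u v = polarForm v u := by
  rw [polarForm_apply, polarForm_apply]
  exact Finset.sum_congr rfl fun j _ => by ring

theorem polarForm_nondegenerate : polarForm.Nondegenerate := by
  have key : ∀ u : QuadSpace, (∀ v, polarForm u v = 0) → u = 0 := by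
    intro u h
    ext (i | i)
    · have := h (Pi.single (Sum.inr i) 1)
      simpa [polarForm_apply, Pi.single_apply] using this
    · have := h (Pi.single (Sum.inl i) 1)
      simpa [polarForm_apply, Pi.single_apply] using this
  exact ⟨key, fun v h => key v fun u => by rw [polarForm_comm]; exact h u⟩

/-- The vector whose product with `u` is the coordinate `K` of `φ_u z`. -/
def coordVec (z : Ext) (K : Finset (Fin 5)) : QuadSpace :=
  Sum.elim (fun j => wedge j z K) (fun j => contract j z K)

theorem polarForm_coordVec (z : Ext) (K : Finset (Fin 5)) (u : QuadSpace) :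
    polarForm (coordVec z K) u = clifford u z K := by
  simp only [polarForm_apply, coordVec, Sum.elim_inl, Sum.elim_inr, clifford, Finset.sum_apply,
    Pi.add_apply, Pi.smul_apply, smul_eq_mul]
  exact Finset.sum_congr rfl fun j _ => by ring

/-- Totally isotropic subspaces of dimension five are their own orthogonal complements. -/
theorem mem_of_isLagrangian {U : Submodule ℂ QuadSpace} (hU : IsLagrangian U) {w : QuadSpace}
    (hw : ∀ u ∈ U, polarForm w u = 0) : w ∈ U := by
  have hle : U ≤ polarForm.orthogonal U := by
    intro u hu v hv
    -- Polarisation: Q vanishes on u, v and u + v, so the bilinear form vanishes on U. Thus U lies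
    -- in its orthogonal complement, whose dimension is 10 − 5 = 5.
    have h1 := polarForm_self (u + v)
    rw [hU.2 _ (U.add_mem hu hv)] at h1
    simp only [map_add, LinearMap.add_apply, polarForm_self, hU.2 u hu, hU.2 v hv,
      polarForm_comm u v] at h1
    have : polarForm v u = 0 := by linear_combination h1 / 2
    exact this
  have hdim := LinearMap.BilinForm.finrank_orthogonal polarForm_nondegenerate
    U
  have hfin : Module.finrank ℂ QuadSpace = 10 := by simp
  have heq : U = polarForm.orthogonal U := Submodule.eq_of_le_of_finrank_eq hle (by
    rw [hdim, hfin, hU.1])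
  rw [heq]
  intro u hu
  change polarForm u w = 0
  rw [polarForm_comm]
  exact hw u hu

theorem clifford_add (u v : QuadSpace) (z : Ext) :
    clifford (u + v) z = clifford u z + clifford v z := by
  ext K
  rw [Pi.add_apply, ← polarForm_coordVec, ← polarForm_coordVec, ← polarForm_coordVec, map_add]

theorem clifford_smul_left (c : ℂ) (u : QuadSpace) (z : Ext) :
    clifford (c • u) z = c • clifford u z := by
  ext K
  rw [Pi.smul_apply, ← polarForm_coordVec, ← polarForm_coordVec, map_smul]

theorem clifford_eq_zero_of_mem_span {S : Set QuadSpace} {z : Ext}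
    (h : ∀ u ∈ S, clifford u z = 0) {u : QuadSpace} (hu : u ∈ Submodule.span ℂ S) :
    clifford u z = 0 := by
  induction hu using Submodule.span_induction with
  | mem u hu => exact h u hu
  | zero => simpa using clifford_smul_left 0 0 z
  | add u v _ _ hu hv => rw [clifford_add, hu, hv, add_zero]
  | smul c u _ hu => rw [clifford_smul_left, hu, smul_zero]

theorem toExt_smul (c : ℂ) (x : HalfSpin) : toExt (c • x) = c • toExt x := by
  ext I; simp only [toExt, Pi.smul_apply]; split_ifs <;> simp

theorem toExt_coe (x : HalfSpin) (I : EvenIdx) : toExt x I = x I := by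
  simp [toExt, I.2]

theorem toExt_ne_zero {x : HalfSpin} (hx : x ≠ 0) : toExt x ≠ 0 := by
  obtain ⟨I, hI⟩ := Function.ne_iff.mp hx
  exact fun h => hI (by rw [← toExt_coe x I, h]; rfl)

theorem clifford_smul_right (c : ℂ) (u : QuadSpace) (z : Ext) :
    clifford u (c • z) = c • clifford u z := by
  ext J
  simp only [Pi.smul_apply, smul_eq_mul, clifford_apply, Finset.mul_sum]
  exact Finset.sum_congr rfl fun j _ => by ring

theorem isHalfSpinorOf_mk_iff {U : Submodule ℂ QuadSpace} {z : HalfSpin} (hz : z ≠ 0) :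
    IsHalfSpinorOf U (Projectivization.mk ℂ z hz) ↔ ∀ u ∈ U, clifford u (toExt z) = 0 := by
  rw [IsHalfSpinorOf, Projectivization.submodule_mk]
  constructor
  · intro h u hu
    exact h z (Submodule.mem_span_singleton_self z) u hu
  · intro h s hs u hu
    obtain ⟨c, rfl⟩ := Submodule.mem_span_singleton.mp hs
    rw [toExt_smul, clifford_smul_right, h u hu, smul_zero]

/-- The equations of the orthogonal Grassmannian. -/
theorem mk_mem_orthGrassmannian_iff {z : HalfSpin} (hz : z ≠ 0) :
    Projectivization.mk ℂ z hz ∈ orthGrassmannian ↔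
      ∀ K, clifford (coordVec (toExt z) K) (toExt z) = 0 := by
  constructor
  · rintro ⟨U, hU, hUz⟩ K
    rw [isHalfSpinorOf_mk_iff] at hUz
    -- The pairing of `coordVec z K` with u is the coefficient K of φ_u z, which is 0 for u ∈ U. So
    -- this vector lies in U^⊥ = U and kills z.
    refine hUz _ (mem_of_isLagrangian hU fun u hu => ?_)
    rw [polarForm_coordVec, hUz u hu, Pi.zero_apply]
  · intro h
    -- Conversely the coordinate vectors span the Lagrangian. If z_I ≠ 0, those at the sets `toggle
    -- i I` have I-parts forming an invertible diagonal matrix, whence dimension 5; isotropy follows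
    -- from the same pairing.
    let U : Submodule ℂ QuadSpace := Submodule.span ℂ (Set.range (coordVec (toExt z)))
    have hUz : ∀ u ∈ U, clifford u (toExt z) = 0 := fun u hu =>
      clifford_eq_zero_of_mem_span (by rintro _ ⟨K, rfl⟩; exact h K) hu
    refine ⟨U, ⟨le_antisymm (finrank_le_of_clifford_eq_zero (toExt_ne_zero hz) hUz) ?_, ?_⟩,
      (isHalfSpinorOf_mk_iff hz).mpr hUz⟩
    · obtain ⟨I, hI⟩ := Function.ne_iff.mp (toExt_ne_zero hz)
      have hmem : ∀ i, coordVec (toExt z) (toggle i I) ∈ U :=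
        fun i => Submodule.subset_span ⟨_, rfl⟩
      have hval : ∀ i j, part I (coordVec (toExt z) (toggle i I)) j =
          if j = i then koszulSign i (toggle i I) * toExt z I else 0 := by
        intro i j
        rcases eq_or_ne j i with rfl | hji
        · by_cases hj : j ∈ I
          · simp [part, coordVec, hj, contract, mem_toggle_self]
            left
            simp [toggle, hj]
          · simp [part, coordVec, hj, wedge, mem_toggle_self]
            left
            simp [toggle, hj]
        · by_cases hj : j ∈ I
          · simp [part, coordVec, hj, contract, mem_toggle_of_ne hji, hji]
          · simp [part, coordVec, hj, wedge, mem_toggle_of_ne hji, hji]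
      have hLI : LinearIndependent ℂ (fun i => (⟨_, hmem i⟩ : U)) := by
        rw [Fintype.linearIndependent_iff]
        intro g hg i
        have h1 := congrArg (fun u : U => partMap I (u : QuadSpace) i) hg
        simp only [Submodule.coe_sum, Submodule.coe_smul, map_sum, map_smul, Finset.sum_apply,
          Pi.smul_apply, smul_eq_mul, ZeroMemClass.coe_zero, map_zero, Pi.zero_apply] at h1
        have h2 : ∀ k, partMap I (coordVec (toExt z) (toggle k I)) i =
          if i = k then koszulSign k (toggle k I) * toExt z I else 0 := fun k => hval k i
        simp only [h2, mul_ite, mul_zero, Finset.sum_ite_eq, Finset.mem_univ, if_true] at h1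
        simpa [koszulSign_ne_zero, show toExt z I ≠ 0 from hI] using h1
      simpa using hLI.fintype_card_le_finrank
    · intro u hu
      have h1 : ∀ v ∈ U, polarForm v u = 0 := by
        intro v hv
        induction hv using Submodule.span_induction with
        | mem v hv =>
          obtain ⟨K, rfl⟩ := hv
          rw [polarForm_coordVec, hUz u hu, Pi.zero_apply]
        | zero => simp
        | add v w _ _ hv hw => rw [map_add, LinearMap.add_apply, hv, hw, add_zero]
        | smul c v _ hv => rw [map_smul, LinearMap.smul_apply, hv, smul_zero]
      have h2 := h1 u hu
      rw [polarForm_self] at h2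
      simpa using h2

end Spinors

/-! ### The seven-dimensional spaces `P_t` -/

section Embedding

theorem forall_finset_fin_five {P : Finset (Fin 5) → Prop} : (∀ J, P J) ↔
    P ∅ ∧ P {0} ∧ P {1} ∧ P {2} ∧ P {3} ∧ P {4} ∧ P {0, 1} ∧ P {0, 2} ∧ P {0, 3} ∧ P {0, 4} ∧
    P {1, 2} ∧ P {1, 3} ∧ P {1, 4} ∧ P {2, 3} ∧ P {2, 4} ∧ P {3, 4} ∧ P {0, 1, 2} ∧
    P {0, 1, 3} ∧ P {0, 1, 4} ∧ P {0, 2, 3} ∧ P {0, 2, 4} ∧ P {0, 3, 4} ∧ P {1, 2, 3} ∧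
    P {1, 2, 4} ∧ P {1, 3, 4} ∧ P {2, 3, 4} ∧ P {0, 1, 2, 3} ∧ P {0, 1, 2, 4} ∧
    P {0, 1, 3, 4} ∧ P {0, 2, 3, 4} ∧ P {1, 2, 3, 4} ∧ P {0, 1, 2, 3, 4} := by
  refine ⟨fun h => by simp only [h, and_self], fun h J => ?_⟩
  have : J = ∅ ∨ J = {0} ∨ J = {1} ∨ J = {2} ∨ J = {3} ∨ J = {4} ∨ J = {0, 1} ∨ J = {0, 2} ∨
      J = {0, 3} ∨ J = {0, 4} ∨ J = {1, 2} ∨ J = {1, 3} ∨ J = {1, 4} ∨ J = {2, 3} ∨ J = {2, 4} ∨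
      J = {3, 4} ∨ J = {0, 1, 2} ∨ J = {0, 1, 3} ∨ J = {0, 1, 4} ∨ J = {0, 2, 3} ∨
      J = {0, 2, 4} ∨ J = {0, 3, 4} ∨ J = {1, 2, 3} ∨ J = {1, 2, 4} ∨ J = {1, 3, 4} ∨
      J = {2, 3, 4} ∨ J = {0, 1, 2, 3} ∨ J = {0, 1, 2, 4} ∨ J = {0, 1, 3, 4} ∨
      J = {0, 2, 3, 4} ∨ J = {1, 2, 3, 4} ∨ J = {0, 1, 2, 3, 4} := by
    clear h; revert J; decide
  obtain ⟨h0, h1, h2, h3, h4, h5, h6, h7, h8, h9, h10, h11, h12, h13, h14, h15, h16, h17, h18,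
    h19, h20, h21, h22, h23, h24, h25, h26, h27, h28, h29, h30, h31⟩ := h
  rcases this with rfl | rfl | rfl | rfl | rfl | rfl | rfl | rfl | rfl | rfl | rfl | rfl | rfl |
    rfl | rfl | rfl | rfl | rfl | rfl | rfl | rfl | rfl | rfl | rfl | rfl | rfl | rfl | rfl |
    rfl | rfl | rfl | rfl <;> assumption

/-- The coordinates on `Λ U_∞` of the vector of `P_t`, `t = [1 : s]`, with free coordinates `w`. -/
def embExt {R : Type*} [CommRing R] (s : R) (w : Fin 7 → R) (J : Finset (Fin 5)) : R :=
  if J = ∅ then s * (1 - s) * w 3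
  else if J = {0, 1} ∨ J = {0, 2} then w 0
  else if J = {1, 3} then w 1
  else if J = {2, 3} then w 2
  else if J = {2, 4} then w 3
  else if J = {3, 4} then w 4
  else if J = {0, 4} then (1 - s) * w 3
  else if J = {1, 2} ∨ J = {1, 4} then s * w 3 + w 4
  else if J = {0, 1, 2, 4} then w 5
  else if J = {0, 2, 3, 4} then w 6
  else 0

/-- The parametrisation of `P_t`, `t = [1 : s]`. -/
def emb {R : Type*} [CommRing R] (s : R) (w : Fin 7 → R) : EvenIdx → R := fun I => embExt s w I

theorem toExt_emb (s : ℂ) (w : Fin 7 → ℂ) : toExt (emb s w) = embExt s w := by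
  ext J
  unfold toExt emb
  split_ifs with h
  · rfl
  · revert h J
    rw [forall_finset_fin_five]
    refine ⟨?_, ?_, ?_, ?_, ?_, ?_, ?_, ?_, ?_, ?_, ?_, ?_, ?_, ?_, ?_, ?_, ?_, ?_, ?_, ?_, ?_, ?_,
      ?_, ?_, ?_, ?_, ?_, ?_, ?_, ?_, ?_, ?_⟩ <;> intro h <;>
      first | exact absurd (by decide) h | simp +decide [embExt]

theorem map_emb {R S : Type*} [CommRing R] [CommRing S] (f : R →+* S) (s : R) (w : Fin 7 → R)
    (I : EvenIdx) : f (emb s w I) = emb (f s) (fun i => f (w i)) I := by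
  simp only [emb, embExt, apply_ite f, map_mul, map_sub, map_add, map_one, map_zero]

theorem linearEqs_iff (s : ℂ) (z : HalfSpin) : linearEqs 1 s z ↔ ∃ w, emb s w = z := by
  constructor
  · intro h
    obtain ⟨h1, h2, h3, h4, h5, h6, h7, h8, h9⟩ := h
    -- Seven coordinates are read off as they stand; the nine equations determine the other nine.
    refine ⟨![toExt z {0, 1}, toExt z {1, 3}, toExt z {2, 3}, toExt z {2, 4}, toExt z {3, 4},
      toExt z {0, 1, 2, 4}, toExt z {0, 2, 3, 4}], ?_⟩
    have key : ∀ J : Finset (Fin 5), Even J.card → embExt s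
        ![toExt z {0, 1}, toExt z {1, 3}, toExt z {2, 3}, toExt z {2, 4}, toExt z {3, 4},
        toExt z {0, 1, 2, 4}, toExt z {0, 2, 3, 4}] J = toExt z J := by
      rw [forall_finset_fin_five]
      refine ⟨?_, ?_, ?_, ?_, ?_, ?_, ?_, ?_, ?_, ?_, ?_, ?_, ?_, ?_, ?_, ?_, ?_, ?_, ?_, ?_, ?_,
        ?_, ?_, ?_, ?_, ?_, ?_, ?_, ?_, ?_, ?_, ?_⟩ <;> intro h <;>
        first
          | exact absurd h (by decide)
          | (simp +decide [embExt, h1, h2, h3, h7]; done)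
          | (simp +decide [embExt]; linear_combination h8)
          | (simp +decide [embExt]; linear_combination h4 - h6)
          | (simp +decide [embExt]; linear_combination -h4)
          | (simp +decide [embExt]; linear_combination -h4 - h5)
          | (simp +decide [embExt]; linear_combination s * h4 - h9)
    funext I
    rw [← toExt_coe z I]
    exact key I I.2
  · rintro ⟨w, rfl⟩
    unfold linearEqs
    rw [toExt_emb]
    refine ⟨?_, ?_, ?_, ?_, ?_, ?_, ?_, ?_, ?_⟩ <;> simp +decide [embExt] <;> ring

/-- An even spinor is sent to an odd one, so only odd coefficients give conditions. They are listed
as five singletons, ten triples and the full set, in lexicographic order within each size. -/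
theorem clifford_emb_iff (s : ℂ) (w : Fin 7 → ℂ) (u : QuadSpace) :
    clifford u (toExt (emb s w)) = 0 ↔
    u (.inr 0) * (s * (1 - s) * w 3) - u (.inl 1) * w 0 - u (.inl 2) * w 0
      - u (.inl 4) * ((1 - s) * w 3) = 0 ∧
    u (.inl 0) * w 0 + u (.inr 1) * (s * (1 - s) * w 3) - u (.inl 2) * (s * w 3 + w 4)
      - u (.inl 3) * w 1 - u (.inl 4) * (s * w 3 + w 4) = 0 ∧
    u (.inl 0) * w 0 + u (.inl 1) * (s * w 3 + w 4) + u (.inr 2) * (s * (1 - s) * w 3)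
      - u (.inl 3) * w 2 - u (.inl 4) * w 3 = 0 ∧
    u (.inl 1) * w 1 + u (.inl 2) * w 2 + u (.inr 3) * (s * (1 - s) * w 3)
      - u (.inl 4) * w 4 = 0 ∧
    u (.inl 0) * ((1 - s) * w 3) + u (.inl 1) * (s * w 3 + w 4) + u (.inl 2) * w 3
      + u (.inl 3) * w 4 + u (.inr 4) * (s * (1 - s) * w 3) = 0 ∧
    u (.inr 0) * (s * w 3 + w 4) - u (.inr 1) * w 0 + u (.inr 2) * w 0 - u (.inl 4) * w 5 = 0 ∧
    u (.inr 0) * w 1 + u (.inr 3) * w 0 = 0 ∧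
    u (.inr 0) * (s * w 3 + w 4) - u (.inr 1) * ((1 - s) * w 3) + u (.inl 2) * w 5
      + u (.inr 4) * w 0 = 0 ∧
    u (.inr 0) * w 2 + u (.inr 3) * w 0 - u (.inl 4) * w 6 = 0 ∧
    u (.inr 0) * w 3 - u (.inl 1) * w 5 - u (.inr 2) * ((1 - s) * w 3) + u (.inl 3) * w 6
      + u (.inr 4) * w 0 = 0 ∧
    u (.inr 0) * w 4 - u (.inl 2) * w 6 - u (.inr 3) * ((1 - s) * w 3) = 0 ∧
    u (.inr 1) * w 2 - u (.inr 2) * w 1 + u (.inr 3) * (s * w 3 + w 4) = 0 ∧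
    u (.inl 0) * w 5 + u (.inr 1) * w 3 - u (.inr 2) * (s * w 3 + w 4)
      + u (.inr 4) * (s * w 3 + w 4) = 0 ∧
    u (.inr 1) * w 4 - u (.inr 3) * (s * w 3 + w 4) + u (.inr 4) * w 1 = 0 ∧
    u (.inl 0) * w 6 + u (.inr 2) * w 4 - u (.inr 3) * w 3 + u (.inr 4) * w 2 = 0 ∧
    - (u (.inr 1) * w 6) - u (.inr 3) * w 5 = 0 := by
  rw [toExt_emb, funext_iff, forall_finset_fin_five]
  simp +decide [clifford_apply, Fin.sum_univ_five, koszulSign, part, toggle, embExt,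
    Finset.filter_insert, Finset.filter_singleton, ← sub_eq_add_neg]

/-- In this form the sign at an explicit set is settled by deciding a parity. -/
theorem koszulSign_eq_ite (i : Fin 5) (J : Finset (Fin 5)) :
    koszulSign i J = if Even (J.filter (fun j => j < i)).card then 1 else -1 := by
  unfold koszulSign
  split_ifs with h
  · exact h.neg_one_pow
  · exact (Nat.not_even_iff_odd.mp h).neg_one_pow

-- Up to sign, only ten conditions are nontrivial: the Pfaffian relation x_∅ x_{ijkl} = x_{ij}x_{kl}
-- − x_{ik}x_{jl} + x_{il}x_{jk} for each four-element set, and for each i a relation between the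
-- products of x_{ij} with the coordinate at the complement of j.
set_option maxHeartbeats 1000000 in
theorem quadrics_iff (s : ℂ) (w : Fin 7 → ℂ) :
    (∀ K, clifford (coordVec (toExt (emb s w)) K) (toExt (emb s w)) = 0) ↔
      w 0 * (w 1 - w 2) = 0 ∧
      (1 - s) * w 3 * (s * w 3 + w 4) - s * (1 - s) * w 3 * w 5 + w 0 * w 3
        - w 0 * (s * w 3 + w 4) = 0 ∧
      w 0 * w 4 + (1 - s) * w 3 * w 1 = 0 ∧
      w 0 * w 4 + (1 - s) * w 3 * w 2 - s * (1 - s) * w 3 * w 6 = 0 ∧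
      (s * w 3 + w 4) * (w 2 + w 4) - w 1 * w 3 = 0 ∧
      w 0 * w 6 = 0 ∧ w 1 * w 5 = 0 ∧ w 1 * w 6 = 0 ∧
      (s * w 3 + w 4) * w 6 - w 2 * w 5 = 0 ∧ (s * w 3 + w 4) * w 6 + w 4 * w 5 = 0 := by
  constructor
  · intro H
    have val : ∀ K j, (coordVec (toExt (emb s w)) K (.inl j) = wedge j (embExt s w) K) ∧
        (coordVec (toExt (emb s w)) K (.inr j) = contract j (embExt s w) K) := by
      intro K j; rw [toExt_emb]; exact ⟨rfl, rfl⟩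
    have e0 := (clifford_emb_iff s w _).mp (H {0})
    have e1 := (clifford_emb_iff s w _).mp (H {1})
    have e2 := (clifford_emb_iff s w _).mp (H {2})
    have e3 := (clifford_emb_iff s w _).mp (H {3})
    have e4 := (clifford_emb_iff s w _).mp (H {4})
    simp +decide only [val, wedge, contract, embExt, koszulSign_eq_ite,
      if_true, if_false] at e0 e1 e2 e3 e4
    -- With indices from 0: K = {0} and the triples avoiding 0 give the Pfaffian relations of the
    -- four-element sets containing 0, and b4 gives the one of {1, 2, 3, 4}. The coefficients at the
    -- full set give the second family, one for each singleton K.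
    obtain ⟨-, -, -, -, -, -, -, -, -, -, -, a1, a2, a3, a4, a5⟩ := e0
    obtain ⟨-, -, -, -, -, -, -, -, -, -, -, -, -, -, b4, b5⟩ := e1
    obtain ⟨-, -, -, -, -, -, -, -, -, -, -, -, -, -, -, c5⟩ := e2
    obtain ⟨-, -, -, -, -, -, -, -, -, -, -, -, -, -, -, d5⟩ := e3
    obtain ⟨-, -, -, -, -, -, -, -, -, -, -, -, -, -, -, f5⟩ := e4
    refine ⟨?_, ?_, ?_, ?_, ?_, ?_, ?_, ?_, ?_, ?_⟩
    · linear_combination a1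
    · linear_combination -a2
    · linear_combination -a3
    · linear_combination -a4
    · linear_combination -b4
    · linear_combination a5
    · linear_combination b5
    · linear_combination -d5
    · linear_combination -c5
    · linear_combination -f5
  · rintro ⟨h1, h2, h3, h4, h5, h6, h7, h8, h9, h10⟩
    simp only [clifford_emb_iff]
    rw [toExt_emb, forall_finset_fin_five]
    simp +decide only [coordVec, Sum.elim_inl, Sum.elim_inr, wedge, contract, embExt,
      koszulSign_eq_ite, if_true, if_false, mul_zero, zero_mul, add_zero,
      zero_add, sub_zero, neg_zero, and_true, true_and, one_mul, neg_mul]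
    repeat' apply And.intro
    all_goals first
      | ring1
      | linear_combination h1
      | linear_combination -h1
      | linear_combination h2
      | linear_combination -h2
      | linear_combination h3
      | linear_combination -h3
      | linear_combination h4
      | linear_combination -h4
      | linear_combination h5
      | linear_combination -h5
      | linear_combination h6
      | linear_combination -h6
      | linear_combination h7
      | linear_combination -h7
      | linear_combination h8
      | linear_combination -h8
      | linear_combination h9
      | linear_combination -h9
      | linear_combination h10
      | linear_combination -h10

end Embedding

section Points

open MvPolynomial

/-! ### Subsets of `P_t` in terms of the free coordinates -/

/-- The coordinates of `ℙ¹⁵` that serve as free coordinates on `P_t`. -/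
def freeIdx : Fin 7 → EvenIdx :=
  ![⟨{0, 1}, by decide⟩, ⟨{1, 3}, by decide⟩, ⟨{2, 3}, by decide⟩, ⟨{2, 4}, by decide⟩,
    ⟨{3, 4}, by decide⟩, ⟨{0, 1, 2, 4}, by decide⟩, ⟨{0, 2, 3, 4}, by decide⟩]

theorem emb_freeIdx {R : Type*} [CommRing R] (s : R) (w : Fin 7 → R) (k : Fin 7) :
    emb s w (freeIdx k) = w k := by
  fin_cases k <;> simp +decide [emb, embExt]

theorem emb_add {R : Type*} [CommRing R] (s : R) (w w' : Fin 7 → R) :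
    emb s (w + w') = emb s w + emb s w' := by
  ext I
  simp only [emb, embExt, Pi.add_apply, ite_add_ite]
  repeat' refine if_congr Iff.rfl ?_ ?_
  all_goals ring

theorem emb_smul {R : Type*} [CommRing R] (s c : R) (w : Fin 7 → R) :
    emb s (c • w) = c • emb s w := by
  ext I
  simp only [emb, embExt, Pi.smul_apply, smul_eq_mul, mul_ite]
  repeat' refine if_congr Iff.rfl ?_ ?_
  all_goals ring

theorem emb_injective {R : Type*} [CommRing R] (s : R) :
    Function.Injective (emb s : (Fin 7 → R) → EvenIdx → R) := by
  intro w w' h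
  ext k
  rw [← emb_freeIdx s w, h, emb_freeIdx]

/-- The parametrisation of `P_t` as a linear map. -/
def embLin (s : ℂ) : (Fin 7 → ℂ) →ₗ[ℂ] HalfSpin where
  toFun := emb s
  map_add' := emb_add s
  map_smul' := emb_smul s

theorem emb_ne_zero {s : ℂ} {w : Fin 7 → ℂ} (hw : w ≠ 0) : emb s w ≠ 0 := fun h =>
  hw (emb_injective s (h.trans (map_zero (embLin s)).symm))

theorem continuous_emb : Continuous fun p : ℂ × (Fin 7 → ℂ) => emb p.1 p.2 := by
  refine continuous_pi fun I => ?_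
  unfold emb embExt
  repeat' refine continuous_if_const _ (fun _ => ?_) (fun _ => ?_)
  all_goals fun_prop

/-- The points of `P_t`, `t = [1 : s]`, whose free coordinates lie in `D`. -/
def pts (s : ℂ) (D : Set (Fin 7 → ℂ)) : Set PS :=
  {x | ∃ w ∈ D, ∃ h : w ≠ 0, Projectivization.mk ℂ (emb s w) (emb_ne_zero h) = x}

/-- Cones: sets of vectors which are stable under scalars. -/
def IsConeSet (D : Set (Fin 7 → ℂ)) : Prop := ∀ (c : ℂ), ∀ w ∈ D, c • w ∈ D

theorem mk_emb_mem_pts_iff {s : ℂ} {D : Set (Fin 7 → ℂ)} (hD : IsConeSet D) {w : Fin 7 → ℂ}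
    (h : emb s w ≠ 0) : Projectivization.mk ℂ (emb s w) h ∈ pts s D ↔ w ∈ D := by
  constructor
  · rintro ⟨w', hw', h0, he⟩
    obtain ⟨c, hc⟩ := (Projectivization.mk_eq_mk_iff' ℂ _ _ h (emb_ne_zero h0)).mp he.symm
    rw [← emb_smul] at hc
    rw [← emb_injective s hc]
    exact hD c w' hw'
  · intro hw
    exact ⟨w, hw, fun h0 => h (by rw [h0]; exact map_zero (embLin s)), rfl⟩

theorem emb_mem_coneOver_pts {s : ℂ} {D : Set (Fin 7 → ℂ)} {w : Fin 7 → ℂ} (hw : w ∈ D) :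
    emb s w ∈ coneOver (pts s D) := fun h =>
  ⟨w, hw, fun h0 => h (by rw [h0]; exact map_zero (embLin s)), rfl⟩

theorem exists_of_mem_coneOver_pts {s : ℂ} {D : Set (Fin 7 → ℂ)} (hD : IsConeSet D)
    (h0 : (0 : Fin 7 → ℂ) ∈ D) {z : HalfSpin} (hz : z ∈ coneOver (pts s D)) :
    ∃ w ∈ D, emb s w = z := by
  by_cases h : z = 0
  · exact ⟨0, h0, by rw [h]; exact map_zero (embLin s)⟩
  · obtain ⟨w, hw, hw0, he⟩ := hz h
    obtain ⟨c, hc⟩ := (Projectivization.mk_eq_mk_iff' ℂ _ _ h (emb_ne_zero hw0)).mp he.symm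
    exact ⟨c • w, hD c w hw, by rw [emb_smul, hc]⟩

theorem pts_mono (s : ℂ) {D D' : Set (Fin 7 → ℂ)} (h : ∀ w ∈ D, w ≠ 0 → w ∈ D') :
    pts s D ⊆ pts s D' := by
  rintro _ ⟨w, hw, h0, rfl⟩
  exact ⟨w, h w hw h0, h0, rfl⟩

theorem pts_subset_iff {s : ℂ} {D D' : Set (Fin 7 → ℂ)} (hD' : IsConeSet D') :
    pts s D ⊆ pts s D' ↔ ∀ w ∈ D, w ≠ 0 → w ∈ D' :=
  ⟨fun h _ hw h0 => (mk_emb_mem_pts_iff hD' _).mp (h ⟨_, hw, h0, rfl⟩), pts_mono s⟩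

theorem pts_union (s : ℂ) (D D' : Set (Fin 7 → ℂ)) : pts s (D ∪ D') = pts s D ∪ pts s D' := by
  ext x
  constructor
  · rintro ⟨w, hw | hw, h⟩
    · exact Or.inl ⟨w, hw, h⟩
    · exact Or.inr ⟨w, hw, h⟩
  · rintro (⟨w, hw, h⟩ | ⟨w, hw, h⟩)
    · exact ⟨w, Or.inl hw, h⟩
    · exact ⟨w, Or.inr hw, h⟩

theorem pts_iUnion (s : ℂ) {ι : Type} (D : ι → Set (Fin 7 → ℂ)) :
    pts s (⋃ i, D i) = ⋃ i, pts s (D i) := by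
  ext x
  simp only [Set.mem_iUnion, pts, Set.mem_ofPred_eq]
  constructor
  · rintro ⟨w, ⟨i, hi⟩, h⟩; exact ⟨i, w, hi, h⟩
  · rintro ⟨i, w, hi, h⟩; exact ⟨w, ⟨i, hi⟩, h⟩

theorem pts_inter {s : ℂ} {D D' : Set (Fin 7 → ℂ)} (hD' : IsConeSet D') :
    pts s D ∩ pts s D' = pts s (D ∩ D') := by
  ext x
  constructor
  · rintro ⟨⟨w, hw, h0, rfl⟩, h⟩
    exact ⟨w, ⟨hw, (mk_emb_mem_pts_iff hD' _).mp h⟩, h0, rfl⟩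
  · rintro ⟨w, ⟨hw, hw'⟩, h0, rfl⟩
    exact ⟨⟨w, hw, h0, rfl⟩, ⟨w, hw', h0, rfl⟩⟩

/-- The point of `P_t` with given free coordinates. -/
def pt (s : ℂ) (w : Fin 7 → ℂ) (h : w ≠ 0) : PS := Projectivization.mk ℂ (emb s w) (emb_ne_zero h)

theorem pt_mem_pts_iff {s : ℂ} {D : Set (Fin 7 → ℂ)} (hD : IsConeSet D) {w : Fin 7 → ℂ}
    (h : w ≠ 0) : pt s w h ∈ pts s D ↔ w ∈ D := mk_emb_mem_pts_iff hD _

theorem pt_eq_pt_iff {s : ℂ} {w w' : Fin 7 → ℂ} (h : w ≠ 0) (h' : w' ≠ 0) :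
    pt s w h = pt s w' h' ↔ ∃ c : ℂ, c • w' = w := by
  unfold pt
  rw [Projectivization.mk_eq_mk_iff']
  simp only [← emb_smul, (emb_injective s).eq_iff]

theorem pts_eq_singleton {s : ℂ} {D : Set (Fin 7 → ℂ)} {w₀ : Fin 7 → ℂ} (h₀ : w₀ ≠ 0)
    (hw₀ : w₀ ∈ D) (h : ∀ w ∈ D, ∃ c : ℂ, c • w₀ = w) : pts s D = {pt s w₀ h₀} := by
  ext x
  constructor
  · rintro ⟨w, hw, h0, rfl⟩
    exact (pt_eq_pt_iff h0 h₀).mpr (h w hw)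
  · rintro rfl
    exact ⟨w₀, hw₀, h₀, rfl⟩

/-! #### Zariski closed subsets and flat limits -/

/-- The vectors at which all specialised forms of the list vanish. -/
def formLocus (L : List (MvPolynomial (Fin 7) (Polynomial ℂ))) (s : ℂ) : Set (Fin 7 → ℂ) :=
  {w | ∀ f ∈ L, eval w (map (Polynomial.evalRingHom s) f) = 0}

/-- All members of the list are forms. -/
def AreForms (L : List (MvPolynomial (Fin 7) (Polynomial ℂ))) : Prop :=
  ∀ f ∈ L, ∃ n, f.IsHomogeneous n

theorem isConeSet_formLocus {L : List (MvPolynomial (Fin 7) (Polynomial ℂ))} (hL : AreForms L)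
    (s : ℂ) : IsConeSet (formLocus L s) := by
  intro c w hw f hf
  obtain ⟨n, hn⟩ := hL f hf
  rw [eval_smul_of_isHomogeneous (hn.map _), hw f hf, mul_zero]

theorem ite_cases {α : Type*} {p : α → Prop} {c : Prop} [Decidable c] {x y : α} (hx : p x)
    (hy : p y) : p (if c then x else y) := by
  split
  exacts [hx, hy]

/-- The linear equation of `P_t` at the coordinate `I`. -/
def embForm (I : EvenIdx) : MvPolynomial EvenIdx (Polynomial ℂ) :=
  X I - emb (C Polynomial.X) (fun k => X (freeIdx k)) I

theorem isHomogeneous_embForm (I : EvenIdx) : (embForm I).IsHomogeneous 1 := by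
  have h1 : ∀ c : Polynomial ℂ, ∀ k, (C c * X (freeIdx k) :
      MvPolynomial EvenIdx (Polynomial ℂ)).IsHomogeneous 1 := fun c k => isHomogeneous_C_mul_X c _
  refine (isHomogeneous_X _ I).sub ?_
  have e1 : (C Polynomial.X * (1 - C Polynomial.X) * X (freeIdx 3) :
      MvPolynomial EvenIdx (Polynomial ℂ)) =
      C (Polynomial.X * (1 - Polynomial.X)) * X (freeIdx 3) := by simp
  have e2 : ((1 - C Polynomial.X) * X (freeIdx 3) : MvPolynomial EvenIdx (Polynomial ℂ)) =
      C (1 - Polynomial.X) * X (freeIdx 3) := by simp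
  simp only [emb, embExt, e1, e2]
  repeat' refine ite_cases (p := fun f => IsHomogeneous f 1) ?_ ?_
  all_goals first
    | exact h1 _ _
    | exact isHomogeneous_X _ _
    | exact (h1 _ _).add (isHomogeneous_X _ _)
    | exact isHomogeneous_zero _ _ _

theorem eval_map_embForm (s : ℂ) (z : HalfSpin) (I : EvenIdx) :
    eval z (map (Polynomial.evalRingHom s) (embForm I)) =
      z I - emb s (fun k => z (freeIdx k)) I := by
  have h := map_emb ((eval z).comp (map (Polynomial.evalRingHom s)))
    (C Polynomial.X : MvPolynomial EvenIdx (Polynomial ℂ)) (fun k => X (freeIdx k)) I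
  simp only [RingHom.comp_apply] at h
  rw [embForm, map_sub, map_sub, h]
  simp

/-- Zariski closures and flat limits are tested by forms in the sixteen ambient coordinates. The
equations of P_t, together with the forms of L written in the coordinates `freeIdx`, are such forms
with coefficients in ℂ[s]. -/
theorem mk_mem_pts_formLocus_iff {L : List (MvPolynomial (Fin 7) (Polynomial ℂ))}
    (hL : AreForms L) {s : ℂ} {z : HalfSpin} (hz : z ≠ 0) :
    Projectivization.mk ℂ z hz ∈ pts s (formLocus L s) ↔
      (∀ I, eval z (map (Polynomial.evalRingHom s) (embForm I)) = 0) ∧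
      ∀ f ∈ L, eval z (map (Polynomial.evalRingHom s) (rename freeIdx f)) = 0 := by
  simp only [eval_map_embForm, map_rename, eval_rename]
  have hrange : (∀ I, z I - emb s (fun k => z (freeIdx k)) I = 0) ↔
      emb s (fun k => z (freeIdx k)) = z := by
    rw [funext_iff]
    exact forall_congr' fun I => by rw [sub_eq_zero, eq_comm]
  rw [hrange]
  constructor
  · rintro ⟨w, hw, h0, he⟩
    obtain ⟨c, hc⟩ := (Projectivization.mk_eq_mk_iff' ℂ _ _ hz (emb_ne_zero h0)).mp he.symm
    rw [← emb_smul] at hc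
    have hw' : (fun k => z (freeIdx k)) = c • w := by
      ext k
      rw [← hc, emb_freeIdx]
    refine ⟨by rw [hw', hc], fun f hf => ?_⟩
    have : z ∘ freeIdx = c • w := hw'
    rw [this]
    exact isConeSet_formLocus hL s c w hw f hf
  · rintro ⟨h1, h2⟩
    have h0 : (fun k => z (freeIdx k)) ≠ 0 := fun h0 => hz (by
      rw [← h1, h0]; exact map_zero (embLin s))
    refine ⟨fun k => z (freeIdx k), h2, h0, ?_⟩
    simp only [h1]

theorem isClosed_pts_formLocus {L : List (MvPolynomial (Fin 7) (Polynomial ℂ))}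
    (hL : AreForms L) (s : ℂ) : IsClosed (pts s (formLocus L s)) := by
  have : pts s (formLocus L s) =
      (⋂ I, {x | VanishesAt (map (Polynomial.evalRingHom s) (embForm I)) x}) ∩
      ⋂ (f) (_ : f ∈ L), {x | VanishesAt (map (Polynomial.evalRingHom s) (rename freeIdx f)) x} := by
    ext x
    induction x using Projectivization.ind with
    | h z hz =>
      rw [mk_mem_pts_formLocus_iff hL]
      simp only [Set.mem_inter_iff, Set.mem_iInter, Set.mem_ofPred_eq]
      refine and_congr (forall_congr' fun I => ?_) (forall₂_congr fun f hf => ?_)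
      · rw [vanishesAt_mk_iff ((isHomogeneous_embForm I).map _)]
      · obtain ⟨n, hn⟩ := hL f hf
        rw [vanishesAt_mk_iff (hn.rename_isHomogeneous.map _)]
  rw [this]
  refine (isClosed_iInter fun I => isClosed_setOf_vanishesAt ((isHomogeneous_embForm I).map _)).inter
    (isClosed_iInter fun f => isClosed_iInter fun hf => ?_)
  obtain ⟨n, hn⟩ := hL f hf
  exact isClosed_setOf_vanishesAt (hn.rename_isHomogeneous.map _)

/-- The upper bound for limits: equations that hold for general s and depend polynomially on s
persist at s = a. -/
theorem flatLimit_subset_pts_formLocus {L : List (MvPolynomial (Fin 7) (Polynomial ℂ))}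
    (hL : AreForms L) {Z : ℂ → Set PS}
    (hZ : ∀ s, s ≠ 0 → s ≠ 1 → Z s ⊆ pts s (formLocus L s)) (a : ℂ) :
    flatLimit Z a ⊆ pts a (formLocus L a) := by
  intro x hx
  induction x using Projectivization.ind with
  | h z hz =>
    rw [mk_mem_pts_formLocus_iff hL]
    constructor
    · intro I
      rw [← vanishesAt_mk_iff ((isHomogeneous_embForm I).map _) hz]
      refine hx 1 _ (isHomogeneous_embForm I) fun s h0 h1 y hy => ?_
      have := hZ s h0 h1 hy
      induction y using Projectivization.ind with
      | h v hv =>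
        rw [mk_mem_pts_formLocus_iff hL] at this
        exact (vanishesAt_mk_iff ((isHomogeneous_embForm I).map _) hv).mpr (this.1 I)
    · intro f hf
      obtain ⟨n, hn⟩ := hL f hf
      rw [← vanishesAt_mk_iff (hn.rename_isHomogeneous.map _) hz]
      refine hx n _ hn.rename_isHomogeneous fun s h0 h1 y hy => ?_
      have := hZ s h0 h1 hy
      induction y using Projectivization.ind with
      | h v hv =>
        rw [mk_mem_pts_formLocus_iff hL] at this
        exact (vanishesAt_mk_iff (hn.rename_isHomogeneous.map _) hv).mpr (this.2 f hf)

/-- Vectors need only be reached up to a nonzero scalar, which is what a parametrisation of a conic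
by quadratic forms provides. -/
theorem isIrreducible_pts {τ : Type} {s : ℂ} {D : Set (Fin 7 → ℂ)} (hne : ∃ w ∈ D, w ≠ 0)
    (φ : Fin 7 → MvPolynomial τ ℂ) (p : (τ → ℂ) → Fin 7 → ℂ)
    (hp : ∀ v k, eval v (φ k) = p v k) (h₁ : ∀ v, p v ∈ D)
    (h₂ : ∀ w ∈ D, w ≠ 0 → ∃ v, ∃ c : ℂ, c ≠ 0 ∧ p v = c • w) : IsIrreducible (pts s D) := by
  have key : ∀ v, (fun I => eval v (emb (C s) φ I)) = emb s (p v) := by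
    intro v
    ext I
    rw [map_emb (eval v), eval_C]
    simp only [hp]
  refine isIrreducible_of_parametrization ?_ (emb (C s) φ) ?_ ?_
  · obtain ⟨w, hw, h0⟩ := hne
    exact ⟨_, w, hw, h0, rfl⟩
  · intro v
    rw [key]
    exact emb_mem_coneOver_pts (h₁ v)
  · rintro _ ⟨w, hw, h0, rfl⟩
    obtain ⟨v, c, hc, hv⟩ := h₂ w hw h0
    refine ⟨v, ?_, ?_⟩
    · rw [key, hv]
      exact emb_ne_zero (smul_ne_zero hc h0)
    · rw [Projectivization.mk_eq_mk_iff']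
      exact ⟨c, by rw [key, hv, emb_smul]⟩

/-! #### Linear subspaces -/

theorem pts_submodule (s : ℂ) (W : Submodule ℂ (Fin 7 → ℂ)) :
    pts s W = ((W.map (embLin s)).projectivization : Set PS) := by
  ext x
  induction x using Projectivization.ind with
  | h z hz =>
    rw [SetLike.mem_coe, Submodule.mk_mem_projectivization_iff, Submodule.mem_map]
    constructor
    · intro h
      exact exists_of_mem_coneOver_pts (fun c w hw => W.smul_mem c hw) W.zero_mem (fun _ => h)
    · rintro ⟨w, hw, rfl⟩
      exact emb_mem_coneOver_pts (D := W) hw hz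

theorem embLin_injective (s : ℂ) : Function.Injective (embLin s) := emb_injective s

theorem finrank_map_embLin (s : ℂ) (W : Submodule ℂ (Fin 7 → ℂ)) :
    Module.finrank ℂ (W.map (embLin s)) = Module.finrank ℂ W :=
  (Submodule.equivMapOfInjective (embLin s) (embLin_injective s) W).finrank_eq.symm

theorem isLine_pts {s : ℂ} {W : Submodule ℂ (Fin 7 → ℂ)} (hW : Module.finrank ℂ W = 2) :
    IsLine (pts s W) :=
  ⟨W.map (embLin s), by rw [finrank_map_embLin, hW], pts_submodule s W⟩

theorem isPlane_pts {s : ℂ} {W : Submodule ℂ (Fin 7 → ℂ)} (hW : Module.finrank ℂ W = 3) :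
    IsPlane (pts s W) :=
  ⟨W.map (embLin s), by rw [finrank_map_embLin, hW], pts_submodule s W⟩

theorem projSpan_pts_union (s : ℂ) (W W' : Submodule ℂ (Fin 7 → ℂ)) :
    projSpan (pts s W ∪ pts s W') = pts s (W ⊔ W' : Submodule ℂ (Fin 7 → ℂ)) := by
  rw [pts_submodule, pts_submodule, pts_submodule, projSpan, Projectivization.Subspace.span_union,
    Projectivization.Subspace.span_coe, Projectivization.Subspace.span_coe, Submodule.map_sup,
    map_sup]

/-- The span lies in the subspace because A does, and contains it because A contains the points of a
generating set b. -/
theorem projSpan_eq_of_subset {A : Set PS} {s : ℂ} {W : Submodule ℂ (Fin 7 → ℂ)}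
    (h : A ⊆ pts s W) (b : Set (Fin 7 → ℂ)) (hb : ∀ w ∈ b, emb s w ∈ coneOver A)
    (hW : W ≤ Submodule.span ℂ b) : projSpan A = pts s W := by
  rw [pts_submodule] at h ⊢
  apply Set.Subset.antisymm
  · exact Projectivization.Subspace.span_le_subspace_iff.mpr h
  · have : W.map (embLin s) ≤ Projectivization.Subspace.submodule
        (Projectivization.Subspace.span A) := by
      refine (Submodule.map_mono hW).trans ?_
      rw [Submodule.map_span, Submodule.span_le]
      rintro _ ⟨w, hw, rfl⟩
      intro h0
      exact Projectivization.Subspace.subset_span A (hb w hw h0)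
    intro x hx
    induction x using Projectivization.ind with
    | h z hz => exact this hx hz

end Points

section Lines

open MvPolynomial

/-! ### The lines

The lines are indexed by `Option Vertex`. For a vertex `v ≠ 34` the index `some v` stands for the
line `X_t^v`. The indices `some 34` and `none` stand for the two lines into which the conic
`X_t^34` degenerates as `t → 1`, the lines `3` and `4` respectively. -/

/-- The first basis vector of a line. -/
def lineU : Option Vertex → Fin 7 → Polynomial ℂ
  | some .v0 => ![0, 0, 1, 0, 0, 0, 0]
  | some .v1 => ![0, 1, 0, 0, 0, 0, 0]
  | some .v2 => ![1, 0, 0, 0, 0, 0, 0]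
  | some .v34 => ![0, 0, 0, -1, 1, 0, 0]
  | some .v5 => ![0, 0, 0, 1, 0, 1, 0]
  | some .v6 => ![0, 0, Polynomial.X, 1, -Polynomial.X, 0, 1]
  | some .v7 => ![0, 0, -1, 0, 1, 0, 0]
  | some .v8 => ![0, 0, 0, 0, 0, 1, 0]
  | some .v9 => ![0, 0, 0, -1, Polynomial.X, 0, 0]
  | some .v10 => ![0, 0, -1, 0, 1, 0, 0]
  | some .v11 => ![1, 0, 0, 0, 0, 0, 0]
  | none => ![0, 1, 1, -1, 0, 0, 0]

/-- The second basis vector of a line. -/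
def lineW : Option Vertex → Fin 7 → Polynomial ℂ
  | some .v0 => ![0, 0, 0, 0, 0, 0, 1]
  | some .v1 => ![0, 0, 1, 0, 0, 0, 0]
  | some .v2 => ![0, 1, 1, 0, 0, 0, 0]
  | some .v34 => ![0, -1, -1, 0, 1, 0, 0]
  | some .v5 => ![Polynomial.X, 0, 0, 0, 0, 1, 0]
  | some .v6 => ![0, 0, -Polynomial.X, 0, Polynomial.X, 1, -1]
  | some .v7 => ![0, 0, 0, 0, 0, 1, -1]
  | some .v8 => ![0, 0, 0, 0, 0, 0, 1]
  | some .v9 => ![0, 0, Polynomial.X, 0, 0, 0, 1]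
  | some .v10 => ![0, 1, 0, 0, 0, 0, 0]
  | some .v11 => ![0, 0, 0, 0, 0, 1, 0]
  | none => ![1, -1, -1, 0, 0, 0, 0]

/-- The first coordinate on a line. -/
def lineP {R : Type*} [CommRing R] (w : Fin 7 → R) : Option Vertex → R
  | some .v0 => w 2
  | some .v1 => w 1
  | some .v2 => w 0
  | some .v34 => -w 3
  | some .v5 => w 3
  | some .v6 => w 3
  | some .v7 => w 4
  | some .v8 => w 5
  | some .v9 => -w 3
  | some .v10 => w 4
  | some .v11 => w 0
  | none => -w 3

/-- The second coordinate on a line. -/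
def lineQ {R : Type*} [CommRing R] (w : Fin 7 → R) : Option Vertex → R
  | some .v0 => w 6
  | some .v1 => w 2
  | some .v2 => w 1
  | some .v34 => w 4 + w 3
  | some .v5 => w 5 - w 3
  | some .v6 => w 5
  | some .v7 => w 5
  | some .v8 => w 6
  | some .v9 => w 6
  | some .v10 => w 1
  | some .v11 => w 5
  | none => w 0

def lineVecU (i : Option Vertex) (s : ℂ) : Fin 7 → ℂ := fun k => (lineU i k).eval s

def lineVecW (i : Option Vertex) (s : ℂ) : Fin 7 → ℂ := fun k => (lineW i k).eval s

/-- The vector space of a line. -/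
def line (i : Option Vertex) (s : ℂ) : Submodule ℂ (Fin 7 → ℂ) :=
  Submodule.span ℂ {lineVecU i s, lineVecW i s}

theorem lineP_lineVecU (i : Option Vertex) (s : ℂ) : lineP (lineVecU i s) i = 1 := by
  rcases i with _ | (_ | _) <;> simp [lineP, lineVecU, lineU]

theorem lineQ_lineVecU (i : Option Vertex) (s : ℂ) : lineQ (lineVecU i s) i = 0 := by
  rcases i with _ | (_ | _) <;> simp [lineQ, lineVecU, lineU]

theorem lineP_lineVecW (i : Option Vertex) (s : ℂ) : lineP (lineVecW i s) i = 0 := by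
  rcases i with _ | (_ | _) <;> simp [lineP, lineVecW, lineW]

theorem lineQ_lineVecW (i : Option Vertex) (s : ℂ) : lineQ (lineVecW i s) i = 1 := by
  rcases i with _ | (_ | _) <;> simp [lineQ, lineVecW, lineW]

theorem lineP_add_smul (w w' : Fin 7 → ℂ) (a b : ℂ) (i : Option Vertex) :
    lineP (a • w + b • w') i = a * lineP w i + b * lineP w' i := by
  rcases i with _ | (_ | _) <;> simp [lineP] <;> ring

theorem lineQ_add_smul (w w' : Fin 7 → ℂ) (a b : ℂ) (i : Option Vertex) :
    lineQ (a • w + b • w') i = a * lineQ w i + b * lineQ w' i := by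
  rcases i with _ | (_ | _) <;> simp [lineQ] <;> ring

/-- `lineP` and `lineQ` are dual to the two basis vectors for every s. So the span is cut out by
linear equations polynomial in s, and keeps dimension 2 at s = 0 and s = 1, where the limits are
taken. -/
theorem mem_line_iff {i : Option Vertex} {s : ℂ} {w : Fin 7 → ℂ} :
    w ∈ line i s ↔ ∀ k, w k = lineP w i * lineVecU i s k + lineQ w i * lineVecW i s k := by
  constructor
  · intro h k
    obtain ⟨a, b, rfl⟩ := Submodule.mem_span_pair.mp h
    rw [lineP_add_smul, lineQ_add_smul, lineP_lineVecU, lineP_lineVecW, lineQ_lineVecU,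
      lineQ_lineVecW]
    simp
  · intro h
    exact Submodule.mem_span_pair.mpr ⟨lineP w i, lineQ w i, by ext k; rw [h k]; simp⟩

/-- The linear equations of a line. -/
def lineForms (i : Option Vertex) : List (MvPolynomial (Fin 7) (Polynomial ℂ)) :=
  List.ofFn fun k => X k - (lineP X i * C (lineU i k) + lineQ X i * C (lineW i k))

theorem areForms_lineForms (i : Option Vertex) : AreForms (lineForms i) := by
  intro f hf
  obtain ⟨k, rfl⟩ := (List.mem_ofFn' _ _).mp hf
  have hX : ∀ k, (X k : MvPolynomial (Fin 7) (Polynomial ℂ)).IsHomogeneous 1 :=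
    isHomogeneous_X _
  have hP : (lineP X i : MvPolynomial (Fin 7) (Polynomial ℂ)).IsHomogeneous 1 := by
    rcases i with _ | (_ | _) <;> simp only [lineP] <;> with_reducible
      first | exact hX _ | exact (hX _).neg
  have hQ : (lineQ X i : MvPolynomial (Fin 7) (Polynomial ℂ)).IsHomogeneous 1 := by
    rcases i with _ | (_ | _) <;> simp only [lineQ] <;> with_reducible
      first | exact hX _ | exact (hX _).add (hX _) | exact (hX _).sub (hX _)
  exact ⟨1, (hX k).sub ((hP.mul (isHomogeneous_C _ _)).add (hQ.mul (isHomogeneous_C _ _)))⟩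

theorem map_lineP {R S : Type*} [CommRing R] [CommRing S] (f : R →+* S) (w : Fin 7 → R)
    (i : Option Vertex) : f (lineP w i) = lineP (fun k => f (w k)) i := by
  rcases i with _ | (_ | _) <;> simp [lineP]

theorem map_lineQ {R S : Type*} [CommRing R] [CommRing S] (f : R →+* S) (w : Fin 7 → R)
    (i : Option Vertex) : f (lineQ w i) = lineQ (fun k => f (w k)) i := by
  rcases i with _ | (_ | _) <;> simp [lineQ]

theorem formLocus_lineForms (i : Option Vertex) (s : ℂ) :
    formLocus (lineForms i) s = (line i s : Set (Fin 7 → ℂ)) := by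
  ext w
  rw [SetLike.mem_coe, mem_line_iff]
  simp only [formLocus, Set.mem_ofPred_eq, lineForms, List.forall_mem_ofFn_iff, map_sub, map_add,
    map_mul, map_lineP, map_lineQ, map_X, map_C, eval_X, eval_C, Polynomial.coe_evalRingHom,
    sub_eq_zero]
  rfl

theorem isClosed_line (i : Option Vertex) (s : ℂ) : IsClosed (pts s (line i s)) := by
  rw [← formLocus_lineForms]
  exact isClosed_pts_formLocus (areForms_lineForms i) s

theorem lineVecU_mem (i : Option Vertex) (s : ℂ) : lineVecU i s ∈ line i s :=
  Submodule.subset_span (by simp)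

theorem lineVecW_mem (i : Option Vertex) (s : ℂ) : lineVecW i s ∈ line i s :=
  Submodule.subset_span (by simp)

theorem linearIndependent_line (i : Option Vertex) (s : ℂ) :
    LinearIndependent ℂ ![lineVecU i s, lineVecW i s] := by
  rw [LinearIndependent.pair_iff]
  intro a b h
  have h1 := lineP_add_smul (lineVecU i s) (lineVecW i s) a b i
  have h2 := lineQ_add_smul (lineVecU i s) (lineVecW i s) a b i
  rw [h, lineP_lineVecU, lineP_lineVecW] at h1
  rw [h, lineQ_lineVecU, lineQ_lineVecW] at h2
  have e1 : lineP (0 : Fin 7 → ℂ) i = 0 := by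
    simpa using lineP_add_smul 0 0 0 0 i
  have e2 : lineQ (0 : Fin 7 → ℂ) i = 0 := by
    simpa using lineQ_add_smul 0 0 0 0 i
  constructor
  · linear_combination e1 - h1
  · linear_combination e2 - h2

theorem finrank_line (i : Option Vertex) (s : ℂ) : Module.finrank ℂ (line i s) = 2 := by
  have := finrank_span_eq_card (linearIndependent_line i s)
  rw [Matrix.range_cons, Matrix.range_cons, Matrix.range_empty, Set.union_empty] at this
  exact this

theorem lineVecU_ne_zero (i : Option Vertex) (s : ℂ) : lineVecU i s ≠ 0 :=
  (linearIndependent_line i s).ne_zero 0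

theorem isConeSet_submodule (W : Submodule ℂ (Fin 7 → ℂ)) : IsConeSet (W : Set (Fin 7 → ℂ)) :=
  fun c _ hw => W.smul_mem c hw

theorem isIrreducible_line (i : Option Vertex) (s : ℂ) : IsIrreducible (pts s (line i s)) := by
  refine isIrreducible_pts (τ := Fin 2) ⟨_, lineVecU_mem i s, lineVecU_ne_zero i s⟩
    (fun k => X 0 * C (lineVecU i s k) + X 1 * C (lineVecW i s k))
    (fun v => v 0 • lineVecU i s + v 1 • lineVecW i s) (by simp) ?_ ?_
  · intro v
    exact Submodule.mem_span_pair.mpr ⟨v 0, v 1, rfl⟩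
  · intro w hw _
    obtain ⟨a, b, h⟩ := Submodule.mem_span_pair.mp hw
    exact ⟨![a, b], 1, one_ne_zero, by simpa using h⟩

/-- A vertex number. -/
def vertexIdx : Vertex → Fin 11
  | .v0 => 0 | .v1 => 1 | .v2 => 2 | .v34 => 3 | .v5 => 4 | .v6 => 5 | .v7 => 6 | .v8 => 7
  | .v9 => 8 | .v10 => 9 | .v11 => 10

theorem vertexIdx_bijective : Function.Bijective vertexIdx := by
  refine Function.bijective_iff_has_inverse.mpr
    ⟨![.v0, .v1, .v2, .v34, .v5, .v6, .v7, .v8, .v9, .v10, .v11], ?_, ?_⟩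
  · intro v; cases v <;> rfl
  · intro i; fin_cases i <;> rfl

instance : Finite Vertex := Finite.of_injective _ vertexIdx_bijective.injective

theorem card_vertex : Nat.card Vertex = 11 := by
  rw [Nat.card_eq_of_bijective _ vertexIdx_bijective]; simp

theorem card_option_vertex : Nat.card (Option Vertex) = 12 := by
  have := Fintype.ofFinite Vertex
  have h := card_vertex
  rw [Nat.card_eq_fintype_card] at h ⊢
  rw [Fintype.card_option, h]

set_option maxHeartbeats 4000000 in
theorem line_one_subset {i j : Option Vertex} (h : pts 1 (line i 1) ⊆ pts 1 (line j 1)) :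
    i = j := by
  rw [pts_subset_iff (isConeSet_submodule _)] at h
  have hmem : lineVecU i 1 + (2 : ℂ) • lineVecW i 1 ∈ line i 1 :=
    (line i 1).add_mem (lineVecU_mem i 1) ((line i 1).smul_mem 2 (lineVecW_mem i 1))
  have h0 : lineVecU i 1 + (2 : ℂ) • lineVecW i 1 ≠ 0 := by
    intro h0
    have := LinearIndependent.pair_iff.mp (linearIndependent_line i 1) 1 2 (by simpa using h0)
    exact one_ne_zero this.1
  have key := mem_line_iff.mp (h _ hmem h0)
  clear h hmem h0
  rcases i with _ | (_ | _) <;> rcases j with _ | (_ | _) <;> first | rfl | (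
    exfalso
    revert key
    simp [lineP, lineQ, lineVecU, lineVecW, lineU, lineW, Fin.forall_fin_succ]
    try norm_num)

end Lines

section SpinorCurve

open MvPolynomial

/-! ### The spinor curve for `t ≠ 0, 1, ∞` -/

/-- The rows of the Jacobian matrix. -/
def jacRow (s : ℂ) (y : Fin 7 → ℂ) : Fin 7 → QuadSpace :=
  ![Sum.elim ![s * y 4, -(1 - s) * y 3, 0, 0, -s * y 2] ![0, 0, y 5, 0, 0],
    Sum.elim ![-y 3, 0, (1 - s) * y 3, 0, s * y 2] ![0, y 5, 0, y 6, 0],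
    Sum.elim ![0, -s * y 3 + s * y 4, s * y 3 - s * y 4, y 3 - s * y 4,
      -s * y 0 + s * y 1 - s * y 3 + s * y 4] ![y 6, 0, 0, 0, 0],
    Sum.elim ![-y 1, -(1 - s) * y 0 - s * y 2 - 2 * (1 - s) * y 3 + (1 - s) * y 4 - (1 - s) * y 6,
      (1 - s) * y 1 + s * y 2, y 2 - (1 - s) * y 4 + (1 - s) * y 5, -s * y 2]
      ![0, 0, y 5, 0, y 5],
    Sum.elim ![s * y 0, s * y 2 + (1 - s) * y 3, -s * y 2, -s * y 2 - (1 - s) * y 3, s * y 2]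
      ![0, 0, -y 5 + y 6, 0, -y 5 + y 6],
    Sum.elim ![0, 0, 0, (1 - s) * y 3, 0] ![0, y 1, y 0 + y 3 - y 4, 0, y 3 - y 4],
    Sum.elim ![0, -(1 - s) * y 3, 0, 0, 0] ![y 2, 0, y 4, y 1, y 4]]

set_option maxHeartbeats 4000000 in
theorem eval_pderiv_quadrics (s : ℂ) (y : Fin 7 → ℂ) (i : Fin 7) (j : Fin 5 ⊕ Fin 5) :
    eval y (pderiv i (quadrics 1 s j)) = jacRow s y i j := by
  rcases j with j | j <;> fin_cases j <;> fin_cases i <;>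
    simp [quadrics, jacRow, pderiv_X, pow_two] <;> ring

theorem jacobianRowSpace_eq (s : ℂ) (y : Fin 7 → ℂ) :
    jacobianRowSpace 1 s y = Submodule.span ℂ (Set.range (jacRow s y)) := by
  unfold jacobianRowSpace
  simp only [eval_pderiv_quadrics]

theorem jacRow_smul (s c : ℂ) (y : Fin 7 → ℂ) (i : Fin 7) :
    jacRow s (c • y) i = c • jacRow s y i := by
  ext (j | j) <;> fin_cases i <;> fin_cases j <;> simp [jacRow] <;> ring

/-- The Jacobian matrix is linear in y. This disposes of the arbitrary representative in `IsRho`. -/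
theorem jacobianRowSpace_smul (s : ℂ) {c : ℂ} (hc : c ≠ 0) (y : Fin 7 → ℂ) :
    jacobianRowSpace 1 s (c • y) = jacobianRowSpace 1 s y := by
  rw [jacobianRowSpace_eq, jacobianRowSpace_eq]
  apply le_antisymm <;> rw [Submodule.span_le] <;> rintro _ ⟨i, rfl⟩
  · rw [jacRow_smul]
    exact Submodule.smul_mem _ _ (Submodule.subset_span ⟨i, rfl⟩)
  · have : jacRow s y i = c⁻¹ • jacRow s (c • y) i := by
      rw [jacRow_smul, inv_smul_smul₀ hc]
    rw [this]
    exact Submodule.smul_mem _ _ (Submodule.subset_span ⟨i, rfl⟩)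

/-- The points of `C_t^v`, on vectors. -/
def OnComponent (s : ℂ) (y : Fin 7 → ℂ) : Vertex → Prop
  | .v0 => y 5 = 0 ∧ y 4 = 0 ∧ y 3 = 0 ∧ y 2 = 0 ∧ y 1 = 0
  | .v1 => y 6 = 0 ∧ y 5 = 0 ∧ y 4 = 0 ∧ y 3 = 0 ∧ y 2 = 0
  | .v2 => y 6 = 0 ∧ y 5 = 0 ∧ y 4 = 0 ∧ y 3 = 0 ∧ y 0 = y 1
  | .v34 => y 2 * y 3 - s * (y 2 * y 4) + (s - 1) * (y 3 * y 4) = 0 ∧ y 6 = 0 ∧ y 5 = 0 ∧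
      y 1 = y 2 - y 4 ∧ y 0 = y 2 - y 3
  | .v5 => y 6 = 0 ∧ y 3 = y 4 ∧ y 2 = y 4 - y 5 ∧ y 1 = 0 ∧ y 0 = 0
  | .v6 => y 4 = y 5 ∧ y 3 = y 5 - y 6 ∧ y 2 = 0 ∧ y 1 = 0 ∧ y 0 = 0
  | .v7 => y 5 = y 6 ∧ y 3 = 0 ∧ y 2 = 0 ∧ y 1 = 0 ∧ y 0 = 0
  | .v8 => y 4 = 0 ∧ y 3 = 0 ∧ y 2 = 0 ∧ y 1 = 0 ∧ y 0 = 0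
  | .v9 => y 5 = 0 ∧ y 4 = 0 ∧ y 2 = 0 ∧ y 1 = 0 ∧ y 0 = -y 3 - y 6
  | .v10 => y 6 = 0 ∧ y 5 = 0 ∧ y 3 = 0 ∧ y 2 = 0 ∧ y 0 = 0
  | .v11 => y 6 = 0 ∧ y 4 = 0 ∧ y 3 = 0 ∧ y 1 = 0 ∧ y 0 = 0

theorem isHomogeneous_componentGens (s : ℂ) (v : Vertex) :
    ∀ f ∈ componentGens 1 s v, ∃ n, f.IsHomogeneous n := by
  have h1 : ∀ k, (X k : MvPolynomial (Fin 7) ℂ).IsHomogeneous 1 := isHomogeneous_X _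
  have h2 : ∀ j k, (X j - X k : MvPolynomial (Fin 7) ℂ).IsHomogeneous 1 :=
    fun j k => (h1 j).sub (h1 k)
  have h3 : ∀ i j k, (X i - X j + X k : MvPolynomial (Fin 7) ℂ).IsHomogeneous 1 :=
    fun i j k => (h2 i j).add (h1 k)
  have h4 : ∀ i j k, (X i + X j + X k : MvPolynomial (Fin 7) ℂ).IsHomogeneous 1 :=
    fun i j k => ((h1 i).add (h1 j)).add (h1 k)
  have h5 : ∀ (c : ℂ) j k, (C c * X j * X k : MvPolynomial (Fin 7) ℂ).IsHomogeneous 2 :=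
    fun c j k => ((h1 j).C_mul c).mul (h1 k)
  have h6 : (C 1 * X 2 * X 3 - C s * X 2 * X 4 + C (-1 + s) * X 3 * X 4 :
      MvPolynomial (Fin 7) ℂ).IsHomogeneous 2 := ((h5 _ _ _).sub (h5 _ _ _)).add (h5 _ _ _)
  cases v <;> simp only [componentGens, List.forall_mem_cons, List.not_mem_nil, false_implies,
    implies_true, and_true]
  case v34 => exact ⟨⟨2, h6⟩, ⟨1, h1 _⟩, ⟨1, h1 _⟩, ⟨1, h3 _ _ _⟩, ⟨1, h3 _ _ _⟩⟩
  all_goals refine ⟨?_, ?_, ?_, ?_, ?_⟩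
  all_goals with_reducible first
    | exact ⟨1, h1 _⟩
    | exact ⟨1, h2 _ _⟩
    | exact ⟨1, h3 _ _ _⟩
    | exact ⟨1, h4 _ _ _⟩

theorem mk_mem_canonicalComponent_iff (s : ℂ) (v : Vertex) {y : Fin 7 → ℂ} (hy : y ≠ 0) :
    Projectivization.mk ℂ y hy ∈ canonicalComponent 1 s v ↔ OnComponent s y v := by
  have : Projectivization.mk ℂ y hy ∈ canonicalComponent 1 s v ↔
      ∀ f ∈ componentGens 1 s v, eval y f = 0 :=
    forall₂_congr fun f hf => by
      obtain ⟨n, hn⟩ := isHomogeneous_componentGens s v f hf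
      exact vanishesAt_mk_iff hn hy
  rw [this]
  cases v <;> simp only [componentGens, OnComponent, List.forall_mem_cons, List.not_mem_nil,
    false_implies, implies_true, and_true, map_add, map_sub, map_mul, eval_X, eval_C]
  all_goals
    refine ⟨fun ⟨h1, h2, h3, h4, h5⟩ => ⟨?_, ?_, ?_, ?_, ?_⟩,
      fun ⟨h1, h2, h3, h4, h5⟩ => ⟨?_, ?_, ?_, ?_, ?_⟩⟩ <;> first
    | exact h1
    | exact h2
    | exact h3
    | exact h4
    | exact h5
    | linear_combination h1
    | linear_combination h2
    | linear_combination h3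
    | linear_combination h4
    | linear_combination h5

/-- The free coordinates of the half spinor at a point of `C_t^v`. -/
def spin (s : ℂ) (y : Fin 7 → ℂ) : Vertex → Fin 7 → ℂ
  | .v0 => ![0, 0, -s * y 0, 0, 0, 0, y 6]
  | .v1 => ![0, y 1, y 0, 0, 0, 0, 0]
  | .v2 => ![-y 2, y 1, y 1, 0, 0, 0, 0]
  | .v34 => ![s * y 2, -s * (y 2 - y 4), -s * (y 2 - y 4), -y 3, s * y 3 - s * y 4, 0, 0]
  | .v5 => ![s * (y 5 - y 4), 0, 0, y 4, 0, y 5, 0]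
  | .v6 => ![0, 0, s * y 6, -(y 5 - y 6), -s * y 6, -y 5, y 6]
  | .v7 => ![0, 0, -s * y 4, 0, s * y 4, y 6, -y 6]
  | .v8 => ![0, 0, 0, 0, 0, -y 5, y 6]
  | .v9 => ![0, 0, s * y 6, -y 3, s * y 3, 0, y 6]
  | .v10 => ![0, y 1, -y 4, 0, y 4, 0, 0]
  | .v11 => ![-s * y 2, 0, 0, 0, 0, y 5, 0]

end SpinorCurve

/-! ### The Jacobian rows annihilate the explicit half spinors -/

section Spin
open MvPolynomial

/-- After substitution of the linear equations of the component, every condition is an identity or a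
multiple of the equation e of the conic. -/
theorem clifford_jacRow_v34 {s : ℂ} {y : Fin 7 → ℂ} (h : OnComponent s y .v34) (i : Fin 7) :
    clifford (jacRow s y i) (toExt (emb s (spin s y .v34))) = 0 := by
  rw [clifford_emb_iff]
  obtain ⟨e, h6, h5, h1, h0⟩ := h
  simp only [jacRow, spin, h0, h1, h5, h6]
  fin_cases i <;>
  · simp
    and_intros <;> first
      | ring1
      | linear_combination s * e
      | linear_combination -s * e
      | linear_combination e
      | linear_combination -e

set_option maxHeartbeats 4000000 in
theorem clifford_jacRow {s : ℂ} {v : Vertex} (hv : v ≠ .v34) {y : Fin 7 → ℂ}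
    (h : OnComponent s y v) (i : Fin 7) :
    clifford (jacRow s y i) (toExt (emb s (spin s y v))) = 0 := by
  rw [clifford_emb_iff]
  cases v
  case v34 => exact absurd rfl hv
  all_goals
    obtain ⟨e1, e2, e3, e4, e5⟩ := h
    simp only [jacRow, spin, e1, e2, e3, e4, e5]
    fin_cases i <;> simp <;> and_intros <;> ring1

end Spin
-- Equations of the spinor curves for s ≠ 0, 1
section SpinorComponents
open MvPolynomial Filter Topology

/-- A parametrisation of `C_t^v`. -/
def curvePt (s p q : ℂ) : Vertex → Fin 7 → ℂ
  | .v0 => ![p, 0, 0, 0, 0, 0, q]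
  | .v1 => ![p, -q, 0, 0, 0, 0, 0]
  | .v2 => ![p, p, -q, 0, 0, 0, 0]
  | .v34 => ![(s - 1) * p * q - p * (p + s * q), (s - 1) * p * q + q * (p + s * q),
      (s - 1) * p * q, p * (p + s * q), -q * (p + s * q), 0, 0]
  | .v5 => ![0, 0, p + q, p, p, -q, 0]
  | .v6 => ![0, 0, 0, p + q, p, p, -q]
  | .v7 => ![0, 0, 0, 0, p, -q, -q]
  | .v8 => ![0, 0, 0, 0, 0, p, -q]
  | .v9 => ![-p - q, 0, 0, p, 0, 0, q]
  | .v10 => ![0, p, 0, 0, q, 0, 0]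
  | .v11 => ![0, 0, p, 0, 0, q, 0]

theorem onComponent_curvePt (s p q : ℂ) (v : Vertex) : OnComponent s (curvePt s p q v) v := by
  cases v <;> simp [OnComponent, curvePt]
  all_goals ring1

/-- Five rows of the Jacobian matrix which are linearly independent at the general point of
`C_t^v`. -/
def rowSel : Vertex → Fin 5 → Fin 7
  | .v0 => ![1, 2, 3, 4, 5]
  | .v1 => ![2, 3, 4, 5, 6]
  | .v2 => ![0, 3, 4, 5, 6]
  | .v34 => ![0, 1, 2, 5, 6]
  | .v5 => ![0, 1, 2, 3, 6]
  | .v6 => ![0, 1, 2, 3, 5]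
  | .v7 => ![0, 1, 2, 3, 5]
  | .v8 => ![0, 1, 2, 3, 4]
  | .v9 => ![0, 1, 2, 4, 5]
  | .v10 => ![0, 2, 3, 5, 6]
  | .v11 => ![0, 1, 3, 4, 6]

-- One genericity condition serves all eleven components: where these four linear forms in (p, q) do
-- not vanish, the point is a smooth point of C_t.
set_option maxHeartbeats 4000000 in
theorem linearIndependent_jacRow {s p q : ℂ} (hs : s ≠ 0) (hs1 : s ≠ 1) (hp : p ≠ 0) (hq : q ≠ 0)
    (hpq : p + q ≠ 0) (hpsq : p + s * q ≠ 0) (v : Vertex) :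
    LinearIndependent ℂ (fun i => jacRow s (curvePt s p q v) (rowSel v i)) := by
  rw [Fintype.linearIndependent_iff]
  intro c h
  have hl : ∀ j, _ := fun j => congr_fun h (Sum.inl j)
  have hr : ∀ j, _ := fun j => congr_fun h (Sum.inr j)
  simp only [Fin.sum_univ_five] at hl hr
  clear h
  cases v <;>
    simp [Fin.forall_fin_succ, jacRow, curvePt, rowSel] at hl hr ⊢ <;> grind

theorem spin_ne_zero {s : ℂ} (hs : s ≠ 0) {y : Fin 7 → ℂ} (hy : y ≠ 0) {v : Vertex}
    (h : OnComponent s y v) : spin s y v ≠ 0 := by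
  intro h0
  apply hy
  have h0' : ∀ k, spin s y v k = 0 := fun k => congr_fun h0 k
  clear hy h0
  ext k
  revert k
  cases v <;> simp [OnComponent, spin, Fin.forall_fin_succ, hs] at h h0' ⊢ <;> grind

theorem clifford_spin {s : ℂ} {v : Vertex} {y : Fin 7 → ℂ} (h : OnComponent s y v) :
    ∀ u ∈ jacobianRowSpace 1 s y, clifford u (toExt (emb s (spin s y v))) = 0 := by
  intro u hu
  rw [jacobianRowSpace_eq] at hu
  refine clifford_eq_zero_of_mem_span ?_ hu
  rintro _ ⟨i, rfl⟩
  by_cases hv : v = .v34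
  · subst hv
    exact clifford_jacRow_v34 h i
  · exact clifford_jacRow hv h i

/-- The five-dimensional row space kills both x and the explicit spinor, and such a space kills only
one spinor up to scalars. -/
theorem exists_eq_of_isRho {s : ℂ} (hs : s ≠ 0) {v : Vertex} {p : ℙ ℂ (Fin 7 → ℂ)} {x : PS}
    (hp : p ∈ canonicalComponent 1 s v) (hx : IsRho 1 s p x) :
    ∃ y, OnComponent s y v ∧ ∃ h : emb s (spin s y v) ≠ 0, Projectivization.mk ℂ _ h = x := by
  obtain ⟨y, hy, rfl⟩ : ∃ y, ∃ hy : y ≠ 0, Projectivization.mk ℂ y hy = p :=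
    ⟨p.rep, p.rep_nonzero, p.mk_rep⟩
  obtain ⟨c, hc⟩ := Projectivization.exists_smul_eq_mk_rep ℂ y hy
  rw [IsRho, ← hc, Units.smul_def, jacobianRowSpace_smul s c.ne_zero] at hx
  rw [mk_mem_canonicalComponent_iff] at hp
  have hz := emb_ne_zero (s := s) (spin_ne_zero hs hy hp)
  refine ⟨y, hp, hz, ?_⟩
  obtain ⟨h5, hx⟩ := hx
  induction x using Projectivization.ind with
  | h x hx0 =>
    rw [isHalfSpinorOf_mk_iff] at hx
    obtain ⟨I, hI⟩ := Function.ne_iff.mp (toExt_ne_zero hx0)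
    have := eq_smul_of_clifford_eq_zero h5 hI hx (clifford_spin hp)
    rw [Projectivization.mk_eq_mk_iff']
    refine ⟨toExt (emb s (spin s y v)) I / toExt x I, ?_⟩
    ext J
    have hJ := congr_fun this J
    rw [toExt_coe, Pi.smul_apply, toExt_coe] at hJ
    exact hJ.symm

/-- The rank is exactly 5: at least 5 by the selected rows, at most 5 because the row space kills a
nonzero spinor. -/
theorem mk_spin_mem {s p q : ℂ} (hs : s ≠ 0) (hs1 : s ≠ 1) (hp : p ≠ 0) (hq : q ≠ 0)
    (hpq : p + q ≠ 0) (hpsq : p + s * q ≠ 0) (v : Vertex) :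
    emb s (spin s (curvePt s p q v) v) ∈
      coneOver {x | ∃ p ∈ canonicalComponent 1 s v, IsRho 1 s p x} := by
  intro hz
  set y := curvePt s p q v with hy
  have hli := linearIndependent_jacRow hs hs1 hp hq hpq hpsq v
  rw [← hy] at hli
  have hy0 : y ≠ 0 := by
    intro h0
    have := hli.ne_zero 0
    apply this
    have := jacRow_smul s 0 y (rowSel v 0)
    rwa [zero_smul, zero_smul, ← h0] at this
  obtain ⟨c, hc⟩ := Projectivization.exists_smul_eq_mk_rep ℂ y hy0
  refine ⟨Projectivization.mk ℂ y hy0,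
    (mk_mem_canonicalComponent_iff s v hy0).mpr (onComponent_curvePt s p q v), ?_⟩
  rw [IsRho, ← hc, Units.smul_def, jacobianRowSpace_smul s c.ne_zero]
  have hU := clifford_spin (onComponent_curvePt s p q v)
  refine ⟨le_antisymm (finrank_le_of_clifford_eq_zero (toExt_ne_zero hz) hU) ?_,
    (isHalfSpinorOf_mk_iff hz).mpr hU⟩
  have h5 := finrank_span_eq_card hli
  rw [Fintype.card_fin] at h5
  rw [jacobianRowSpace_eq]
  refine h5.ge.trans ?_
  refine Submodule.finrank_mono (Submodule.span_mono ?_)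
  rintro _ ⟨i, rfl⟩
  exact ⟨_, rfl⟩

theorem eventually_add_mul_ne_zero (a : ℂ) {b : ℂ} (hb : b ≠ 0) :
    ∀ᶠ ε : ℂ in 𝓝[≠] 0, a + b * ε ≠ 0 := by
  have : ∀ᶠ ε : ℂ in 𝓝[≠] 0, ε ≠ -a / b := by
    by_cases h : (0 : ℂ) = -a / b
    · rw [← h]
      exact self_mem_nhdsWithin
    · exact eventually_ne_nhdsWithin h
  filter_upwards [this] with ε h h0
  exact h (by field_simp; linear_combination h0)

theorem continuous_spin_curvePt (s : ℂ) (v : Vertex) :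
    Continuous fun x : ℂ × ℂ => spin s (curvePt s x.1 x.2 v) v := by
  refine continuous_pi fun k => ?_
  cases v <;> fin_cases k <;> simp [spin, curvePt] <;> fun_prop

theorem continuous_emb_comp {X : Type*} [TopologicalSpace X] {f : X → ℂ} {g : X → Fin 7 → ℂ}
    (hf : Continuous f) (hg : Continuous g) : Continuous fun x => emb (f x) (g x) :=
  continuous_emb.comp (hf.prodMk hg)

theorem emb_spin_mem {s : ℂ} (hs : s ≠ 0) (hs1 : s ≠ 1) (p q : ℂ) (v : Vertex) :
    emb s (spin s (curvePt s p q v) v) ∈ coneOver (spinorComponent 1 s v) := by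
  -- Special values of (p, q) are approached in the direction (N, 1). Along it p, q, p + q and p +
  -- sq have slopes N, 1, N + 1 and N + s; these are nonzero, so the four forms do not vanish for
  -- small ε ≠ 0.
  obtain ⟨N, hN0, hN1, hNs⟩ : ∃ N : ℂ, N ≠ 0 ∧ N + 1 ≠ 0 ∧ N + s ≠ 0 := by
    obtain ⟨N, hN⟩ := Infinite.exists_notMem_finset ({0, -1, -s} : Finset ℂ)
    simp only [Finset.mem_insert, Finset.mem_singleton, not_or, ← add_eq_zero_iff_eq_neg] at hN
    exact ⟨N, hN⟩
  have key := mem_coneOver_of_eventually (K := spinorComponent 1 s v) isClosed_closure (a := 0)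
    (z := fun ε => emb s (spin s (curvePt s (p + N * ε) (q + 1 * ε) v) v)) ?_ ?_
  · simpa using key
  · exact (continuous_emb_comp continuous_const ((continuous_spin_curvePt s v).comp (by fun_prop :
      Continuous fun ε : ℂ => (p + N * ε, q + 1 * ε)))).continuousAt
  · filter_upwards [eventually_add_mul_ne_zero p hN0, eventually_add_mul_ne_zero q one_ne_zero,
      eventually_add_mul_ne_zero (p + q) hN1, eventually_add_mul_ne_zero (p + s * q) hNs]
      with ε h1 h2 h3 h4
    refine coneOver_mono subset_closure (mk_spin_mem hs hs1 h1 h2 ?_ ?_ v)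
    · intro h; apply h3; linear_combination h
    · intro h; apply h4; linear_combination h

/-- The equations of the conic `X_t^34`. -/
def conicForms : List (MvPolynomial (Fin 7) (Polynomial ℂ)) :=
  [X 5, X 6, X 1 - X 2, X 1 + X 0 + X 4 + C Polynomial.X * X 3,
    X 0 * (X 4 + C Polynomial.X * X 3) - C (1 - Polynomial.X) * X 3 * (X 4 + C Polynomial.X * X 3)
      - X 3 * X 0]

/-- The equations of the curve `X_t^v`. -/
def spinorForms : Vertex → List (MvPolynomial (Fin 7) (Polynomial ℂ))
  | .v34 => conicForms
  | v => lineForms (some v)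

theorem spinorForms_of_ne {v : Vertex} (hv : v ≠ .v34) : spinorForms v = lineForms (some v) := by
  cases v <;> first | rfl | exact absurd rfl hv

theorem mem_conic_iff {s : ℂ} {w : Fin 7 → ℂ} : w ∈ formLocus conicForms s ↔
    w 5 = 0 ∧ w 6 = 0 ∧ w 1 = w 2 ∧ w 1 = -w 0 - w 4 - s * w 3 ∧
    w 0 * (w 4 + s * w 3) - (1 - s) * w 3 * (w 4 + s * w 3) - w 3 * w 0 = 0 := by
  simp only [formLocus, conicForms, Set.mem_ofPred_eq, List.forall_mem_cons, List.not_mem_nil,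
    false_implies, implies_true, and_true, map_add, map_sub, map_mul, map_X, eval_X, map_C, eval_C,
    Polynomial.coe_evalRingHom, Polynomial.eval_X, Polynomial.eval_one]
  refine and_congr_right fun _ => and_congr_right fun _ => and_congr sub_eq_zero
    (and_congr_left fun _ => ⟨fun h => ?_, fun h => ?_⟩)
  · linear_combination h
  · linear_combination h

theorem areForms_conicForms : AreForms conicForms := by
  have h1 : ∀ k, (X k : MvPolynomial (Fin 7) (Polynomial ℂ)).IsHomogeneous 1 := isHomogeneous_X _
  have h2 : ∀ c k, (C c * X k : MvPolynomial (Fin 7) (Polynomial ℂ)).IsHomogeneous 1 :=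
    fun c k => (h1 k).C_mul c
  have h3 := (h1 4).add (h2 Polynomial.X 3)
  intro f hf
  simp only [conicForms, List.mem_cons, List.not_mem_nil, or_false] at hf
  rcases hf with rfl | rfl | rfl | rfl | rfl
  · exact ⟨1, h1 _⟩
  · exact ⟨1, h1 _⟩
  · exact ⟨1, (h1 _).sub (h1 _)⟩
  · exact ⟨1, (((h1 _).add (h1 _)).add (h1 _)).add (h2 _ _)⟩
  · exact ⟨2, (((h1 _).mul h3).sub ((h2 _ _).mul h3)).sub ((h1 _).mul (h1 _))⟩

theorem areForms_spinorForms (v : Vertex) : AreForms (spinorForms v) := by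
  by_cases hv : v = .v34
  · subst hv; exact areForms_conicForms
  · rw [spinorForms_of_ne hv]; exact areForms_lineForms _

theorem spin_mem_formLocus {s : ℂ} {y : Fin 7 → ℂ} {v : Vertex} (h : OnComponent s y v) :
    spin s y v ∈ formLocus (spinorForms v) s := by
  by_cases hv : v = .v34
  · subst hv
    obtain ⟨e, h6, h5, h1, h0⟩ := h
    rw [spinorForms, mem_conic_iff]
    simp only [spin]
    simp
    constructor
    · ring
    · linear_combination s * e
  · rw [spinorForms_of_ne hv, formLocus_lineForms, SetLike.mem_coe, mem_line_iff]
    cases v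
    case v34 => exact absurd rfl hv
    all_goals simp [OnComponent] at h
    all_goals simp [Fin.forall_fin_succ, spin, lineP, lineQ, lineVecU, lineVecW, lineU, lineW]
    case v5 => ring
    case v6 => constructor <;> ring
    case v9 => constructor <;> ring

theorem exists_spin_eq {s : ℂ} (hs : s ≠ 0) (hs1 : s ≠ 1) {v : Vertex} {w : Fin 7 → ℂ}
    (hw : w ∈ formLocus (spinorForms v) s) :
    ∃ p q c : ℂ, c ≠ 0 ∧ spin s (curvePt s p q v) v = c • w := by
  by_cases hv : v = .v34
  · subst hv
    rw [spinorForms, mem_conic_iff] at hw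
    obtain ⟨h5, h6, h12, h1, h⟩ := hw
    -- The parametrisation inverts the projection of the conic from its point w₃ = w₄ = 0, with p :
    -- q = −w₃ : (w₄ + s w₃)/s, and reproduces w up to the factor w₄ + s w₃ − w₃. Where this factor
    -- vanishes, the equation of the conic forces w₃ = w₄ = 0; the centre itself is the value at (p
    -- : q) = (s : −1).
    by_cases h0 : w 4 + s * w 3 - w 3 = 0
    · have h3 : w 3 = 0 := by
        have : (1 - s) * w 3 ^ 2 = 0 := by linear_combination -h + (w 0 - (1 - s) * w 3) * h0
        simpa [sub_eq_zero, hs1.symm] using this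
      have h4 : w 4 = 0 := by linear_combination h0 + (1 - s) * h3
      by_cases hw0 : w 0 = 0
      · refine ⟨0, 0, 1, one_ne_zero, ?_⟩
        ext k
        fin_cases k <;> simp [spin, curvePt] <;> grind
      · refine ⟨s * w 0, -w 0, -s ^ 2 * (s - 1) * w 0, by simp [hs, hw0, sub_eq_zero, hs1], ?_⟩
        ext k
        fin_cases k <;> simp [spin, curvePt] <;> grind
    · refine ⟨-w 3, (w 4 + s * w 3) / s, w 4 + s * w 3 - w 3, h0, ?_⟩
      ext k
      fin_cases k <;> simp [spin, curvePt] <;> grind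
  · rw [spinorForms_of_ne hv, formLocus_lineForms, SetLike.mem_coe, mem_line_iff] at hw
    cases v
    case v34 => exact absurd rfl hv
    all_goals simp [Fin.forall_fin_succ, lineP, lineQ, lineVecU, lineVecW, lineU, lineW] at hw
    case v0 => refine ⟨-w 2 / s, w 6, 1, one_ne_zero, ?_⟩; ext k; fin_cases k <;> simp [spin, curvePt] <;> grind
    case v1 => refine ⟨w 2, -w 1, 1, one_ne_zero, ?_⟩; ext k; fin_cases k <;> simp [spin, curvePt] <;> grind
    case v2 => refine ⟨w 1, w 0, 1, one_ne_zero, ?_⟩; ext k; fin_cases k <;> simp [spin, curvePt] <;> grind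
    case v5 => refine ⟨w 3, -w 5, 1, one_ne_zero, ?_⟩; ext k; fin_cases k <;> simp [spin, curvePt] <;> grind
    case v6 => refine ⟨-w 5, -w 6, 1, one_ne_zero, ?_⟩; ext k; fin_cases k <;> simp [spin, curvePt] <;> grind
    case v7 => refine ⟨w 4 / s, -w 5, 1, one_ne_zero, ?_⟩; ext k; fin_cases k <;> simp [spin, curvePt] <;> grind
    case v8 => refine ⟨-w 5, -w 6, 1, one_ne_zero, ?_⟩; ext k; fin_cases k <;> simp [spin, curvePt] <;> grind
    case v9 => refine ⟨-w 3, w 6, 1, one_ne_zero, ?_⟩; ext k; fin_cases k <;> simp [spin, curvePt] <;> grind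
    case v10 => refine ⟨w 1, w 4, 1, one_ne_zero, ?_⟩; ext k; fin_cases k <;> simp [spin, curvePt] <;> grind
    case v11 => refine ⟨-w 0 / s, w 5, 1, one_ne_zero, ?_⟩; ext k; fin_cases k <;> simp [spin, curvePt] <;> grind

/-- The image of ρ satisfies the closed equations. Conversely every solution is a multiple of an
explicit spinor, which lies in the closure even at special parameters by `emb_spin_mem`. -/
theorem spinorComponent_eq {s : ℂ} (hs : s ≠ 0) (hs1 : s ≠ 1) (v : Vertex) :
    spinorComponent 1 s v = pts s (formLocus (spinorForms v) s) := by
  apply Set.Subset.antisymm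
  · refine closure_minimal ?_ (isClosed_pts_formLocus (areForms_spinorForms v) s)
    rintro x ⟨p, hp, hx⟩
    obtain ⟨y, hy, hz, rfl⟩ := exists_eq_of_isRho hs hp hx
    exact emb_mem_coneOver_pts (spin_mem_formLocus hy) hz
  · rintro _ ⟨w, hw, h0, rfl⟩
    obtain ⟨p, q, c, hc, h⟩ := exists_spin_eq hs hs1 hw
    have := emb_spin_mem hs hs1 p q v
    rw [h, emb_smul] at this
    have := smul_mem_coneOver this c⁻¹
    rw [inv_smul_smul₀ hc] at this
    exact this (emb_ne_zero h0)

end SpinorComponents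
section Limits
open MvPolynomial Filter Topology

/-! ### The flat limits -/

theorem limitComponent_subset (a : ℂ) (v : Vertex) :
    limitComponent a v ⊆ pts a (formLocus (spinorForms v) a) :=
  flatLimit_subset_pts_formLocus (areForms_spinorForms v)
    (fun _ h0 h1 => (spinorComponent_eq h0 h1 v).subset) a

theorem emb_mem_limitComponent {a : ℂ} {v : Vertex} {w : ℂ → Fin 7 → ℂ} (hw : Continuous w)
    (h : ∀ s, w s ∈ formLocus (spinorForms v) s) :
    emb a (w a) ∈ coneOver (limitComponent a v) := by
  refine mem_flatLimit_of_section (z := fun s => emb s (w s))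
    (continuous_emb_comp continuous_id hw).continuousAt fun s h0 h1 => ?_
  rw [spinorComponent_eq h0 h1]
  exact emb_mem_coneOver_pts (h s)

theorem emb_mem_limitComponent_of_eventually {a : ℂ} {v : Vertex} {w : ℂ → Fin 7 → ℂ} {b : ℂ}
    (hw : Continuous w) (h : ∀ᶠ ε in 𝓝[≠] b, emb a (w ε) ∈ coneOver (limitComponent a v)) :
    emb a (w b) ∈ coneOver (limitComponent a v) :=
  mem_coneOver_of_eventually (isClosed_flatLimit _ _)
    (continuous_emb_comp continuous_const hw).continuousAt h

theorem pts_subset_of_emb_mem {a : ℂ} {D : Set (Fin 7 → ℂ)} {K : Set PS}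
    (h : ∀ w ∈ D, emb a w ∈ coneOver K) : pts a D ⊆ K := by
  rintro _ ⟨w, hw, h0, rfl⟩
  exact h w hw (emb_ne_zero h0)

theorem continuous_lineVecU (i : Option Vertex) : Continuous (lineVecU i) :=
  continuous_pi fun k => (lineU i k).continuous

theorem continuous_lineVecW (i : Option Vertex) : Continuous (lineVecW i) :=
  continuous_pi fun k => (lineW i k).continuous

/-- Combinations of the basis vectors with constant coefficients are sections over all s, so every
point of the line at s = a is a limit. -/
theorem limitComponent_of_ne (a : ℂ) {v : Vertex} (hv : v ≠ .v34) :
    limitComponent a v = pts a (line (some v) a) := by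
  apply Set.Subset.antisymm
  · rw [← formLocus_lineForms, ← spinorForms_of_ne hv]
    exact limitComponent_subset a v
  · refine pts_subset_of_emb_mem fun w hw => ?_
    obtain ⟨p, q, rfl⟩ := Submodule.mem_span_pair.mp hw
    refine emb_mem_limitComponent (w := fun s => p • lineVecU (some v) s + q • lineVecW (some v) s)
      (((continuous_lineVecU _).const_smul p).add ((continuous_lineVecW _).const_smul q))
      fun s => ?_
    rw [spinorForms_of_ne hv, formLocus_lineForms]
    exact Submodule.mem_span_pair.mpr ⟨p, q, rfl⟩

/-- A point of the plane of the conic `X_t^34`. -/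
def conicVec (s α β γ : ℂ) : Fin 7 → ℂ := ![β, -β - γ, -β - γ, -α, s * α + γ, 0, 0]

theorem conicVec_mem {s α β γ : ℂ} (h : β * γ + (1 - s) * α * γ + α * β = 0) :
    conicVec s α β γ ∈ formLocus conicForms s := by
  rw [mem_conic_iff]
  simp only [conicVec]
  simp
  constructor
  · ring
  · linear_combination h

theorem exists_conicVec_eq {s : ℂ} {w : Fin 7 → ℂ} (hw : w ∈ formLocus conicForms s) :
    ∃ α β γ, conicVec s α β γ = w ∧ β * γ + (1 - s) * α * γ + α * β = 0 := by
  rw [mem_conic_iff] at hw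
  obtain ⟨h5, h6, h12, h1, h⟩ := hw
  refine ⟨-w 3, w 0, w 4 + s * w 3, ?_, ?_⟩
  · ext k
    fin_cases k <;> simp [conicVec] <;> grind
  · linear_combination h

theorem continuous_conicVec {X : Type*} [TopologicalSpace X] {s α β γ : X → ℂ} (hs : Continuous s)
    (hα : Continuous α) (hβ : Continuous β) (hγ : Continuous γ) :
    Continuous fun x => conicVec (s x) (α x) (β x) (γ x) := by
  refine continuous_pi fun k => ?_
  fin_cases k <;> simp [conicVec] <;> fun_prop

/-- When the ratio of the two outer coordinates is fixed as α : γ, the conic equation is linear in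
the middle one. Solving it gives a section over all s. -/
theorem emb_conicVec_mem_limitComponent (a α γ : ℂ) :
    emb a (conicVec a (α * (α + γ)) ((a - 1) * α * γ) (γ * (α + γ))) ∈
      coneOver (limitComponent a .v34) := by
  refine emb_mem_limitComponent
    (w := fun s => conicVec s (α * (α + γ)) ((s - 1) * α * γ) (γ * (α + γ)))
    (continuous_conicVec (by fun_prop) (by fun_prop) (by fun_prop) (by fun_prop)) fun s => ?_
  exact conicVec_mem (by ring)

theorem conicVec_smul (s c α β γ : ℂ) :
    conicVec s (c * α) (c * β) (c * γ) = c • conicVec s α β γ := by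
  ext k
  fin_cases k <;> simp [conicVec] <;> ring

theorem mem_of_smul_mem_coneOver {K : Set PS} {a c : ℂ} (hc : c ≠ 0) {w : Fin 7 → ℂ}
    (h : emb a (c • w) ∈ coneOver K) : emb a w ∈ coneOver K := by
  have := smul_mem_coneOver h c⁻¹
  rwa [← emb_smul, inv_smul_smul₀ hc] at this

theorem limitComponent_zero_v34 :
    limitComponent 0 .v34 = pts 0 (formLocus conicForms 0) := by
  refine Set.Subset.antisymm (limitComponent_subset 0 .v34) (pts_subset_of_emb_mem fun w hw => ?_)
  obtain ⟨α, β, γ, rfl, h⟩ := exists_conicVec_eq hw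
  by_cases h0 : α + γ = 0
  · have hα : α = 0 := by
      have : α ^ 2 = 0 := by linear_combination (α + β) * h0 - h
      simpa using this
    have hγ : γ = 0 := by linear_combination h0 - hα
    -- The point with α = γ = 0 is the value of the parametrisation at (1, −1), where α + γ
    -- vanishes.
    have := smul_mem_coneOver (emb_conicVec_mem_limitComponent 0 1 (-1)) β
    rw [← emb_smul, ← conicVec_smul] at this
    simpa [hα, hγ] using this
  · refine mem_of_smul_mem_coneOver h0 ?_
    rw [← conicVec_smul]
    convert emb_conicVec_mem_limitComponent 0 α γ using 3
    · ring
    · linear_combination h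
    · ring

theorem mem_line_three_iff {w : Fin 7 → ℂ} :
    w ∈ line (some .v34) 1 ↔ ∃ α γ, conicVec 1 α 0 γ = w := by
  constructor
  · intro h
    obtain ⟨p, q, rfl⟩ := Submodule.mem_span_pair.mp h
    refine ⟨p, q, ?_⟩
    ext k
    fin_cases k <;> simp [conicVec, lineVecU, lineVecW, lineU, lineW]
  · rintro ⟨α, γ, rfl⟩
    refine Submodule.mem_span_pair.mpr ⟨α, γ, ?_⟩
    ext k
    fin_cases k <;> simp [conicVec, lineVecU, lineVecW, lineU, lineW]

theorem mem_line_four_iff {w : Fin 7 → ℂ} :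
    w ∈ line none 1 ↔ ∃ α β, conicVec 1 α β (-α) = w := by
  constructor
  · intro h
    obtain ⟨p, q, rfl⟩ := Submodule.mem_span_pair.mp h
    refine ⟨p, q, ?_⟩
    ext k
    fin_cases k <;> simp [conicVec, lineVecU, lineVecW, lineU, lineW] <;> ring
  · rintro ⟨α, γ, rfl⟩
    refine Submodule.mem_span_pair.mpr ⟨α, γ, ?_⟩
    ext k
    fin_cases k <;> simp [conicVec, lineVecU, lineVecW, lineU, lineW] <;> ring

/-- At s = 1 the conic equation factors as β(γ + α) = 0, which bounds the limit by two lines. Each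
line then needs its own family of sections. -/
theorem limitComponent_one_v34 :
    limitComponent 1 .v34 = pts 1 (line (some .v34) 1) ∪ pts 1 (line none 1) := by
  apply Set.Subset.antisymm
  · refine (limitComponent_subset 1 .v34).trans ?_
    rw [← pts_union]
    refine pts_mono 1 fun w hw _ => ?_
    obtain ⟨α, β, γ, rfl, h⟩ := exists_conicVec_eq hw
    have : β * (γ + α) = 0 := by linear_combination h
    rcases mul_eq_zero.mp this with h | h
    · exact Or.inl (mem_line_three_iff.mpr ⟨α, γ, by rw [h]⟩)
    · exact Or.inr (mem_line_four_iff.mpr ⟨α, β, by rw [eq_neg_of_add_eq_zero_left h]⟩)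
  · apply Set.union_subset
    · refine pts_subset_of_emb_mem fun w hw => ?_
      obtain ⟨α, γ, rfl⟩ := mem_line_three_iff.mp hw
      have key : ∀ α γ, α + γ ≠ 0 →
          emb 1 (conicVec 1 α 0 γ) ∈ coneOver (limitComponent 1 .v34) := by
        intro α γ h
        refine mem_of_smul_mem_coneOver h ?_
        rw [← conicVec_smul]
        convert emb_conicVec_mem_limitComponent 1 α γ using 3 <;> ring
      have := emb_mem_limitComponent_of_eventually (a := 1) (v := .v34) (b := 0)
        (w := fun ε => conicVec 1 α 0 (γ + 1 * ε))
        (continuous_conicVec (by fun_prop) (by fun_prop) (by fun_prop) (by fun_prop)) (by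
          filter_upwards [eventually_add_mul_ne_zero (α + γ) one_ne_zero] with ε h
          exact key _ _ (by rwa [← add_assoc]))
      simpa using this
    · refine pts_subset_of_emb_mem fun w hw => ?_
      obtain ⟨α, β, rfl⟩ := mem_line_four_iff.mp hw
      have key : ∀ α β, β ≠ 0 →
          emb 1 (conicVec 1 α β (-α)) ∈ coneOver (limitComponent 1 .v34) := by
        intro α β h
        refine mem_of_smul_mem_coneOver (neg_ne_zero.mpr h) ?_
        rw [← conicVec_smul]
        have := emb_mem_limitComponent (a := 1) (v := .v34)
          (w := fun s => conicVec s ((-β + (s - 1) * α) * α) ((-β + (s - 1) * α) * β) (β * α))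
          (continuous_conicVec (by fun_prop) (by fun_prop) (by fun_prop) (by fun_prop))
          fun s => conicVec_mem (by ring)
        convert this using 3 <;> ring
      have := emb_mem_limitComponent_of_eventually (a := 1) (v := .v34) (b := 0)
        (w := fun ε => conicVec 1 α (β + 1 * ε) (-α))
        (continuous_conicVec (by fun_prop) (by fun_prop) (by fun_prop) (by fun_prop)) (by
          filter_upwards [eventually_add_mul_ne_zero β one_ne_zero] with ε h
          exact key _ _ h)
      simpa using this

theorem limitCurve_eq (a : ℂ) : limitCurve a = ⋃ v, limitComponent a v :=
  flatLimit_iUnion _ a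

end Limits
section LimitComponents
open MvPolynomial Filter Topology

/-! ### The components of the limit curves -/

theorem limitComponent_one_image :
    limitComponent 1 '' {v | v ≠ Vertex.v34} ∪ {pts 1 (line (some .v34) 1), pts 1 (line none 1)} =
      Set.range fun i : Option Vertex => pts 1 (line i 1) := by
  ext Z
  constructor
  · rintro (⟨v, hv, rfl⟩ | rfl | rfl)
    · exact ⟨some v, (limitComponent_of_ne 1 hv).symm⟩
    · exact ⟨_, rfl⟩
    · exact ⟨_, rfl⟩
  · rintro ⟨_ | v, rfl⟩
    · exact Or.inr (Or.inr rfl)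
    · by_cases hv : v = .v34
      · subst hv
        exact Or.inr (Or.inl rfl)
      · exact Or.inl ⟨v, hv, limitComponent_of_ne 1 hv⟩

theorem limitCurve_one : limitCurve 1 = ⋃ i : Option Vertex, pts 1 (line i 1) := by
  rw [limitCurve_eq]
  apply Set.Subset.antisymm
  · refine Set.iUnion_subset fun v => ?_
    by_cases hv : v = .v34
    · subst hv
      rw [limitComponent_one_v34]
      exact Set.union_subset (Set.subset_iUnion_of_subset (some .v34) Set.Subset.rfl)
        (Set.subset_iUnion_of_subset none Set.Subset.rfl)
    · rw [limitComponent_of_ne 1 hv]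
      exact Set.subset_iUnion_of_subset (some v) Set.Subset.rfl
  · refine Set.iUnion_subset fun i => ?_
    rcases i with _ | v
    · exact (Set.subset_union_right.trans limitComponent_one_v34.superset).trans
        (Set.subset_iUnion _ Vertex.v34)
    · by_cases hv : v = .v34
      · subst hv
        exact (Set.subset_union_left.trans limitComponent_one_v34.superset).trans
          (Set.subset_iUnion _ Vertex.v34)
      · rw [← limitComponent_of_ne 1 hv]
        exact Set.subset_iUnion _ v

theorem componentsOf_limitCurve_one :
    componentsOf (limitCurve 1) = Set.range fun i : Option Vertex => pts 1 (line i 1) := by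
  rw [limitCurve_one]
  exact componentsOf_iUnion _ (fun i => isClosed_line i 1) (fun i => isIrreducible_line i 1)
    fun _ _ => line_one_subset

theorem ncard_componentsOf_limitCurve_one : (componentsOf (limitCurve 1)).ncard = 12 := by
  rw [componentsOf_limitCurve_one, ncard_range_of_not_subset _ fun _ _ => line_one_subset,
    card_option_vertex]

/-! #### The limit `t → ∞` -/

theorem limitComponent_zero (v : Vertex) :
    limitComponent 0 v = pts 0 (formLocus (spinorForms v) 0) := by
  by_cases hv : v = .v34
  · subst hv
    exact limitComponent_zero_v34
  · rw [limitComponent_of_ne 0 hv, spinorForms_of_ne hv, formLocus_lineForms]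

theorem isIrreducible_conic : IsIrreducible (pts 0 (formLocus conicForms 0)) := by
  refine isIrreducible_pts (τ := Fin 2)
    ⟨conicVec 0 1 0 0, conicVec_mem (by ring), fun h => ?_⟩
    ![-X 0 * X 1, X 0 * X 1 - X 1 * (X 0 + X 1), X 0 * X 1 - X 1 * (X 0 + X 1), -X 0 * (X 0 + X 1),
      X 1 * (X 0 + X 1), 0, 0]
    (fun v => conicVec 0 (v 0 * (v 0 + v 1)) (-v 0 * v 1) (v 1 * (v 0 + v 1))) ?_ ?_ ?_
  · simpa [conicVec] using congr_fun h 3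
  · intro v k
    fin_cases k <;> simp [conicVec]
  · intro v
    exact conicVec_mem (by ring)
  · intro w hw h0
    obtain ⟨α, β, γ, rfl, h⟩ := exists_conicVec_eq hw
    by_cases h1 : α + γ = 0
    · have hα : α = 0 := by
        have : α ^ 2 = 0 := by linear_combination (α + β) * h1 - h
        simpa using this
      have hγ : γ = 0 := by linear_combination h1 - hα
      have hβ : β ≠ 0 := by
        rintro rfl
        apply h0
        ext k
        fin_cases k <;> simp [conicVec, hα, hγ]
      -- The remaining point α = γ = 0 has the parameter (1, −1), where the middle coordinate is 1.
      refine ⟨![1, -1], β⁻¹, inv_ne_zero hβ, ?_⟩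
      rw [← conicVec_smul]
      simp [hα, hγ, hβ]
    · refine ⟨![α, γ], α + γ, h1, ?_⟩
      rw [← conicVec_smul]
      simp only [Matrix.cons_val_zero, Matrix.cons_val_one]
      congr 1
      · ring
      · linear_combination -h
      · ring

theorem isIrreducible_limitComponent_zero (v : Vertex) : IsIrreducible (limitComponent 0 v) := by
  by_cases hv : v = .v34
  · subst hv
    rw [limitComponent_zero_v34]
    exact isIrreducible_conic
  · rw [limitComponent_of_ne 0 hv]
    exact isIrreducible_line _ _

/-- A point of `X_∞^v` which lies on no other component. -/
def zeroWitness : Vertex → Fin 7 → ℂ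
  | .v34 => ![-1, -1, -1, -2, 2, 0, 0]
  | v => lineVecU (some v) 0 + (2 : ℂ) • lineVecW (some v) 0

theorem zeroWitness_mem (v : Vertex) : zeroWitness v ∈ formLocus (spinorForms v) 0 := by
  by_cases hv : v = .v34
  · subst hv
    rw [spinorForms, mem_conic_iff]
    simp [zeroWitness]
    norm_num
  · rw [spinorForms_of_ne hv, formLocus_lineForms]
    cases v
    case v34 => exact absurd rfl hv
    all_goals exact Submodule.mem_span_pair.mpr ⟨1, 2, by rw [one_smul]; rfl⟩

set_option maxHeartbeats 4000000 in
theorem eq_of_zeroWitness_mem {v v' : Vertex}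
    (h : zeroWitness v ∈ formLocus (spinorForms v') 0) : v = v' := by
  by_cases hv' : v' = .v34
  · subst hv'
    rw [spinorForms, mem_conic_iff] at h
    cases v <;> first
      | rfl
      | (exfalso; revert h; simp [zeroWitness, lineVecU, lineVecW, lineU, lineW]; done)
      | (exfalso; revert h; simp [zeroWitness, lineVecU, lineVecW, lineU, lineW]; norm_num)
  · rw [spinorForms_of_ne hv', formLocus_lineForms, SetLike.mem_coe, mem_line_iff] at h
    cases v' <;> first | exact absurd rfl hv' | skip
    all_goals cases v <;> first
      | rfl
      | (exfalso; revert h; simp [zeroWitness, lineP, lineQ, lineVecU, lineVecW, lineU, lineW,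
          Fin.forall_fin_succ]; done)
      | (exfalso; revert h; simp [zeroWitness, lineP, lineQ, lineVecU, lineVecW, lineU, lineW,
          Fin.forall_fin_succ]; norm_num)

theorem limitComponent_zero_subset {v v' : Vertex}
    (h : limitComponent 0 v ⊆ limitComponent 0 v') : v = v' := by
  rw [limitComponent_zero, limitComponent_zero,
    pts_subset_iff (isConeSet_formLocus (areForms_spinorForms _) _)] at h
  refine eq_of_zeroWitness_mem (h _ (zeroWitness_mem v) fun h0 => ?_)
  -- The witness must be nonzero: the vector 0 lies in every cone, so a zero witness would identify
  -- all vertices.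
  have h1 : ∀ v', v = v' := fun v' => eq_of_zeroWitness_mem (by
    rw [h0]
    simpa using isConeSet_formLocus (areForms_spinorForms v') 0 0 _ (zeroWitness_mem v'))
  exact absurd ((h1 .v0).symm.trans (h1 .v1)) (by simp)

theorem componentsOf_limitCurve_zero :
    componentsOf (limitCurve 0) = Set.range (limitComponent 0) := by
  rw [limitCurve_eq]
  exact componentsOf_iUnion _ (fun v => isClosed_flatLimit _ _) isIrreducible_limitComponent_zero
    fun _ _ => limitComponent_zero_subset

theorem ncard_componentsOf_limitCurve_zero : (componentsOf (limitCurve 0)).ncard = 11 := by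
  rw [componentsOf_limitCurve_zero,
    ncard_range_of_not_subset _ fun _ _ => limitComponent_zero_subset, card_vertex]

/-- The plane of the conic. -/
def conicPlane : Submodule ℂ (Fin 7 → ℂ) :=
  Submodule.span ℂ (Set.range ![conicVec 0 1 0 0, conicVec 0 0 1 0, conicVec 0 0 0 1])

theorem mem_conicPlane_iff {w : Fin 7 → ℂ} : w ∈ conicPlane ↔ ∃ α β γ, conicVec 0 α β γ = w := by
  rw [conicPlane, Submodule.mem_span_range_iff_exists_fun]
  constructor
  · rintro ⟨c, rfl⟩
    refine ⟨c 0, c 1, c 2, ?_⟩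
    ext k
    fin_cases k <;> simp [Fin.sum_univ_three, conicVec] <;> ring
  · rintro ⟨α, β, γ, rfl⟩
    refine ⟨![α, β, γ], ?_⟩
    ext k
    fin_cases k <;> simp [Fin.sum_univ_three, conicVec] <;> ring

theorem finrank_conicPlane : Module.finrank ℂ conicPlane = 3 := by
  have : LinearIndependent ℂ ![conicVec 0 1 0 0, conicVec 0 0 1 0, conicVec 0 0 0 1] := by
    rw [Fintype.linearIndependent_iff]
    intro c h i
    have h0 := congr_fun h 0
    have h3 := congr_fun h 3
    have h4 := congr_fun h 4
    simp [Fin.sum_univ_three, conicVec] at h0 h3 h4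
    fin_cases i <;> assumption
  exact (finrank_span_eq_card this).trans (by simp)

/-- The conic equation has no square terms, so the three coordinate points of the plane lie on the
conic, and they already span. -/
theorem projSpan_conic : projSpan (limitComponent 0 .v34) = pts 0 conicPlane := by
  rw [limitComponent_zero_v34]
  refine projSpan_eq_of_subset (pts_mono 0 fun w hw _ => ?_)
    (Set.range ![conicVec 0 1 0 0, conicVec 0 0 1 0, conicVec 0 0 0 1]) ?_ le_rfl
  · obtain ⟨α, β, γ, h, _⟩ := exists_conicVec_eq hw
    exact mem_conicPlane_iff.mpr ⟨α, β, γ, h⟩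
  · rintro _ ⟨i, rfl⟩
    refine emb_mem_coneOver_pts ?_
    fin_cases i <;> exact conicVec_mem (by simp)

theorem isIrreducibleConic_limitComponent_zero : IsIrreducibleConic (limitComponent 0 .v34) := by
  refine ⟨isIrreducible_limitComponent_zero _, ?_, ?_⟩
  · rw [projSpan_conic]
    exact isPlane_pts finrank_conicPlane
  · let c : Fin 7 → HalfSpin →ₗ[ℂ] ℂ := fun k => LinearMap.proj (freeIdx k)
    -- On the plane at s = 0 one has w₀ = β, w₃ = −α and w₄ = γ, so this form is βγ + αγ + αβ.
    refine ⟨QuadraticMap.linMulLin (c 0) (c 4) - QuadraticMap.linMulLin (c 3) (c 4)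
      - QuadraticMap.linMulLin (c 3) (c 0), ?_⟩
    have hq : ∀ w, (QuadraticMap.linMulLin (c 0) (c 4) - QuadraticMap.linMulLin (c 3) (c 4)
        - QuadraticMap.linMulLin (c 3) (c 0)) (emb 0 w) = w 0 * w 4 - w 3 * w 4 - w 3 * w 0 := by
      intro w
      simp [c, emb_freeIdx]
    rw [projSpan_conic, limitComponent_zero_v34]
    ext x
    constructor
    · rintro ⟨w, hw, h0, rfl⟩
      obtain ⟨α, β, γ, rfl, h⟩ := exists_conicVec_eq hw
      refine ⟨⟨_, mem_conicPlane_iff.mpr ⟨α, β, γ, rfl⟩, h0, rfl⟩, ?_⟩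
      rw [Projectivization.submodule_mk]
      intro z hz
      obtain ⟨k, rfl⟩ := Submodule.mem_span_singleton.mp hz
      rw [QuadraticMap.map_smul, hq]
      simp only [conicVec]
      simp
      right
      linear_combination h
    · rintro ⟨⟨w, hw, h0, rfl⟩, h⟩
      obtain ⟨α, β, γ, rfl⟩ := mem_conicPlane_iff.mp hw
      rw [Projectivization.submodule_mk] at h
      have := h _ (Submodule.mem_span_singleton_self _)
      rw [hq] at this
      simp [conicVec] at this
      exact ⟨_, conicVec_mem (by linear_combination this), h0, rfl⟩

end LimitComponents
section LinearSections
open MvPolynomial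

/-! ### The linear sections of the orthogonal Grassmannian -/

/-- The equations of `Y_t`, `t = [1 : s]`, in the free coordinates of `P_t`. -/
def SectionEqs (s : ℂ) (w : Fin 7 → ℂ) : Prop :=
  w 0 * (w 1 - w 2) = 0 ∧
  (1 - s) * w 3 * (s * w 3 + w 4) - s * (1 - s) * w 3 * w 5 + w 0 * w 3
    - w 0 * (s * w 3 + w 4) = 0 ∧
  w 0 * w 4 + (1 - s) * w 3 * w 1 = 0 ∧
  w 0 * w 4 + (1 - s) * w 3 * w 2 - s * (1 - s) * w 3 * w 6 = 0 ∧
  (s * w 3 + w 4) * (w 2 + w 4) - w 1 * w 3 = 0 ∧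
  w 0 * w 6 = 0 ∧ w 1 * w 5 = 0 ∧ w 1 * w 6 = 0 ∧
  (s * w 3 + w 4) * w 6 - w 2 * w 5 = 0 ∧ (s * w 3 + w 4) * w 6 + w 4 * w 5 = 0

theorem linearSection_eq (s : ℂ) : linearSection 1 s = pts s {w | SectionEqs s w} := by
  ext x
  induction x using Projectivization.ind with
  | h z hz =>
    have hlin : Projectivization.mk ℂ z hz ∈ linearSpace 1 s ↔ ∃ w, emb s w = z := by
      simp only [linearSpace, Set.mem_ofPred_eq, Projectivization.submodule_mk, linearEqs_iff]
      constructor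
      · intro h
        exact h z (Submodule.mem_span_singleton_self z)
      · rintro ⟨w, rfl⟩ z' hz'
        obtain ⟨c, rfl⟩ := Submodule.mem_span_singleton.mp hz'
        exact ⟨c • w, emb_smul s c w⟩
    rw [linearSection, Set.mem_inter_iff, hlin, mk_mem_orthGrassmannian_iff]
    constructor
    · rintro ⟨⟨w, rfl⟩, h⟩
      exact emb_mem_coneOver_pts (D := {w | SectionEqs s w}) ((quadrics_iff s w).mp h) hz
    · rintro ⟨w, hw, h0, he⟩
      obtain ⟨c, rfl⟩ := (Projectivization.mk_eq_mk_iff' ℂ _ _ hz (emb_ne_zero h0)).mp he.symm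
      rw [← emb_smul]
      refine ⟨⟨_, rfl⟩, (quadrics_iff s _).mpr ?_⟩
      obtain ⟨h1, h2, h3, h4, h5, h6, h7, h8, h9, h10⟩ := hw
      simp only [Pi.smul_apply, smul_eq_mul]
      refine ⟨?_, ?_, ?_, ?_, ?_, ?_, ?_, ?_, ?_, ?_⟩
      · linear_combination c ^ 2 * h1
      · linear_combination c ^ 2 * h2
      · linear_combination c ^ 2 * h3
      · linear_combination c ^ 2 * h4
      · linear_combination c ^ 2 * h5
      · linear_combination c ^ 2 * h6
      · linear_combination c ^ 2 * h7
      · linear_combination c ^ 2 * h8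
      · linear_combination c ^ 2 * h9
      · linear_combination c ^ 2 * h10

/-! #### The case `t = ∞` -/

/-- The equations of the plane spanned by `X_∞^5`, `X_∞^6`, `X_∞^8`, `X_∞^9`. -/
def zeroPlaneForms : List (MvPolynomial (Fin 7) (Polynomial ℂ)) := [X 0, X 1, X 2, X 4]

theorem areForms_zeroPlaneForms : AreForms zeroPlaneForms := by
  intro f hf
  simp only [zeroPlaneForms, List.mem_cons, List.not_mem_nil, or_false] at hf
  rcases hf with rfl | rfl | rfl | rfl <;> exact ⟨1, isHomogeneous_X _ _⟩

theorem mem_zeroPlane_iff {s : ℂ} {w : Fin 7 → ℂ} :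
    w ∈ formLocus zeroPlaneForms s ↔ w 0 = 0 ∧ w 1 = 0 ∧ w 2 = 0 ∧ w 4 = 0 := by
  simp [formLocus, zeroPlaneForms]

/-- The plane spanned by `X_∞^5`, `X_∞^6`, `X_∞^8`, `X_∞^9`. -/
def zeroPlane : Submodule ℂ (Fin 7 → ℂ) :=
  Submodule.span ℂ (Set.range ![lineVecU (some .v8) 0, lineVecW (some .v8) 0,
    lineVecU (some .v9) 0])

theorem coe_zeroPlane : (zeroPlane : Set (Fin 7 → ℂ)) = formLocus zeroPlaneForms 0 := by
  ext w
  rw [SetLike.mem_coe, mem_zeroPlane_iff, zeroPlane, Submodule.mem_span_range_iff_exists_fun]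
  constructor
  · rintro ⟨c, rfl⟩
    simp [Fin.sum_univ_three, lineVecU, lineVecW, lineU, lineW]
  · rintro ⟨h0, h1, h2, h4⟩
    refine ⟨![w 5, w 6, -w 3], ?_⟩
    ext k
    fin_cases k <;> simp [Fin.sum_univ_three, lineVecU, lineVecW, lineU, lineW, h0, h1, h2, h4]

theorem finrank_zeroPlane : Module.finrank ℂ zeroPlane = 3 := by
  have : LinearIndependent ℂ ![lineVecU (some .v8) 0, lineVecW (some .v8) 0,
      lineVecU (some .v9) 0] := by
    rw [Fintype.linearIndependent_iff]
    intro c h i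
    have h5 := congr_fun h 5
    have h6 := congr_fun h 6
    have h3 := congr_fun h 3
    simp [Fin.sum_univ_three, lineVecU, lineVecW, lineU, lineW] at h3 h5 h6
    fin_cases i <;> assumption
  exact (finrank_span_eq_card this).trans (by simp)

theorem projSpan_eq_zeroPlane :
    projSpan (limitComponent 0 .v5 ∪ limitComponent 0 .v6 ∪ limitComponent 0 .v8 ∪
      limitComponent 0 .v9) = pts 0 zeroPlane := by
  rw [limitComponent_of_ne 0 (by simp), limitComponent_of_ne 0 (by simp),
    limitComponent_of_ne 0 (by simp), limitComponent_of_ne 0 (by simp), ← pts_union, ← pts_union,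
    ← pts_union]
  refine projSpan_eq_of_subset (pts_mono 0 fun w hw _ => ?_) _ ?_ le_rfl
  · rw [coe_zeroPlane, mem_zeroPlane_iff]
    rcases hw with ((hw | hw) | hw) | hw <;> obtain ⟨p, q, rfl⟩ := Submodule.mem_span_pair.mp hw <;>
      simp [lineVecU, lineVecW, lineU, lineW]
  · rintro _ ⟨i, rfl⟩
    refine emb_mem_coneOver_pts ?_
    fin_cases i
    · exact Or.inl (Or.inr (lineVecU_mem _ _))
    · exact Or.inl (Or.inr (lineVecW_mem _ _))
    · exact Or.inr (lineVecU_mem _ _)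

theorem isIrreducible_zeroPlane : IsIrreducible (pts 0 (formLocus zeroPlaneForms 0)) := by
  refine isIrreducible_pts (τ := Fin 3) ⟨![0, 0, 0, 1, 0, 0, 0], ?_, fun h => ?_⟩
    ![0, 0, 0, X 0, 0, X 1, X 2] (fun v => ![0, 0, 0, v 0, 0, v 1, v 2]) ?_ ?_ ?_
  · simp [mem_zeroPlane_iff]
  · simpa using congr_fun h 3
  · intro v k
    fin_cases k <;> simp
  · intro v
    simp [mem_zeroPlane_iff]
  · intro w hw _
    obtain ⟨h0, h1, h2, h4⟩ := mem_zeroPlane_iff.mp hw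
    refine ⟨![w 3, w 5, w 6], 1, one_ne_zero, ?_⟩
    ext k
    fin_cases k <;> simp [h0, h1, h2, h4]

/-- The vertices whose curves in `X_∞` are components of `Y_∞`. -/
def zeroVertex : Fin 7 → Vertex := ![.v0, .v1, .v2, .v7, .v10, .v11, .v34]

theorem range_zeroVertex : Set.range zeroVertex =
    {Vertex.v0, Vertex.v1, Vertex.v2, Vertex.v7, Vertex.v10, Vertex.v11, Vertex.v34} := by
  ext v
  simp [zeroVertex]
  tauto

theorem zeroVertex_injective : Function.Injective zeroVertex := by
  intro i j h
  fin_cases i <;> fin_cases j <;> first | rfl | simp [zeroVertex] at h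

/-- The components of `Y_∞`. -/
def zeroForms : Option (Fin 7) → List (MvPolynomial (Fin 7) (Polynomial ℂ))
  | none => zeroPlaneForms
  | some i => spinorForms (zeroVertex i)

/-- If w₃ ≠ 0, the equations give the plane when w₀ = 0 and the conic when w₀ ≠ 0. If w₃ = 0, then
w₀w₄ = 0 and the remaining equations leave one of the six lines, except that w₀ = w₁ = w₄ = 0 with
w₅ ≠ 0 gives points of the plane. -/
theorem sectionEqs_zero_iff {w : Fin 7 → ℂ} :
    SectionEqs 0 w ↔ ∃ i, w ∈ formLocus (zeroForms i) 0 := by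
  constructor
  · rintro ⟨h1, h2, h3, h4, h5, h6, h7, h8, h9, h10⟩
    have hl : ∀ i : Fin 7, ∀ h : zeroVertex i ≠ .v34, w ∈ line (some (zeroVertex i)) 0 →
        ∃ i, w ∈ formLocus (zeroForms i) 0 := by
      intro i hi hw
      refine ⟨some i, ?_⟩
      rwa [zeroForms, spinorForms_of_ne hi, formLocus_lineForms]
    have l0 := hl 0 (by simp [zeroVertex])
    have l1 := hl 1 (by simp [zeroVertex])
    have l2 := hl 2 (by simp [zeroVertex])
    have l7 := hl 3 (by simp [zeroVertex])
    have l10 := hl 4 (by simp [zeroVertex])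
    have l11 := hl 5 (by simp [zeroVertex])
    have pl : w 0 = 0 ∧ w 1 = 0 ∧ w 2 = 0 ∧ w 4 = 0 → ∃ i, w ∈ formLocus (zeroForms i) 0 :=
      fun h => ⟨none, mem_zeroPlane_iff.mpr h⟩
    have cn : (w 5 = 0 ∧ w 6 = 0 ∧ w 1 = w 2 ∧ w 1 = -w 0 - w 4 - 0 * w 3 ∧
        w 0 * (w 4 + 0 * w 3) - (1 - 0) * w 3 * (w 4 + 0 * w 3) - w 3 * w 0 = 0) →
        ∃ i, w ∈ formLocus (zeroForms i) 0 :=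
      fun h => ⟨some 6, mem_conic_iff.mpr h⟩
    simp only [mem_line_iff] at l0 l1 l2 l7 l10 l11
    simp [zeroVertex, Fin.forall_fin_succ, lineP, lineQ, lineVecU, lineVecW, lineU, lineW]
      at l0 l1 l2 l7 l10 l11
    by_cases d : w 3 = 0
    · by_cases a : w 0 = 0
      · by_cases e : w 4 = 0
        · by_cases b : w 1 = 0
          · by_cases f : w 5 = 0
            · clear hl; apply l0 <;> grind
            · clear hl; apply pl; refine ⟨?_, ?_, ?_, ?_⟩ <;> grind
          · clear hl; apply l1 <;> grind
        · by_cases b : w 1 = 0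
          · clear hl; apply l7 <;> grind
          · clear hl; apply l10 <;> grind
      · by_cases b : w 1 = 0
        · clear hl; apply l11 <;> grind
        · clear hl; apply l2 <;> grind
    · by_cases a : w 0 = 0
      · clear hl; apply pl; refine ⟨?_, ?_, ?_, ?_⟩ <;> grind
      · clear hl; apply cn; refine ⟨?_, ?_, ?_, ?_, ?_⟩ <;> grind
  · rintro ⟨_ | i, hw⟩
    · obtain ⟨h0, h1, h2, h4⟩ := mem_zeroPlane_iff.mp hw
      simp [SectionEqs, h0, h1, h2, h4]
    · by_cases hi : zeroVertex i = .v34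
      · rw [zeroForms, hi, spinorForms, mem_conic_iff] at hw
        unfold SectionEqs
        grind
      · rw [zeroForms, spinorForms_of_ne hi, formLocus_lineForms] at hw
        obtain ⟨p, q, rfl⟩ := Submodule.mem_span_pair.mp hw
        fin_cases i <;> first
          | exact absurd rfl hi
          | simp [SectionEqs, zeroVertex, lineVecU, lineVecW, lineU, lineW]

theorem areForms_zeroForms (i : Option (Fin 7)) : AreForms (zeroForms i) := by
  rcases i with _ | i
  · exact areForms_zeroPlaneForms
  · exact areForms_spinorForms _

theorem linearSection_zero : linearSection 1 0 = ⋃ i, pts 0 (formLocus (zeroForms i) 0) := by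
  rw [linearSection_eq, ← pts_iUnion]
  congr 1
  ext w
  rw [Set.mem_iUnion]
  exact sectionEqs_zero_iff

theorem zeroForms_subset {i j : Option (Fin 7)}
    (h : pts 0 (formLocus (zeroForms i) 0) ⊆ pts 0 (formLocus (zeroForms j) 0)) : i = j := by
  rcases i with _ | i <;> rcases j with _ | j
  · rfl
  · exfalso
    rw [pts_subset_iff (isConeSet_formLocus (areForms_zeroForms _) _)] at h
    have := h ![0, 0, 0, 1, 0, 1, 1] (mem_zeroPlane_iff.mpr (by simp))
      (fun h => by simpa using congr_fun h 3)
    by_cases hj : zeroVertex j = .v34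
    · rw [zeroForms, hj, spinorForms, mem_conic_iff] at this
      simp at this
    · rw [zeroForms, spinorForms_of_ne hj, formLocus_lineForms, SetLike.mem_coe,
        mem_line_iff] at this
      fin_cases j <;> first
        | exact absurd rfl hj
        | simp [zeroVertex, Fin.forall_fin_succ, lineP, lineQ, lineVecU, lineVecW, lineU, lineW]
            at this
  · exfalso
    rw [pts_subset_iff (isConeSet_formLocus (areForms_zeroForms _) _)] at h
    have := h (zeroWitness (zeroVertex i)) (zeroWitness_mem _) (fun h => by
      have h1 := congr_fun h 0
      have h2 := congr_fun h 1
      have h3 := congr_fun h 2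
      clear * - h1 h2 h3
      fin_cases i <;> simp [zeroVertex, zeroWitness, lineVecU, lineVecW, lineU, lineW] at h1 h2 h3)
    have := mem_zeroPlane_iff.mp this
    clear h
    fin_cases i <;> simp [zeroVertex, zeroWitness, lineVecU, lineVecW, lineU, lineW] at this
  · simp only [zeroForms, ← limitComponent_zero] at h
    rw [zeroVertex_injective (limitComponent_zero_subset h)]

theorem componentsOf_linearSection_zero :
    componentsOf (linearSection 1 0) = Set.range fun i => pts 0 (formLocus (zeroForms i) 0) := by
  rw [linearSection_zero]
  refine componentsOf_iUnion _ (fun i => isClosed_pts_formLocus (areForms_zeroForms i) 0)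
    (fun i => ?_) fun _ _ => zeroForms_subset
  rcases i with _ | i
  · exact isIrreducible_zeroPlane
  · rw [zeroForms, ← limitComponent_zero]
    exact isIrreducible_limitComponent_zero _

theorem ncard_componentsOf_linearSection_zero :
    (componentsOf (linearSection 1 0)).ncard = 8 := by
  rw [componentsOf_linearSection_zero, ncard_range_of_not_subset _ fun _ _ => zeroForms_subset]
  simp

theorem range_zeroForms : (Set.range fun i => pts 0 (formLocus (zeroForms i) 0)) =
    limitComponent 0 '' {Vertex.v0, Vertex.v1, Vertex.v2, Vertex.v7, Vertex.v10, Vertex.v11,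
      Vertex.v34} ∪ {pts 0 (zeroPlane : Set (Fin 7 → ℂ))} := by
  rw [← range_zeroVertex, ← Set.range_comp, coe_zeroPlane]
  ext Z
  constructor
  · rintro ⟨_ | i, rfl⟩
    · exact Or.inr rfl
    · exact Or.inl ⟨i, limitComponent_zero _⟩
  · rintro (⟨i, rfl⟩ | rfl)
    · exact ⟨some i, (limitComponent_zero _).symm⟩
    · exact ⟨none, rfl⟩

end LinearSections
section SectionOne
open MvPolynomial

/-! #### The case `t = 1` -/

/-- The equations of the five components of `Y_1`. -/
def oneForms : Fin 5 → List (MvPolynomial (Fin 7) (Polynomial ℂ)) :=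
  ![[X 0, X 1, X 5, X 3 + X 4],
    [X 0, X 5, X 6, (X 3 + X 4) * (X 2 + X 4) - X 1 * X 3],
    [X 4, X 5, X 6, X 1 - X 2],
    [X 1, X 2, X 4, X 6],
    [X 0, X 1, X 2 + X 4, (X 3 + X 4) * X 6 + X 4 * X 5]]

theorem areForms_oneForms (i : Fin 5) : AreForms (oneForms i) := by
  have h1 : ∀ k, (X k : MvPolynomial (Fin 7) (Polynomial ℂ)).IsHomogeneous 1 := isHomogeneous_X _
  have h2 : ∀ j k, (X j + X k : MvPolynomial (Fin 7) (Polynomial ℂ)).IsHomogeneous 1 :=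
    fun j k => (h1 j).add (h1 k)
  have h3 : (X 1 - X 2 : MvPolynomial (Fin 7) (Polynomial ℂ)).IsHomogeneous 1 :=
    (h1 1).sub (h1 2)
  have h4 : ((X 3 + X 4) * (X 2 + X 4) - X 1 * X 3 :
      MvPolynomial (Fin 7) (Polynomial ℂ)).IsHomogeneous 2 :=
    ((h2 3 4).mul (h2 2 4)).sub ((h1 1).mul (h1 3))
  have h5 : ((X 3 + X 4) * X 6 + X 4 * X 5 :
      MvPolynomial (Fin 7) (Polynomial ℂ)).IsHomogeneous 2 :=
    ((h2 3 4).mul (h1 6)).add ((h1 4).mul (h1 5))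
  intro f hf
  fin_cases i <;> simp [oneForms] at hf <;> rcases hf with rfl | rfl | rfl | rfl
  all_goals with_reducible first
    | exact ⟨1, h1 _⟩
    | exact ⟨1, h2 _ _⟩
    | exact ⟨1, h3⟩
    | exact ⟨2, h4⟩
    | exact ⟨2, h5⟩

/-- The condition on free coordinates that defines a component of `Y_1`. -/
def OnePart (w : Fin 7 → ℂ) : Fin 5 → Prop :=
  ![w 0 = 0 ∧ w 1 = 0 ∧ w 5 = 0 ∧ w 4 = -w 3,
    w 0 = 0 ∧ w 5 = 0 ∧ w 6 = 0 ∧ (w 3 + w 4) * (w 2 + w 4) - w 1 * w 3 = 0,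
    w 4 = 0 ∧ w 5 = 0 ∧ w 6 = 0 ∧ w 1 = w 2,
    w 1 = 0 ∧ w 2 = 0 ∧ w 4 = 0 ∧ w 6 = 0,
    w 0 = 0 ∧ w 1 = 0 ∧ w 4 = -w 2 ∧ (w 3 + w 4) * w 6 + w 4 * w 5 = 0]

theorem mem_oneForms_iff {s : ℂ} {w : Fin 7 → ℂ} {i : Fin 5} :
    w ∈ formLocus (oneForms i) s ↔ OnePart w i := by
  fin_cases i <;> simp [formLocus, oneForms, OnePart, sub_eq_zero] <;> grind

/-- At s = 1 one equation becomes w₀w₄ = 0. If w₀ ≠ 0, then w₄ = w₆ = 0, w₁ = w₂ and w₁w₅ = 0: two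
planes. If w₀ = 0 and w₁ ≠ 0, then w₅ = w₆ = 0 and one quadric remains. If w₀ = w₁ = 0, then (w₃ +
w₄)(w₂ + w₄) = 0, which separates the third plane from the second quadric. -/
theorem sectionEqs_one_iff {w : Fin 7 → ℂ} : SectionEqs 1 w ↔ ∃ i, OnePart w i := by
  constructor
  · rintro ⟨h1, h2, h3, h4, h5, h6, h7, h8, h9, h10⟩
    by_cases a : w 0 = 0
    · by_cases b : w 1 = 0
      · by_cases de : w 4 = -w 3
        · by_cases f : w 5 = 0
          · exact ⟨0, a, b, f, de⟩
          · refine ⟨4, a, b, ?_, ?_⟩ <;> grind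
        · refine ⟨4, a, b, ?_, ?_⟩ <;> grind
      · refine ⟨1, a, ?_, ?_, ?_⟩ <;> grind
    · by_cases f : w 5 = 0
      · refine ⟨2, ?_, ?_, ?_, ?_⟩ <;> grind
      · refine ⟨3, ?_, ?_, ?_, ?_⟩ <;> grind
  · rintro ⟨i, hi⟩
    unfold SectionEqs
    fin_cases i <;> simp [OnePart] at hi <;> grind

theorem linearSection_one : linearSection 1 1 = ⋃ i, pts 1 (formLocus (oneForms i) 1) := by
  rw [linearSection_eq, ← pts_iUnion]
  congr 1
  ext w
  rw [Set.mem_iUnion]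
  simp only [mem_oneForms_iff]
  exact sectionEqs_one_iff

/-- Polynomial parametrisations of the components of `Y_1`. -/
def onePoly {R : Type*} [CommRing R] (v : Fin 4 → R) : Fin 5 → Fin 7 → R :=
  ![![0, 0, v 0, v 1, -v 1, 0, v 2],
    ![0, v 0 * v 2, v 1 * v 2 - (v 0 * v 3 - v 1 * v 3), v 1 * v 3, v 0 * v 3 - v 1 * v 3, 0, 0],
    ![v 0, v 1, v 1, v 2, 0, 0, 0],
    ![v 0, 0, 0, v 1, 0, v 2, 0],
    ![0, 0, v 0 * v 2, v 0 * v 3 + v 0 * v 2, -(v 0 * v 2), v 1 * v 3, v 1 * v 2]]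

theorem onePart_onePoly (v : Fin 4 → ℂ) (i : Fin 5) : OnePart (onePoly v i) i := by
  fin_cases i <;> simp [OnePart, onePoly] <;> ring

/-- A singular matrix with rows (P, b) and (d, R) is the column (x, t) times the row (y, z). This
parametrises both quadrics in Y_1 and displays their rulings. -/
theorem exists_rank_one {P b d R : ℂ} (h : P * R = b * d) :
    ∃ x t y z : ℂ, P = x * y ∧ b = x * z ∧ d = t * y ∧ R = t * z := by
  by_cases hP : P = 0
  · by_cases hb : b = 0
    · exact ⟨0, 1, d, R, by simp [hP, hb]⟩
    · refine ⟨1, R / b, P, b, by simp, by simp, ?_, by field_simp⟩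
      subst hP
      have : d = 0 := by simpa [hb] using h.symm
      simp [this]
  · refine ⟨1, d / P, P, b, by simp, by simp, by field_simp, ?_⟩
    field_simp
    linear_combination h

theorem exists_onePoly_eq {w : Fin 7 → ℂ} {i : Fin 5} (h : OnePart w i) :
    ∃ v : Fin 4 → ℂ, onePoly v i = w := by
  fin_cases i <;> simp [OnePart] at h
  · exact ⟨![w 2, w 3, w 6, 0], by ext k; fin_cases k <;> simp [onePoly, h]⟩
  · obtain ⟨h0, h5, h6, h⟩ := h
    obtain ⟨x, t, y, z, e1, e2, e3, e4⟩ :=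
      exists_rank_one (P := w 3 + w 4) (b := w 1) (d := w 3) (R := w 2 + w 4)
        (by linear_combination h)
    refine ⟨![x, t, z, y], ?_⟩
    ext k
    fin_cases k <;> simp [onePoly] <;> grind
  · exact ⟨![w 0, w 1, w 3, 0], by ext k; fin_cases k <;> simp [onePoly, h]⟩
  · exact ⟨![w 0, w 3, w 5, 0], by ext k; fin_cases k <;> simp [onePoly, h]⟩
  · obtain ⟨h0, h1, h4, h⟩ := h
    obtain ⟨x, t, y, z, e1, e2, e3, e4⟩ :=
      exists_rank_one (P := w 3 + w 4) (b := -w 4) (d := w 5) (R := w 6)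
        (by linear_combination h)
    refine ⟨![x, t, z, y], ?_⟩
    ext k
    fin_cases k <;> simp [onePoly] <;> grind

/-- A point on one component of `Y_1` only. -/
def oneWitness : Fin 5 → Fin 7 → ℂ :=
  ![![0, 0, 2, 1, -1, 0, 1], ![0, 1, 3, 2, -1, 0, 0], ![1, 1, 1, 1, 0, 0, 0],
    ![1, 0, 0, 1, 0, 1, 0], ![0, 0, 1, 2, -1, 2, 2]]

theorem oneWitness_mem (i : Fin 5) : OnePart (oneWitness i) i := by
  fin_cases i <;> simp [OnePart, oneWitness] <;> norm_num

theorem eq_of_oneWitness_mem {i j : Fin 5} (h : OnePart (oneWitness i) j) : i = j := by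
  fin_cases i <;> fin_cases j <;> first
    | rfl
    | (exfalso; revert h; simp [OnePart, oneWitness])

theorem oneWitness_ne_zero (i : Fin 5) : oneWitness i ≠ 0 := fun h => by
  have h2 := congr_fun h 2
  have h3 := congr_fun h 3
  fin_cases i <;> simp [oneWitness] at h2 h3

theorem oneForms_subset {i j : Fin 5}
    (h : pts 1 (formLocus (oneForms i) 1) ⊆ pts 1 (formLocus (oneForms j) 1)) : i = j := by
  rw [pts_subset_iff (isConeSet_formLocus (areForms_oneForms _) _)] at h
  exact eq_of_oneWitness_mem (mem_oneForms_iff.mp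
    (h _ (mem_oneForms_iff.mpr (oneWitness_mem i)) (oneWitness_ne_zero i)))

theorem isIrreducible_onePart (i : Fin 5) : IsIrreducible (pts 1 (formLocus (oneForms i) 1)) := by
  refine isIrreducible_pts
    ⟨_, mem_oneForms_iff.mpr (oneWitness_mem i), oneWitness_ne_zero i⟩
    (onePoly X i) (fun v => onePoly v i) ?_ ?_ ?_
  · intro v k
    fin_cases i <;> fin_cases k <;> simp [onePoly]
  · intro v
    exact mem_oneForms_iff.mpr (onePart_onePoly v i)
  · intro w hw _
    obtain ⟨v, hv⟩ := exists_onePoly_eq (mem_oneForms_iff.mp hw)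
    exact ⟨v, 1, one_ne_zero, by rw [hv, one_smul]⟩

theorem isClosed_onePart (i : Fin 5) : IsClosed (pts 1 (formLocus (oneForms i) 1)) :=
  isClosed_pts_formLocus (areForms_oneForms i) 1

theorem componentsOf_linearSection_one :
    componentsOf (linearSection 1 1) = Set.range fun i => pts 1 (formLocus (oneForms i) 1) := by
  rw [linearSection_one]
  exact componentsOf_iUnion _ isClosed_onePart isIrreducible_onePart fun _ _ => oneForms_subset

theorem ncard_componentsOf_linearSection_one :
    (componentsOf (linearSection 1 1)).ncard = 5 := by
  rw [componentsOf_linearSection_one, ncard_range_of_not_subset _ fun _ _ => oneForms_subset]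
  simp

/-! #### Dimensions -/

/-- Four free coordinates that generate the homogeneous coordinate ring of a component. -/
def oneCoord : Fin 5 → Fin 4 → Fin 7 :=
  ![![2, 3, 4, 6], ![1, 2, 3, 4], ![0, 1, 2, 3], ![0, 3, 5, 6], ![3, 4, 5, 6]]

/-- The free coordinates on a component in terms of these four. -/
def oneLin {R : Type*} [CommRing R] (v : Fin 4 → R) : Fin 5 → Fin 7 → R :=
  ![![0, 0, v 0, v 1, v 2, 0, v 3], ![0, v 0, v 1, v 2, v 3, 0, 0], ![v 0, v 1, v 2, v 3, 0, 0, 0],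
    ![v 0, 0, 0, v 1, 0, v 2, v 3], ![0, 0, -v 1, v 0, v 1, v 2, v 3]]

/-- The equation of a component in these four coordinates. -/
def oneEqn {R : Type*} [CommRing R] (v : Fin 4 → R) : Fin 5 → R :=
  ![v 1 + v 2, (v 2 + v 3) * (v 1 + v 3) - v 0 * v 2, v 1 - v 2, v 3,
    (v 0 + v 1) * v 3 + v 1 * v 2]

/-- All five components are treated alike as surfaces in a ℙ³; for the planes one of the four
coordinates is redundant and the equation is linear. -/
theorem topologicalKrullDim_onePart_le (i : Fin 5) :
    topologicalKrullDim (pts 1 (formLocus (oneForms i) 1)) ≤ 2 := by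
  have hmem : ∀ z ∈ coneOver (pts 1 (formLocus (oneForms i) 1)), ∃ w, OnePart w i ∧ emb 1 w = z :=
    fun z hz => by
      have hc := isConeSet_formLocus (areForms_oneForms i) 1
      obtain ⟨w, hw, h⟩ := exists_of_mem_coneOver_pts hc
        (by simpa using hc 0 _ (mem_oneForms_iff.mpr (oneWitness_mem i))) hz
      exact ⟨w, mem_oneForms_iff.mp hw, h⟩
  refine topologicalKrullDim_le (n := 2) (isClosed_onePart i) (emb 1 (oneLin X i))
    (fun k => freeIdx (oneCoord i k)) ?_ ?_ (oneEqn X i) ?_ ?_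
  · intro k
    rw [emb_freeIdx]
    fin_cases i <;> fin_cases k <;> rfl
  · intro z hz I
    obtain ⟨w, hw, rfl⟩ := hmem z hz
    simp only [emb_freeIdx]
    have h := map_emb (eval fun k => w (oneCoord i k)) 1 (oneLin X i) I
    rw [map_one] at h
    rw [h]
    congr 1
    ext k
    fin_cases i <;> simp [OnePart] at hw <;> fin_cases k <;>
      simp [oneLin, oneCoord, hw]
  · intro h
    -- None of the five equations vanishes at (1, 2, 3, 4).
    have h := congr_arg (eval ![1, 2, 3, 4]) h
    revert h
    fin_cases i <;> simp [oneEqn] <;> norm_num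
  · intro z hz
    obtain ⟨w, hw, rfl⟩ := hmem z hz
    simp only [emb_freeIdx]
    fin_cases i <;> simp [OnePart] at hw <;> simp [oneEqn, oneCoord] <;> grind

end SectionOne
section Scrolls

/-! ### Scrolls -/

theorem mem_submodule_iff_mk_eq {z : HalfSpin} (hz : z ≠ 0) (x : PS) :
    z ∈ x.submodule ↔ Projectivization.mk ℂ z hz = x := by
  induction x using Projectivization.ind with
  | h y hy =>
    rw [Projectivization.submodule_mk, Submodule.mem_span_singleton,
      Projectivization.mk_eq_mk_iff']

theorem projSpan_pair {A B : HalfSpin} (hA : A ≠ 0) (hB : B ≠ 0) :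
    projSpan {Projectivization.mk ℂ A hA, Projectivization.mk ℂ B hB} =
      ((Submodule.span ℂ {A, B}).projectivization : Set PS) := by
  have hs : ∀ (C : HalfSpin) (hC : C ≠ 0), ({Projectivization.mk ℂ C hC} : Set PS) =
      ((Submodule.span ℂ {C}).projectivization : Set PS) := by
    intro C hC
    ext x
    induction x using Projectivization.ind with
    | h y hy =>
      rw [SetLike.mem_coe, Submodule.mk_mem_projectivization_iff,
        Set.mem_singleton_iff, Submodule.mem_span_singleton, Projectivization.mk_eq_mk_iff']
  rw [projSpan, Set.insert_eq, Projectivization.Subspace.span_union, hs A hA, hs B hB,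
    Projectivization.Subspace.span_coe, Projectivization.Subspace.span_coe, Submodule.span_insert,
    map_sup]

theorem projectivization_injective {E E' : Submodule ℂ HalfSpin}
    (h : (E.projectivization : Set PS) = (E'.projectivization : Set PS)) : E = E' := by
  ext z
  by_cases hz : z = 0
  · simp [hz]
  · rw [← Submodule.mk_mem_projectivization_iff E hz,
      ← Submodule.mk_mem_projectivization_iff E' hz, ← SetLike.mem_coe, h,
      SetLike.mem_coe]

theorem exists_lineEquiv {U W U' W' : HalfSpin} (h : LinearIndependent ℂ ![U, W])
    (h' : LinearIndependent ℂ ![U', W']) :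
    ∃ φ : Submodule.span ℂ {U, W} ≃ₗ[ℂ] Submodule.span ℂ {U', W'},
      ∀ (α β : ℂ) (x : Submodule.span ℂ {U, W}), (x : HalfSpin) = α • U + β • W →
        (φ x : HalfSpin) = α • U' + β • W' := by
  have e : ∀ A B : HalfSpin, Set.range ![A, B] = {A, B} := by
    intro A B
    rw [Matrix.range_cons, Matrix.range_cons, Matrix.range_empty, Set.union_empty]
    rfl
  rw [← e, ← e]
  refine ⟨(Module.Basis.span h).equiv (Module.Basis.span h') (Equiv.refl _), ?_⟩
  intro α β x hx
  have : x = α • Module.Basis.span h 0 + β • Module.Basis.span h 1 := by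
    ext1
    rw [hx]
    simp [Module.Basis.span_apply]
  rw [this, map_add, map_smul, map_smul, Module.Basis.equiv_apply, Module.Basis.equiv_apply]
  simp [Module.Basis.span_apply]

theorem add_ne_zero_of_linearIndependent {V : Type*} [AddCommGroup V] [Module ℂ V] {U W : V}
    (h : LinearIndependent ℂ ![U, W]) : U + W ≠ 0 := fun h0 =>
  one_ne_zero (LinearIndependent.pair_iff.mp h 1 1 (by simpa using h0)).1

theorem injective_three_points {U W : HalfSpin} (h : LinearIndependent ℂ ![U, W])
    (hU : U ≠ 0) (hUW : U + W ≠ 0) (hW : W ≠ 0) :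
    Function.Injective ![Projectivization.mk ℂ U hU, Projectivization.mk ℂ (U + W) hUW,
      Projectivization.mk ℂ W hW] := by
  have h := LinearIndependent.pair_iff.mp h
  have h01 : Projectivization.mk ℂ U hU ≠ Projectivization.mk ℂ (U + W) hUW := by
    rw [Ne, Projectivization.mk_eq_mk_iff']
    rintro ⟨c, hc⟩
    have := h (c - 1) c (by
      rw [sub_smul, one_smul]
      rw [smul_add] at hc
      rw [← sub_eq_zero.mpr hc]
      abel)
    grind
  have h02 : Projectivization.mk ℂ U hU ≠ Projectivization.mk ℂ W hW := by
    rw [Ne, Projectivization.mk_eq_mk_iff']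
    rintro ⟨c, hc⟩
    have := h (-1) c (by rw [hc]; simp)
    grind
  have h12 : Projectivization.mk ℂ (U + W) hUW ≠ Projectivization.mk ℂ W hW := by
    rw [Ne, Projectivization.mk_eq_mk_iff']
    rintro ⟨c, hc⟩
    have := h (-1) (c - 1) (by rw [sub_smul, one_smul, hc]; simp)
    grind
  intro i j hij
  fin_cases i <;> fin_cases j <;> simp at hij ⊢ <;> first
    | exact h01 hij | exact h01 hij.symm | exact h02 hij | exact h02 hij.symm
    | exact h12 hij | exact h12 hij.symm

/-- Both triples are normalised as U, U + W, W, so the isomorphism is induced by U ↦ U′, W ↦ W′. It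
is unique because any competing lift ψ multiplies U, W and U + W by scalars relative to their
targets, and additivity makes the three scalars equal; thus ψ is a multiple of φ. -/
theorem isScroll_of_linearIndependent {U W U' W' : HalfSpin} (h : LinearIndependent ℂ ![U, W])
    (h' : LinearIndependent ℂ ![U', W']) {Z : Set PS}
    (hZ : ∀ z, ∀ hz : z ≠ 0, Projectivization.mk ℂ z hz ∈ Z ↔ ∃ α β : ℂ, (α ≠ 0 ∨ β ≠ 0) ∧
      ∃ l m : ℂ, l • (α • U + β • W) + m • (α • U' + β • W') = z)
    (hU : U ≠ 0) (hUW : U + W ≠ 0) (hW : W ≠ 0)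
    (hU' : U' ≠ 0) (hUW' : U' + W' ≠ 0) (hW' : W' ≠ 0) :
    IsScroll Z ((Submodule.span ℂ {U, W}).projectivization : Set PS)
      ((Submodule.span ℂ {U', W'}).projectivization : Set PS)
      ![Projectivization.mk ℂ U hU, Projectivization.mk ℂ (U + W) hUW, Projectivization.mk ℂ W hW]
      ![Projectivization.mk ℂ U' hU', Projectivization.mk ℂ (U' + W') hUW',
        Projectivization.mk ℂ W' hW'] := by
  have hmem : ∀ A B : HalfSpin, A ∈ Submodule.span ℂ {A, B} ∧ A + B ∈ Submodule.span ℂ {A, B} ∧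
      B ∈ Submodule.span ℂ {A, B} := by
    intro A B
    have hA : A ∈ Submodule.span ℂ {A, B} := Submodule.subset_span (by simp)
    have hB : B ∈ Submodule.span ℂ {A, B} := Submodule.subset_span (by simp)
    exact ⟨hA, Submodule.add_mem _ hA hB, hB⟩
  have hpt : ∀ (A B : HalfSpin) (hA : A ≠ 0) (hAB : A + B ≠ 0) (hB : B ≠ 0) (i : Fin 3),
      ![Projectivization.mk ℂ A hA, Projectivization.mk ℂ (A + B) hAB,
        Projectivization.mk ℂ B hB] i ∈ ((Submodule.span ℂ {A, B}).projectivization : Set PS) := by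
    intro A B hA hAB hB i
    fin_cases i
    · exact (Submodule.mk_mem_projectivization_iff _ hA).mpr (hmem A B).1
    · exact (Submodule.mk_mem_projectivization_iff _ hAB).mpr (hmem A B).2.1
    · exact (Submodule.mk_mem_projectivization_iff _ hB).mpr (hmem A B).2.2
  have hex := exists_lineEquiv h h'
  set E := Submodule.span ℂ {U, W} with hE
  set E' := Submodule.span ℂ {U', W'} with hE'
  obtain ⟨φ, hφ⟩ := hex
  have hfin : Module.finrank ℂ E = 2 := by
    have := finrank_span_eq_card h
    rw [Matrix.range_cons, Matrix.range_cons, Matrix.range_empty, Set.union_empty] at this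
    exact this
  have hφ0 : ∀ x : E, (x : HalfSpin) ≠ 0 → (φ x : HalfSpin) ≠ 0 := by
    intro x hx h0
    apply hx
    have : φ x = 0 := Subtype.ext h0
    rw [(LinearEquiv.map_eq_zero_iff φ).mp this]
    rfl
  have hrep : ∀ a : (E.projectivization : Set PS), (a : PS).rep ∈ E := fun a =>
    (Submodule.mk_mem_projectivization_iff E (a : PS).rep_nonzero).mp
      (by rw [Projectivization.mk_rep]; exact a.2)
  -- The image is computed on the chosen representative; `hf` shows that every other representative
  -- gives the same point.
  let f : ((E.projectivization : Set PS) : Type) → ((E'.projectivization : Set PS) : Type) := fun a =>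
    ⟨Projectivization.mk ℂ (φ ⟨(a : PS).rep, hrep a⟩) (hφ0 _ (a : PS).rep_nonzero),
      (Submodule.mk_mem_projectivization_iff E' _).mpr (φ _).2⟩
  have hf : ∀ (a : (E.projectivization : Set PS)) (x : E), (x : HalfSpin) ∈ (a : PS).submodule →
      (φ x : HalfSpin) ∈ (f a : PS).submodule := by
    intro a x hx
    rw [Projectivization.submodule_eq, Submodule.mem_span_singleton] at hx
    obtain ⟨c, hc⟩ := hx
    have : x = c • ⟨(a : PS).rep, hrep a⟩ := Subtype.ext hc.symm
    rw [this, map_smul, Projectivization.submodule_mk]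
    exact Submodule.smul_mem _ c (Submodule.mem_span_singleton_self _)
  refine ⟨injective_three_points h hU hUW hW, injective_three_points h' hU' hUW' hW',
    hpt U W hU hUW hW, hpt U' W' hU' hUW' hW', f, ?_, ?_⟩
  · intro g
    constructor
    · rintro ⟨⟨F, F', ψ, -, hF, hF', hψ⟩, hg⟩
      -- The planes of vectors in `IsLineIso` are determined by their points, so ψ is a map from E
      -- to E′.
      obtain rfl := projectivization_injective hF
      obtain rfl := projectivization_injective hF'
      have key : ∀ (i : Fin 3) (A A' : HalfSpin) (hA : A ∈ E) (hA0 : A ≠ 0) (hA0' : A' ≠ 0),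
          Projectivization.mk ℂ A hA0 = ![Projectivization.mk ℂ U hU,
            Projectivization.mk ℂ (U + W) hUW, Projectivization.mk ℂ W hW] i →
          Projectivization.mk ℂ A' hA0' = ![Projectivization.mk ℂ U' hU',
            Projectivization.mk ℂ (U' + W') hUW', Projectivization.mk ℂ W' hW'] i →
          ∃ c : ℂ, c • A' = (ψ ⟨A, hA⟩ : HalfSpin) := by
        intro i A A' hA hA0 hA0' e e'
        let a : (E.projectivization : Set PS) := ⟨Projectivization.mk ℂ A hA0,
          (Submodule.mk_mem_projectivization_iff E hA0).mpr hA⟩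
        have h1 := hψ a ⟨A, hA⟩ (by
          rw [Projectivization.submodule_mk]; exact Submodule.mem_span_singleton_self _)
        rw [hg i a e, ← e', Projectivization.submodule_mk] at h1
        exact Submodule.mem_span_singleton.mp h1
      obtain ⟨c₀, h₀⟩ := key 0 U U' (hmem U W).1 hU hU' rfl rfl
      obtain ⟨c₁, h₁⟩ := key 1 (U + W) (U' + W') (hmem U W).2.1 hUW hUW' rfl rfl
      obtain ⟨c₂, h₂⟩ := key 2 W W' (hmem U W).2.2 hW hW' rfl rfl
      have hsum : (ψ ⟨U + W, (hmem U W).2.1⟩ : HalfSpin) =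
          (ψ ⟨U, (hmem U W).1⟩ : HalfSpin) + (ψ ⟨W, (hmem U W).2.2⟩ : HalfSpin) := by
        rw [← Submodule.coe_add, ← map_add]
        rfl
      rw [← h₀, ← h₁, ← h₂] at hsum
      have hc := LinearIndependent.pair_iff.mp h' (c₁ - c₀) (c₁ - c₂) (by
        rw [sub_smul, sub_smul]
        rw [smul_add] at hsum
        rw [← sub_eq_zero] at hsum
        rw [← hsum]
        abel)
      have e0 : c₀ = c₁ := (sub_eq_zero.mp hc.1).symm
      have e2 : c₂ = c₁ := (sub_eq_zero.mp hc.2).symm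
      have hψφ : ∀ x : E, (ψ x : HalfSpin) = c₁ • (φ x : HalfSpin) := by
        intro x
        obtain ⟨α, β, hx⟩ := Submodule.mem_span_pair.mp x.2
        have hx' : x = α • ⟨U, (hmem U W).1⟩ + β • ⟨W, (hmem U W).2.2⟩ :=
          Subtype.ext hx.symm
        rw [hφ α β x hx.symm, hx', map_add, map_smul, map_smul, Submodule.coe_add,
          Submodule.coe_smul, Submodule.coe_smul, ← h₀, ← h₂, e0, e2, smul_add, smul_comm α,
          smul_comm β]
      funext a
      apply Subtype.ext
      have h1 := hψ a ⟨(a : PS).rep, hrep a⟩ (by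
        rw [Projectivization.submodule_eq]; exact Submodule.mem_span_singleton_self _)
      have hne : (ψ ⟨(a : PS).rep, hrep a⟩ : HalfSpin) ≠ 0 := by
        intro h0
        have : ψ ⟨(a : PS).rep, hrep a⟩ = 0 := Subtype.ext h0
        exact (a : PS).rep_nonzero (congr_arg Subtype.val ((LinearEquiv.map_eq_zero_iff ψ).mp this))
      rw [mem_submodule_iff_mk_eq hne] at h1
      rw [← h1]
      refine (Projectivization.mk_eq_mk_iff' ℂ _ _ _ _).mpr ⟨c₁, ?_⟩
      exact (hψφ _).symm
    · rintro rfl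
      refine ⟨⟨E, E', φ, hfin, rfl, rfl, hf⟩, ?_⟩
      have key : ∀ (α β : ℂ) (hA : α • U + β • W ≠ 0) (hA' : α • U' + β • W' ≠ 0)
          (a : (E.projectivization : Set PS)), (a : PS) = Projectivization.mk ℂ _ hA →
          (f a : PS) = Projectivization.mk ℂ _ hA' := by
        intro α β hA hA' a ha
        have hx : α • U + β • W ∈ E := Submodule.mem_span_pair.mpr ⟨α, β, rfl⟩
        have h1 := hf a ⟨_, hx⟩ (by
          rw [ha, Projectivization.submodule_mk]; exact Submodule.mem_span_singleton_self _)
        rw [hφ α β _ rfl, mem_submodule_iff_mk_eq hA'] at h1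
        exact h1.symm
      intro i a ha
      fin_cases i
      · have := key 1 0 (by simpa using hU) (by simpa using hU') a
        simp only [one_smul, zero_smul, add_zero] at this
        exact this ha
      · have := key 1 1 (by simpa using hUW) (by simpa using hUW') a
        simp only [one_smul] at this
        exact this ha
      · have := key 0 1 (by simpa using hW) (by simpa using hW') a
        simp only [one_smul, zero_smul, zero_add] at this
        exact this ha
  · ext x
    induction x using Projectivization.ind with
    | h z hz =>
      rw [hZ, Set.mem_iUnion]
      have hspan : ∀ (a : (E.projectivization : Set PS)) (α β : ℂ) (hA : α • U + β • W ≠ 0)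
          (_ : (a : PS) = Projectivization.mk ℂ _ hA),
          Projectivization.mk ℂ z hz ∈ projSpan {(a : PS), (f a : PS)} ↔
            ∃ l m : ℂ, l • (α • U + β • W) + m • (α • U' + β • W') = z := by
        intro a α β hA ha
        have hx : α • U + β • W ∈ E := Submodule.mem_span_pair.mpr ⟨α, β, rfl⟩
        have h1 := hf a ⟨_, hx⟩ (by
          rw [ha, Projectivization.submodule_mk]; exact Submodule.mem_span_singleton_self _)
        have h2 := hφ0 ⟨_, hx⟩ hA
        rw [hφ α β _ rfl] at h1 h2
        rw [mem_submodule_iff_mk_eq h2] at h1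
        rw [← h1, ha, projSpan_pair, SetLike.mem_coe,
          Submodule.mk_mem_projectivization_iff, Submodule.mem_span_pair]
      constructor
      · rintro ⟨α, β, hαβ, hlm⟩
        have hA : α • U + β • W ≠ 0 := by
          intro h0
          have := LinearIndependent.pair_iff.mp h α β h0
          grind
        have hx : α • U + β • W ∈ E := Submodule.mem_span_pair.mpr ⟨α, β, rfl⟩
        exact ⟨⟨Projectivization.mk ℂ _ hA,
          (Submodule.mk_mem_projectivization_iff E hA).mpr hx⟩,
          (hspan _ α β hA rfl).mpr hlm⟩
      · rintro ⟨a, ha⟩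
        obtain ⟨α, β, hab⟩ := Submodule.mem_span_pair.mp (hrep a)
        have hA : α • U + β • W ≠ 0 := by rw [hab]; exact (a : PS).rep_nonzero
        refine ⟨α, β, ?_, (hspan a α β hA ?_).mp ha⟩
        · by_contra! h0
          rw [h0.1, h0.2] at hA
          simp at hA
        · simp only [hab, Projectivization.mk_rep]

end Scrolls
section Nodes

/-! ### The nodes of `X_1` and the components of `Y_1` -/

theorem linearIndependent_emb {s : ℂ} {u w : Fin 7 → ℂ} (h : LinearIndependent ℂ ![u, w]) :
    LinearIndependent ℂ ![emb s u, emb s w] := by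
  rw [LinearIndependent.pair_iff] at h ⊢
  intro a b hab
  refine h a b (embLin_injective s ?_)
  rw [map_add, map_smul, map_smul, map_zero]
  exact hab

theorem pts_span_pair (s : ℂ) (u w : Fin 7 → ℂ) :
    pts s (Submodule.span ℂ {u, w}) =
      ((Submodule.span ℂ {emb s u, emb s w}).projectivization : Set PS) := by
  rw [pts_submodule, Submodule.map_span, Set.image_pair]
  rfl

theorem isScroll_pts {s : ℂ} {u w u' w' : Fin 7 → ℂ} (h : LinearIndependent ℂ ![u, w])
    (h' : LinearIndependent ℂ ![u', w']) {D : Set (Fin 7 → ℂ)} (hDc : IsConeSet D)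
    (hD : ∀ v, v ≠ 0 → (v ∈ D ↔ ∃ α β : ℂ, (α ≠ 0 ∨ β ≠ 0) ∧
      ∃ l m : ℂ, l • (α • u + β • w) + m • (α • u' + β • w') = v)) :
    IsScroll (pts s D) (pts s (Submodule.span ℂ {u, w})) (pts s (Submodule.span ℂ {u', w'}))
      ![pt s u (h.ne_zero 0), pt s (u + w) (add_ne_zero_of_linearIndependent h),
        pt s w (h.ne_zero 1)]
      ![pt s u' (h'.ne_zero 0), pt s (u' + w') (add_ne_zero_of_linearIndependent h'),
        pt s w' (h'.ne_zero 1)] := by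
  have hi := linearIndependent_emb (s := s) h
  have hi' := linearIndependent_emb (s := s) h'
  have key := isScroll_of_linearIndependent hi hi' (Z := pts s D) ?_ (hi.ne_zero 0)
    (add_ne_zero_of_linearIndependent hi) (hi.ne_zero 1) (hi'.ne_zero 0)
    (add_ne_zero_of_linearIndependent hi') (hi'.ne_zero 1)
  · rw [pts_span_pair, pts_span_pair]
    simp only [pt, emb_add]
    exact key
  · have he : ∀ (α β l m : ℂ), l • (α • emb s u + β • emb s w) + m • (α • emb s u' + β • emb s w') =
        emb s (l • (α • u + β • w) + m • (α • u' + β • w')) := by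
      intro α β l m
      simp only [emb_add, emb_smul]
    intro z hz
    simp only [he]
    constructor
    · rintro ⟨v, hv, h0, hvz⟩
      obtain ⟨c, rfl⟩ := (Projectivization.mk_eq_mk_iff' ℂ _ _ hz (emb_ne_zero h0)).mp hvz.symm
      obtain ⟨α, β, hαβ, l, m, rfl⟩ := (hD v h0).mp hv
      refine ⟨α, β, hαβ, c * l, c * m, ?_⟩
      rw [← emb_smul, mul_smul, mul_smul, ← smul_add]
    · rintro ⟨α, β, hαβ, l, m, rfl⟩
      rw [mk_emb_mem_pts_iff hDc]
      refine (hD _ ?_).mpr ⟨α, β, hαβ, l, m, rfl⟩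
      rintro h0
      rw [h0] at hz
      exact hz (map_zero (embLin s))

theorem line_inter_eq {i j : Option Vertex} {s : ℂ} {n : Fin 7 → ℂ} (h0 : n ≠ 0)
    (hi : n ∈ line i s) (hj : n ∈ line j s)
    (h : ∀ w, w ∈ line i s → w ∈ line j s → ∃ c : ℂ, c • n = w) :
    pts s (line i s) ∩ pts s (line j s) = {pt s n h0} := by
  rw [pts_inter (isConeSet_submodule _)]
  exact pts_eq_singleton h0 ⟨hi, hj⟩ fun w hw => h w hw.1 hw.2

/-- Vectors representing the nodes of `X_1`, in the order `0–1`, `1–2`, `1–10`, `3–9`, `3–4`,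
`3–10`, `5–6`, `6–7`, `6–9`, `8–11`, `7–8`, `0–8`. -/
def nodeVec : Fin 12 → Fin 7 → ℂ :=
  ![![0, 0, 1, 0, 0, 0, 0], ![0, 1, 1, 0, 0, 0, 0], ![0, 1, 0, 0, 0, 0, 0],
    ![0, 0, 0, -1, 1, 0, 0], ![0, 1, 1, -1, 0, 0, 0], ![0, 1, 1, 0, -1, 0, 0],
    ![0, 0, 0, 1, 0, 1, 0], ![0, 0, -1, 0, 1, 1, -1], ![0, 0, -1, -1, 1, 0, -1],
    ![0, 0, 0, 0, 0, 1, 0], ![0, 0, 0, 0, 0, 1, -1], ![0, 0, 0, 0, 0, 0, -1]]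

theorem nodeVec_ne_zero (k : Fin 12) : nodeVec k ≠ 0 := by
  intro h
  have h1 := congr_fun h 1
  have h2 := congr_fun h 2
  have h3 := congr_fun h 3
  have h5 := congr_fun h 5
  have h6 := congr_fun h 6
  fin_cases k <;> simp [nodeVec] at h1 h2 h3 h5 h6

/-- The nodes of `X_1`. -/
def node (k : Fin 12) : PS := pt 1 (nodeVec k) (nodeVec_ne_zero k)

/-- The two lines through a node. -/
def nodeLines : Fin 12 → Option Vertex × Option Vertex :=
  ![(some .v0, some .v1), (some .v1, some .v2), (some .v1, some .v10), (some .v34, some .v9),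
    (some .v34, none), (some .v34, some .v10), (some .v5, some .v6), (some .v6, some .v7),
    (some .v6, some .v9), (some .v8, some .v11), (some .v7, some .v8), (some .v0, some .v8)]

set_option maxHeartbeats 1000000 in
theorem line_inter_line (k : Fin 12) :
    pts 1 (line (nodeLines k).1 1) ∩ pts 1 (line (nodeLines k).2 1) = {node k} := by
  refine line_inter_eq _ ?_ ?_ ?_
  · rw [mem_line_iff]
    fin_cases k <;> simp [nodeVec, nodeLines, Fin.forall_fin_succ, lineP, lineQ, lineVecU,
      lineVecW, lineU, lineW]
  · rw [mem_line_iff]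
    fin_cases k <;> simp [nodeVec, nodeLines, Fin.forall_fin_succ, lineP, lineQ, lineVecU,
      lineVecW, lineU, lineW]
  · intro w h1 h2
    rw [mem_line_iff] at h1 h2
    -- The scalar is read off at a coordinate where the node vector is 1, or −1 for the last node.
    refine ⟨![w 2, w 1, w 1, w 4, w 1, w 1, w 3, w 5, w 4, w 5, w 5, -w 6] k, ?_⟩
    fin_cases k <;> simp [nodeLines, Fin.forall_fin_succ, lineP, lineQ, lineVecU,
      lineVecW, lineU, lineW] at h1 h2 <;> ext i <;> fin_cases i <;> simp [nodeVec] <;> grind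

theorem four_inter_nonempty_two :
    (pts 1 (line none 1) ∩ pts 1 (line (some .v2) 1)).Nonempty := by
  refine ⟨pt 1 ![1, -1, -1, 0, 0, 0, 0] (fun h => by simpa using congr_fun h 0), ?_, ?_⟩ <;>
  · refine (pt_mem_pts_iff (isConeSet_submodule _) _).mpr (mem_line_iff.mpr ?_)
    simp [Fin.forall_fin_succ, lineP, lineQ, lineVecU, lineVecW, lineU, lineW]

theorem four_inter_nonempty_five :
    (pts 1 (line none 1) ∩ pts 1 (line (some .v5) 1)).Nonempty := by
  refine ⟨pt 1 ![-1, 0, 0, 1, 0, 0, 0] (fun h => by simpa using congr_fun h 0), ?_, ?_⟩ <;>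
  · refine (pt_mem_pts_iff (isConeSet_submodule _) _).mpr (mem_line_iff.mpr ?_)
    simp [Fin.forall_fin_succ, lineP, lineQ, lineVecU, lineVecW, lineU, lineW]

theorem linearIndependent_nodeVec (k l : Fin 12)
    (h : (k = 0 ∧ l = 2) ∨ (k = 3 ∧ l = 5) ∨ (k = 6 ∧ l = 8) ∨ (k = 9 ∧ l = 11)) :
    LinearIndependent ℂ ![nodeVec k, nodeVec l] := by
  rw [LinearIndependent.pair_iff]
  intro a b hab
  have h1 := congr_fun hab 1
  have h2 := congr_fun hab 2
  have h3 := congr_fun hab 3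
  have h5 := congr_fun hab 5
  have h6 := congr_fun hab 6
  rcases h with ⟨rfl, rfl⟩ | ⟨rfl, rfl⟩ | ⟨rfl, rfl⟩ | ⟨rfl, rfl⟩ <;>
    simp [nodeVec] at h1 h2 h3 h5 h6 <;> grind

theorem span_nodeVec (k l : Fin 12) (i : Option Vertex)
    (h : (k = 0 ∧ l = 2 ∧ i = some .v1) ∨ (k = 3 ∧ l = 5 ∧ i = some .v34) ∨
      (k = 6 ∧ l = 8 ∧ i = some .v6) ∨ (k = 9 ∧ l = 11 ∧ i = some .v8)) :
    Submodule.span ℂ {nodeVec k, nodeVec l} = line i 1 := by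
  have hli := linearIndependent_nodeVec k l (by tauto)
  apply Submodule.eq_of_le_of_finrank_eq
  · rw [Submodule.span_le]
    rintro x (rfl | rfl) <;> rw [SetLike.mem_coe, mem_line_iff] <;>
      rcases h with ⟨rfl, rfl, rfl⟩ | ⟨rfl, rfl, rfl⟩ | ⟨rfl, rfl, rfl⟩ | ⟨rfl, rfl, rfl⟩ <;>
      simp [nodeVec, Fin.forall_fin_succ, lineP, lineQ, lineVecU, lineVecW, lineU, lineW]
  · rw [finrank_line]
    have := finrank_span_eq_card hli
    rw [Matrix.range_cons, Matrix.range_cons, Matrix.range_empty, Set.union_empty] at this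
    exact this

theorem isScroll_one :
    IsScroll (pts 1 (formLocus (oneForms 1) 1)) (pts 1 (line (some .v1) 1))
      (pts 1 (line (some .v34) 1)) ![node 0, node 1, node 2] ![node 3, node 4, node 5] := by
  have key := isScroll_pts (s := 1) (linearIndependent_nodeVec 0 2 (by simp))
    (linearIndependent_nodeVec 3 5 (by simp)) (isConeSet_formLocus (areForms_oneForms 1) 1) ?_
  · rw [span_nodeVec 0 2 (some .v1) (by simp), span_nodeVec 3 5 (some .v34) (by simp)] at key
    -- The node vectors are scaled so that the middle one of each triple is the sum of the outer
    -- two, as the normalised form of the scroll requires.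
    have e1 : nodeVec 0 + nodeVec 2 = nodeVec 1 := by
      ext k; fin_cases k <;> simp [nodeVec]
    have e2 : nodeVec 3 + nodeVec 5 = nodeVec 4 := by
      ext k; fin_cases k <;> simp [nodeVec]
    simp only [e1, e2] at key
    exact key
  · intro v hv
    rw [mem_oneForms_iff]
    constructor
    · rintro ⟨h0, h5, h6, h⟩
      obtain ⟨x, t, y, z, h1, h2, h3, h4⟩ :=
        exists_rank_one (P := v 3 + v 4) (b := v 1) (d := v 3) (R := v 2 + v 4)
          (by linear_combination h)
      refine ⟨t, x, ?_, z + y, -y, ?_⟩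
      · by_contra! hc
        apply hv
        ext k
        fin_cases k <;> simp <;> grind
      · ext k
        fin_cases k <;> simp [nodeVec] <;> grind
    · rintro ⟨α, β, -, l, m, rfl⟩
      simp [OnePart, nodeVec]
      ring

theorem isScroll_four :
    IsScroll (pts 1 (formLocus (oneForms 4) 1)) (pts 1 (line (some .v6) 1))
      (pts 1 (line (some .v8) 1)) ![node 6, node 7, node 8] ![node 9, node 10, node 11] := by
  have key := isScroll_pts (s := 1) (linearIndependent_nodeVec 6 8 (by simp))
    (linearIndependent_nodeVec 9 11 (by simp)) (isConeSet_formLocus (areForms_oneForms 4) 1) ?_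
  · rw [span_nodeVec 6 8 (some .v6) (by simp), span_nodeVec 9 11 (some .v8) (by simp)] at key
    have e1 : nodeVec 6 + nodeVec 8 = nodeVec 7 := by
      ext k; fin_cases k <;> simp [nodeVec]
    have e2 : nodeVec 9 + nodeVec 11 = nodeVec 10 := by
      ext k; fin_cases k <;> simp [nodeVec]
    simp only [e1, e2] at key
    exact key
  · intro v hv
    rw [mem_oneForms_iff]
    constructor
    · rintro ⟨h0, h1, h2, h⟩
      -- The matrix now has rows (v₃ + v₄, −v₄) and (v₅, v₆), and the roles are exchanged: the row
      -- (y, z) selects the ruling line, the column (x, t) the position on it.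
      obtain ⟨x, t, y, z, h3, h4, h5, h6⟩ :=
        exists_rank_one (P := v 3 + v 4) (b := -v 4) (d := v 5) (R := v 6)
          (by linear_combination h)
      refine ⟨y, -z, ?_, x, t - x, ?_⟩
      · by_contra! hc
        apply hv
        ext k
        fin_cases k <;> simp <;> grind
      · ext k
        fin_cases k <;> simp [nodeVec] <;> grind
    · rintro ⟨α, β, -, l, m, rfl⟩
      simp [OnePart, nodeVec]
      ring

/-! #### Spans -/

theorem line_subset_onePart {i : Option Vertex} {k : Fin 5}
    (h : ∀ p q : ℂ, OnePart (p • lineVecU i 1 + q • lineVecW i 1) k) :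
    pts 1 (line i 1) ⊆ pts 1 (formLocus (oneForms k) 1) := by
  refine pts_mono 1 fun w hw _ => ?_
  obtain ⟨p, q, rfl⟩ := Submodule.mem_span_pair.mp hw
  exact mem_oneForms_iff.mpr (h p q)

theorem projSpan_lines_eq {i j : Option Vertex} {k : Fin 5}
    (h : ∀ p q r t : ℂ,
      OnePart (p • lineVecU i 1 + q • lineVecW i 1 + (r • lineVecU j 1 + t • lineVecW j 1)) k)
    (h' : ∀ w, OnePart w k → ∃ p q r t : ℂ,
      p • lineVecU i 1 + q • lineVecW i 1 + (r • lineVecU j 1 + t • lineVecW j 1) = w) :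
    projSpan (pts 1 (line i 1) ∪ pts 1 (line j 1)) = pts 1 (formLocus (oneForms k) 1) := by
  rw [projSpan_pts_union]
  congr 1
  ext w
  rw [SetLike.mem_coe, mem_oneForms_iff, Submodule.mem_sup]
  constructor
  · rintro ⟨x, hx, y, hy, rfl⟩
    obtain ⟨p, q, rfl⟩ := Submodule.mem_span_pair.mp hx
    obtain ⟨r, t, rfl⟩ := Submodule.mem_span_pair.mp hy
    exact h p q r t
  · intro hw
    obtain ⟨p, q, r, t, rfl⟩ := h' w hw
    exact ⟨_, Submodule.mem_span_pair.mpr ⟨p, q, rfl⟩, _,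
      Submodule.mem_span_pair.mpr ⟨r, t, rfl⟩, rfl⟩

theorem projSpan_zero_nine : projSpan (pts 1 (line (some .v0) 1) ∪ pts 1 (line (some .v9) 1)) =
    pts 1 (formLocus (oneForms 0) 1) := by
  refine projSpan_lines_eq (fun p q r t => ?_) fun w hw => ⟨w 2, w 6, -w 3, 0, ?_⟩
  · simp [OnePart, lineVecU, lineVecW, lineU, lineW]
  · simp [OnePart] at hw
    ext k
    fin_cases k <;> simp [lineVecU, lineVecW, lineU, lineW, hw]

theorem projSpan_two_four : projSpan (pts 1 (line (some .v2) 1) ∪ pts 1 (line none 1)) =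
    pts 1 (formLocus (oneForms 2) 1) := by
  refine projSpan_lines_eq (fun p q r t => ?_) fun w hw => ⟨w 0, w 1 + w 3, -w 3, 0, ?_⟩
  · simp [OnePart, lineVecU, lineVecW, lineU, lineW]
  · simp [OnePart] at hw
    ext k
    fin_cases k <;> simp [lineVecU, lineVecW, lineU, lineW, hw]

theorem projSpan_five_eleven :
    projSpan (pts 1 (line (some .v5) 1) ∪ pts 1 (line (some .v11) 1)) =
      pts 1 (formLocus (oneForms 3) 1) := by
  refine projSpan_lines_eq (fun p q r t => ?_) fun w hw => ⟨w 3, 0, w 0, w 5 - w 3, ?_⟩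
  · simp [OnePart, lineVecU, lineVecW, lineU, lineW]
  · simp [OnePart] at hw
    ext k
    fin_cases k <;> simp [lineVecU, lineVecW, lineU, lineW, hw]

/-! #### Dimensions -/

/-- A node and a line on each component of `Y_1`. -/
def oneFlag : Fin 5 → Fin 12 × Option Vertex :=
  ![(0, some .v0), (0, some .v1), (1, some .v2), (6, some .v5), (6, some .v6)]

theorem not_line_subset_singleton (i : Option Vertex) (s : ℂ) (x : PS) :
    ¬ pts s (line i s) ⊆ {x} := by
  intro h
  have hli := linearIndependent_line i s
  have h1 : pt s (lineVecU i s) (hli.ne_zero 0) = x := h ⟨_, lineVecU_mem i s, hli.ne_zero 0, rfl⟩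
  have h2 : pt s (lineVecW i s) (hli.ne_zero 1) = x := h ⟨_, lineVecW_mem i s, hli.ne_zero 1, rfl⟩
  obtain ⟨c, hc⟩ := (pt_eq_pt_iff _ _).mp (h1.trans h2.symm)
  have := LinearIndependent.pair_iff.mp hli (-1) c (by rw [hc]; simp)
  simp at this

theorem oneFlag_line_subset (i : Fin 5) :
    pts 1 (line (oneFlag i).2 1) ⊆ pts 1 (formLocus (oneForms i) 1) := by
  refine line_subset_onePart fun p q => ?_
  fin_cases i <;> simp [oneFlag, OnePart, lineVecU, lineVecW, lineU, lineW]
  all_goals and_intros <;> ring1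

theorem not_onePart_subset_line (i : Fin 5) :
    ¬ pts 1 (formLocus (oneForms i) 1) ⊆ pts 1 (line (oneFlag i).2 1) := by
  rw [pts_subset_iff (isConeSet_submodule _)]
  intro h
  have := mem_line_iff.mp
    (h _ (mem_oneForms_iff.mpr (oneWitness_mem i)) (oneWitness_ne_zero i))
  clear h
  revert this
  fin_cases i <;> simp [oneFlag, oneWitness, Fin.forall_fin_succ, lineP, lineQ, lineVecU, lineVecW,
    lineU, lineW]

theorem topologicalKrullDim_onePart (i : Fin 5) :
    topologicalKrullDim (pts 1 (formLocus (oneForms i) 1)) = 2 := by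
  refine le_antisymm (topologicalKrullDim_onePart_le i) ?_
  -- A node is closed as the intersection of two closed lines; it is the bottom of the flag that
  -- gives the lower bound.
  have hn : IsClosed {node (oneFlag i).1} := by
    rw [← line_inter_line]
    exact (isClosed_line _ _).inter (isClosed_line _ _)
  have hmem : node (oneFlag i).1 ∈ pts 1 (line (oneFlag i).2 1) := by
    refine (pt_mem_pts_iff (isConeSet_submodule _) _).mpr (mem_line_iff.mpr ?_)
    fin_cases i <;> simp [oneFlag, nodeVec, Fin.forall_fin_succ, lineP, lineQ, lineVecU, lineVecW,
      lineU, lineW]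
  exact two_le_topologicalKrullDim isIrreducible_singleton (isIrreducible_line _ _)
    (isIrreducible_onePart i) hn (isClosed_line _ _) (isClosed_onePart i)
    ⟨Set.singleton_subset_iff.mpr hmem, not_line_subset_singleton _ _ _⟩
    ⟨oneFlag_line_subset i, not_onePart_subset_line i⟩

end Nodes
end SpinorModel
end

/-! ### Assembly of the two limits -/

open SpinorModel in
theorem mainTheorem7 :
    -- Part 1, the limit `t → 1`. The component `34` splits into two lines `3` and `4`,
    -- which the nodes on them tell apart.
    (∃ L₃ L₄ S T : Set PS,
      ∃ n₀₁ n₁₂ n₁₁₀ n₃₉ n₃₄ n₃₁₀ n₅₆ n₆₇ n₆₉ n₈₁₁ n₇₈ n₀₈ : PS,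
      (∀ v, v ≠ Vertex.v34 → IsLine (limitComponent 1 v)) ∧
      IsLine L₃ ∧ IsLine L₄ ∧ limitComponent 1 .v34 = L₃ ∪ L₄ ∧
      componentsOf (limitCurve 1) = limitComponent 1 '' {v | v ≠ Vertex.v34} ∪ {L₃, L₄} ∧
      (componentsOf (limitCurve 1)).ncard = 12 ∧
      (L₄ ∩ limitComponent 1 .v2).Nonempty ∧ (L₄ ∩ limitComponent 1 .v5).Nonempty ∧
      limitComponent 1 .v0 ∩ limitComponent 1 .v1 = {n₀₁} ∧
      limitComponent 1 .v1 ∩ limitComponent 1 .v2 = {n₁₂} ∧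
      limitComponent 1 .v1 ∩ limitComponent 1 .v10 = {n₁₁₀} ∧
      L₃ ∩ limitComponent 1 .v9 = {n₃₉} ∧
      L₃ ∩ L₄ = {n₃₄} ∧
      L₃ ∩ limitComponent 1 .v10 = {n₃₁₀} ∧
      limitComponent 1 .v5 ∩ limitComponent 1 .v6 = {n₅₆} ∧
      limitComponent 1 .v6 ∩ limitComponent 1 .v7 = {n₆₇} ∧
      limitComponent 1 .v6 ∩ limitComponent 1 .v9 = {n₆₉} ∧
      limitComponent 1 .v8 ∩ limitComponent 1 .v11 = {n₈₁₁} ∧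
      limitComponent 1 .v7 ∩ limitComponent 1 .v8 = {n₇₈} ∧
      limitComponent 1 .v0 ∩ limitComponent 1 .v8 = {n₀₈} ∧
      IsScroll S (limitComponent 1 .v1) L₃ ![n₀₁, n₁₂, n₁₁₀] ![n₃₉, n₃₄, n₃₁₀] ∧
      limitComponent 1 .v10 ⊆ S ∧
      IsScroll T (limitComponent 1 .v6) (limitComponent 1 .v8)
        ![n₅₆, n₆₇, n₆₉] ![n₈₁₁, n₇₈, n₀₈] ∧
      limitComponent 1 .v7 ⊆ T ∧
      componentsOf (linearSection 1 1) =
        {projSpan (limitComponent 1 .v0 ∪ limitComponent 1 .v9),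
          S,
          projSpan (limitComponent 1 .v2 ∪ L₄),
          projSpan (limitComponent 1 .v5 ∪ limitComponent 1 .v11),
          T} ∧
      (componentsOf (linearSection 1 1)).ncard = 5 ∧
      ∀ Z ∈ componentsOf (linearSection 1 1), topologicalKrullDim Z = 2) ∧
    -- Part 2, the limit `t → ∞`.
    ((∀ v, v ≠ Vertex.v34 → IsLine (limitComponent 0 v)) ∧
      IsIrreducibleConic (limitComponent 0 .v34) ∧
      componentsOf (limitCurve 0) = Set.range (limitComponent 0) ∧
      (componentsOf (limitCurve 0)).ncard = 11 ∧
      IsPlane (projSpan (limitComponent 0 .v5 ∪ limitComponent 0 .v6 ∪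
        limitComponent 0 .v8 ∪ limitComponent 0 .v9)) ∧
      componentsOf (linearSection 1 0) =
        limitComponent 0 '' {Vertex.v0, Vertex.v1, Vertex.v2, Vertex.v7, Vertex.v10,
          Vertex.v11, Vertex.v34} ∪
        {projSpan (limitComponent 0 .v5 ∪ limitComponent 0 .v6 ∪
          limitComponent 0 .v8 ∪ limitComponent 0 .v9)} ∧
      (componentsOf (linearSection 1 0)).ncard = 8) := by
  have h1 : ∀ v, v ≠ Vertex.v34 → limitComponent 1 v = pts 1 (line (some v) 1) :=
    fun v hv => limitComponent_of_ne 1 hv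
  refine ⟨⟨pts 1 (line (some .v34) 1), pts 1 (line none 1), pts 1 (formLocus (oneForms 1) 1),
    pts 1 (formLocus (oneForms 4) 1), node 0, node 1, node 2, node 3, node 4, node 5, node 6,
    node 7, node 8, node 9, node 10, node 11, ?_⟩, ?_⟩
  · rw [h1 .v0 (by simp), h1 .v1 (by simp), h1 .v2 (by simp), h1 .v5 (by simp), h1 .v6 (by simp),
      h1 .v7 (by simp), h1 .v8 (by simp), h1 .v9 (by simp), h1 .v10 (by simp), h1 .v11 (by simp),
      limitComponent_one_image, componentsOf_limitCurve_one, projSpan_zero_nine, projSpan_two_four,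
      projSpan_five_eleven]
    have hcomp : (Set.range fun i => pts 1 (formLocus (oneForms i) 1)) =
        {pts 1 (formLocus (oneForms 0) 1), pts 1 (formLocus (oneForms 1) 1),
          pts 1 (formLocus (oneForms 2) 1), pts 1 (formLocus (oneForms 3) 1),
          pts 1 (formLocus (oneForms 4) 1)} := by
      ext Z
      simp [Fin.exists_fin_succ, eq_comm]
    refine ⟨fun v hv => ?_, isLine_pts (finrank_line _ _), isLine_pts (finrank_line _ _),
      limitComponent_one_v34, rfl, ?_, four_inter_nonempty_two, four_inter_nonempty_five,
      line_inter_line 0, line_inter_line 1, line_inter_line 2, line_inter_line 3,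
      line_inter_line 4, line_inter_line 5, line_inter_line 6, line_inter_line 7,
      line_inter_line 8, line_inter_line 9, line_inter_line 10, line_inter_line 11,
      isScroll_one, ?_, isScroll_four, ?_, ?_, ncard_componentsOf_linearSection_one, ?_⟩
    · rw [h1 v hv]
      exact isLine_pts (finrank_line _ _)
    · rw [← componentsOf_limitCurve_one, ncard_componentsOf_limitCurve_one]
    · refine line_subset_onePart fun p q => ?_
      simp [OnePart, lineVecU, lineVecW, lineU, lineW]
    · refine line_subset_onePart fun p q => ?_
      simp [OnePart, lineVecU, lineVecW, lineU, lineW]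
    · rw [componentsOf_linearSection_one, hcomp]
    · rw [componentsOf_linearSection_one]
      rintro _ ⟨i, rfl⟩
      exact topologicalKrullDim_onePart i
  · refine ⟨fun v hv => ?_, isIrreducibleConic_limitComponent_zero, componentsOf_limitCurve_zero,
      ncard_componentsOf_limitCurve_zero, ?_, ?_, ncard_componentsOf_linearSection_zero⟩
    · rw [limitComponent_of_ne 0 hv]
      exact isLine_pts (finrank_line _ _)
    · rw [projSpan_eq_zeroPlane]
      exact isPlane_pts finrank_zeroPlane
    · rw [projSpan_eq_zeroPlane, componentsOf_linearSection_zero, range_zeroForms]
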